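/- Theorem (string equations of the generalized solution). Let $p,\bar p$ be nonzero integers and $\hbar$ a real parameter. \textbf{Conventions.} Let $R=\mathbb C[[t_1,t_2,\dots,\bar t_1,\bar t_2,\dots]]$ be the ring of formal power series, where $t_n,\bar t_n$ have weight $n$, and let $\mathbf\Lambda^n=(\delta_{i,j-n})$, $\mathbf\Delta=(i\,\delta_{ij})$ ($i,j\in\mathbb Z$). For $\epsilon=\pm1$ let $\mathcal E_\epsilon$ be the ring of those $\mathbb Z\times\mathbb Z$ matrices $A$ over $R$ for which there is an $N$ such that a monomial of weight $w$ can occur in $A_{ij}$ only if $\epsilon(j-i)\le N+w$; every coefficient of a product is then a finite sum. Matrices are identified with difference operators by $\sum_n \mathrm{diag}[a_n(i)]\mathbf\Lambda^n\leftrightarrow\sum_n a_n(s)e^{n\hbar\partial_s}$, $s=\hbar i$. Given a numerical matrix $\mathbf U(0,0)=(u_{ij})$, lower triangular if $\epsilon=1$ and upper triangular if $\epsilon=-1$, put $$\mathbf U(t,\bar t)=\exp\Bigl(\hbar^{-1}\sum_{n\ge1}t_n\mathbf\Lambda^n\Bigr)\,\mathbf U(0,0)\,\exp\Bigl(-\hbar^{-1}\sum_{n\ge1}\bar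 t_n\mathbf\Lambda^{-n}\Bigr).$$ The associated solution of the Toda lattice hierarchy is given by invertible $W,\bar W\in\mathcal E_\epsilon$ with $\mathbf U(t,\bar t)=W^{-1}\bar W$, $W$ lower triangular with unit diagonal and $\bar W$ upper triangular with invertible diagonal entries; its Lax and Orlov--Shulman operators are $$L=W\mathbf\Lambda W^{-1},\quad M=W\Bigl(\hbar\mathbf\Delta+\sum_{n\ge1}nt_n\mathbf\Lambda^n\Bigr)W^{-1},\quad \bar L=\bar W\mathbf\Lambda\bar W^{-1},\quad \bar M=\bar W\Bigl(\hbar\mathbf\Delta-\sum_{n\ge1}n\bar t_n\mathbf\Lambda^{-n}\Bigr)\bar W^{-1}.$$ \textbf{(a) The case $p+\bar p\ne0$.} Let $\hbar>0$, let $\mathrm{const}\in\mathbb C\setminus\{0\}$, and let $\epsilon$ be the sign of $p+\bar p$. Let $\gamma:[a,b]\to\mathbb C\setminus(-\infty,0]$, $a<0<b$, be a $C^1$ path through the saddle point $\gamma(0)=1$ of $\varphi(z)=z^{\bar p}-\frac{\bar p}{p+\bar p}z^{p+\bar p}$, with $\mathrm{Re}\,(p\bar p\,\gamma'(0)^2)>0$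 and $\mathrm{Re}\,\varphi(\gamma(\tau))<\mathrm{Re}\,\varphi(1)$ for $\tau\neq0$. For $j\in\mathbb Z$ and $\lambda>0$ put $$u_j(\lambda)=c(\lambda)\int_{\lambda\gamma}\mu^{(\bar p-1)/2-j-1}\exp\hbar^{-1}\Bigl(\lambda^p\mu^{\bar p}-\frac{\bar p}{p+\bar p}\mu^{p+\bar p}\Bigr)d\mu,\qquad c(\lambda)=\mathrm{const}\cdot\lambda^{(p-1)/2}\exp\hbar^{-1}\Bigl(\frac{-p}{p+\bar p}\lambda^{p+\bar p}\Bigr)$$ (principal branches). Then there is exactly one matrix $\mathbf U(0,0)=(u_{ij})$, lower triangular if $p+\bar p>0$ and upper triangular if $p+\bar p<0$, such that for all $j$ asymptotically $$u_j(\lambda)\sim\sum_{i=j}^{\infty}\lambda^{-i-1}u_{ij}\ (\lambda\to+\infty)\quad\text{if }p+\bar p>0,\qquad u_j(\lambda)\sim\sum_{i=-\infty}^{j}\lambda^{-i-1}u_{ij}\ (\lambda\to+0)\quad\text{if }p+\bar p<0;$$ there is exactly one pair $(W,\bar W)$ as above for this matrix; and the operators $L,M,\bar L,\bar M$ of this solution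 satisfy the string equations $$L^p=\frac1{\bar p}\bar M\bar L^{-\bar p}-\hbar\frac{\bar p-1}{2\bar p}\bar L^{-\bar p}+\bar L^p,\qquad \bar L^{\bar p}=-\frac1pML^{-p}+\hbar\frac{p-1}{2p}L^{-p}+L^{\bar p}.$$ \textbf{(b) The case $p+\bar p=0$.} Let $\hbar\neq0$ be such that none of $\frac12-\frac1\hbar$ and $x_i=\frac12-\frac1\hbar+\frac{i+1/2}{p}$ $(i\in\mathbb Z)$ is a pole of $\Gamma$, and let $$u_{ij}=(-\hbar)^{(i+\frac12)/p}\,\frac{\Gamma\bigl(\frac12-\frac1\hbar+\frac{i+1/2}{p}\bigr)}{\Gamma\bigl(\frac12-\frac1\hbar\bigr)}\,\delta_{ij}$$ (principal branch of the power). Then, for $\epsilon=1$ and for $\epsilon=-1$, there is exactly one pair $(W,\bar W)$ as above, and the same string equations hold. Moreover this matrix is the one given by the generating functions: if $\hbar<0$, $x_j>0$ and $\lambda>0$, the integral in $$u_j(\lambda)=c(\lambda)\int_0^\infty\mu^{(\bar p-1)/2-j-1}\exp\hbar^{-1}\bigl(\lambda^p\mu^{\bar p}-\bar p\log\mu\bigr)d\mu,\qquad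 c(\lambda)=\frac{|p|\,(-\hbar)^{\frac1\hbar-\frac12}}{\Gamma(\frac12-\frac1\hbar)}\,\lambda^{(p-1)/2}\exp\hbar^{-1}(-p\log\lambda),$$ converges absolutely and $u_j(\lambda)=\lambda^{-j-1}u_{jj}$. -/

import Mathlib

open Filter Asymptotics Topology

noncomputable section

namespace Toda

/-! ### Formal power series in the times -/

/-- Labels of the time variables: `Sum.inl n` is `t_n`, `Sum.inr n` is `t̄_n`, for `n ≥ 1`. -/
abbrev Times : Type := ℕ+ ⊕ ℕ+

/-- The coefficient ring `ℂ[[t, t̄]]`. -/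
abbrev Coeff : Type := MvPowerSeries Times ℂ

/-- The weight of a monomial in `t, t̄`: both `t_n` and `t̄_n` have weight `n`. -/
def weight : (Times →₀ ℕ) →+ ℕ := Finsupp.weight (Sum.elim PNat.val PNat.val)

/-- The variable `t_n` for an integer `n ≥ 1`, and `0` for `n ≤ 0`. -/
def tVar (n : ℤ) : Coeff :=
  if h : 0 < n then MvPowerSeries.X (Sum.inl ⟨n.toNat, by omega⟩) else 0

/-- The variable `t̄_n` for an integer `n ≥ 1`, and `0` for `n ≤ 0`. -/
def tbarVar (n : ℤ) : Coeff :=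
  if h : 0 < n then MvPowerSeries.X (Sum.inr ⟨n.toNat, by omega⟩) else 0

theorem weight_of_coeff_tVar_ne {n : ℤ} {m : Times →₀ ℕ}
    (h : MvPowerSeries.coeff m (tVar n) ≠ 0) : (weight m : ℤ) = n := by
  classical
  unfold tVar at h
  split_ifs at h with hn
  · rw [MvPowerSeries.coeff_X] at h
    split_ifs at h with hm
    · subst hm
      rw [weight, Finsupp.weight_single, one_smul]
      exact Int.toNat_of_nonneg hn.le
    · exact absurd rfl h
  · simp at h

theorem weight_of_coeff_tbarVar_ne {n : ℤ} {m : Times →₀ ℕ}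
    (h : MvPowerSeries.coeff m (tbarVar n) ≠ 0) : (weight m : ℤ) = n := by
  classical
  unfold tbarVar at h
  split_ifs at h with hn
  · rw [MvPowerSeries.coeff_X] at h
    split_ifs at h with hm
    · subst hm
      rw [weight, Finsupp.weight_single, one_smul]
      exact Int.toNat_of_nonneg hn.le
    · exact absurd rfl h
  · simp at h

/-- For a sequence `x_1, x_2, …` (given as `x : ℤ → Coeff`), the generating series
`∑_{n ≥ 1} x_n z^n`. -/
def timeSeries (x : ℤ → Coeff) : PowerSeries Coeff :=
  PowerSeries.mk fun n => if n = 0 then 0 else x n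

/-- The fundamental Schur function `S_n(x)`, the coefficient of `z^n` in
`exp (∑_{k ≥ 1} x_k z^k) = ∑_r (1/r!) (∑_{k ≥ 1} x_k z^k)^r`; the terms with `r > n` do not
contribute to `z^n`. It is `0` for `n < 0`. -/
def schur (x : ℤ → Coeff) (n : ℤ) : Coeff :=
  if 0 ≤ n then
    ∑ r ∈ Finset.range (n.toNat + 1),
      ((r.factorial : ℂ)⁻¹) • PowerSeries.coeff n.toNat (timeSeries x ^ r)
  else 0

theorem weight_of_coeff_timeSeries_pow_ne {x : ℤ → Coeff}
    (hx : ∀ (n : ℤ) (m : Times →₀ ℕ), MvPowerSeries.coeff m (x n) ≠ 0 → (weight m : ℤ) = n)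
    (r : ℕ) : ∀ (n : ℕ) (m : Times →₀ ℕ),
      MvPowerSeries.coeff m (PowerSeries.coeff n (timeSeries x ^ r)) ≠ 0 → weight m = n := by
  classical
  induction r with
  | zero =>
    intro n m h
    rw [pow_zero, PowerSeries.coeff_one] at h
    split_ifs at h with hn
    · rw [MvPowerSeries.coeff_one] at h
      split_ifs at h with hm
      · simp [hm, hn]
      · exact absurd rfl h
    · simp at h
  | succ r ih =>
    intro n m h
    rw [pow_succ, PowerSeries.coeff_mul, map_sum] at h
    obtain ⟨⟨a, b⟩, hab, h⟩ := Finset.exists_ne_zero_of_sum_ne_zero h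
    rw [MvPowerSeries.coeff_mul] at h
    obtain ⟨⟨c, d⟩, hcd, h⟩ := Finset.exists_ne_zero_of_sum_ne_zero h
    have h1 := ih a c (left_ne_zero_of_mul h)
    have h2 := right_ne_zero_of_mul h
    simp only [timeSeries, PowerSeries.coeff_mk] at h2
    split_ifs at h2 with hb
    · simp at h2
    · have h3 := hx b d h2
      rw [Finset.HasAntidiagonal.mem_antidiagonal] at hab hcd
      simp only at hab hcd h1 h3
      rw [← hcd, map_add]
      omega

theorem weight_of_coeff_schur_ne {x : ℤ → Coeff}
    (hx : ∀ (n : ℤ) (m : Times →₀ ℕ), MvPowerSeries.coeff m (x n) ≠ 0 → (weight m : ℤ) = n)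
    {n : ℤ} {m : Times →₀ ℕ} (h : MvPowerSeries.coeff m (schur x n) ≠ 0) :
    (weight m : ℤ) = n := by
  unfold schur at h
  split_ifs at h with hn
  · rw [map_sum] at h
    obtain ⟨r, -, h⟩ := Finset.exists_ne_zero_of_sum_ne_zero h
    rw [map_smul] at h
    have := weight_of_coeff_timeSeries_pow_ne hx r _ _ (right_ne_zero_of_mul h)
    omega
  · simp at h

/-! ### The ring of formal infinite matrices

A `ℤ × ℤ` matrix `A` is the difference operator `∑_n a_n(s) e^{n∂_s}`, `a_n(i) = A i (i + n)`.
For `ε = 1` we take the matrices over `ℂ[[t, t̄]]` such that the part of weight `w` has only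
finitely many upper diagonals, at most `w + const`; for `ε = -1` the same with lower diagonals.
In each coefficient of a product of two such matrices only finitely many terms are nonzero. -/

/-- The condition `ε (j - i) ≤ N + weight m` on the coefficients of `t^m` in `A i j`. -/
def IsBounded (ε : ℤˣ) (N : ℤ) (A : Matrix ℤ ℤ Coeff) : Prop :=
  ∀ (i j : ℤ) (m : Times →₀ ℕ), MvPowerSeries.coeff m (A i j) ≠ 0 →
    (ε : ℤ) * (j - i) ≤ N + weight m

theorem IsBounded.mono {ε : ℤˣ} {N N' : ℤ} {A : Matrix ℤ ℤ Coeff} (h : IsBounded ε N A)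
    (hN : N ≤ N') : IsBounded ε N' A :=
  fun i j m hm => (h i j m hm).trans (by omega)

/-- The matrices that satisfy the bound for some `N`. -/
def opSubmodule (ε : ℤˣ) : Submodule ℂ (Matrix ℤ ℤ Coeff) where
  carrier := {A | ∃ N : ℤ, IsBounded ε N A}
  zero_mem' := ⟨0, fun i j m h => absurd (by simp) h⟩
  add_mem' := by
    rintro A B ⟨N, hA⟩ ⟨N', hB⟩
    refine ⟨max N N', fun i j m h => ?_⟩
    by_cases h1 : MvPowerSeries.coeff m (A i j) = 0
    · refine (hB.mono (le_max_right _ _)) i j m fun h2 => h ?_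
      rw [Matrix.add_apply, map_add, h1, h2, add_zero]
    · exact (hA.mono (le_max_left _ _)) i j m h1
  smul_mem' := by
    rintro c A ⟨N, hA⟩
    refine ⟨N, fun i j m h => hA i j m fun h1 => h ?_⟩
    rw [Matrix.smul_apply, map_smul, h1, smul_zero]

/-- The ring of formal infinite matrices (difference operators). -/
def Op (ε : ℤˣ) : Type := opSubmodule ε

namespace Op

variable {ε : ℤˣ}

instance : AddCommGroup (Op ε) := inferInstanceAs (AddCommGroup (opSubmodule ε))

instance : Module ℂ (Op ε) := inferInstanceAs (Module ℂ (opSubmodule ε))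

/-- The entry `(i, j)` of a matrix. -/
def entry (A : Op ε) : Matrix ℤ ℤ Coeff := A.1

@[ext]
theorem ext {A B : Op ε} (h : ∀ i j, A.entry i j = B.entry i j) : A = B :=
  Subtype.ext (Matrix.ext h)

@[simp] theorem entry_zero (i j : ℤ) : (0 : Op ε).entry i j = 0 := rfl

@[simp] theorem entry_add (A B : Op ε) (i j : ℤ) :
    (A + B).entry i j = A.entry i j + B.entry i j := rfl

@[simp] theorem entry_smul (c : ℂ) (A : Op ε) (i j : ℤ) :
    (c • A).entry i j = c • A.entry i j := rfl

/-- Finitely many `k` contribute to a given coefficient of a product. -/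
theorem mem_of_coeff_mul_ne {N N' : ℤ} {A B : Matrix ℤ ℤ Coeff} (hA : IsBounded ε N A)
    (hB : IsBounded ε N' B) {i j k : ℤ} {m : Times →₀ ℕ}
    (h : MvPowerSeries.coeff m (A i k * B k j) ≠ 0) :
    (ε : ℤ) * (k - i) ≤ N + weight m ∧ (ε : ℤ) * (j - k) ≤ N' + weight m ∧
      (ε : ℤ) * (j - i) ≤ N + N' + weight m := by
  classical
  rw [MvPowerSeries.coeff_mul] at h
  obtain ⟨⟨c, d⟩, hcd, h⟩ := Finset.exists_ne_zero_of_sum_ne_zero h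
  have h1 := hA i k c (left_ne_zero_of_mul h)
  have h2 := hB k j d (right_ne_zero_of_mul h)
  rw [Finset.HasAntidiagonal.mem_antidiagonal] at hcd
  have h3 : weight m = weight c + weight d := by rw [← hcd, map_add]
  have h4 : (ε : ℤ) * (j - i) = ε * (k - i) + ε * (j - k) := by ring
  push_cast [h3]
  omega

/-- An interval containing all `k` that satisfy the first two bounds above. -/
def window (N : ℤ) (i j : ℤ) (w : ℕ) : Finset ℤ :=
  Finset.Icc (min i j - |N| - w) (max i j + |N| + w)

theorem mem_window {N N' K : ℤ} {i j k : ℤ} {w v : ℕ} (h1 : (ε : ℤ) * (k - i) ≤ N + w)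
    (h2 : (ε : ℤ) * (j - k) ≤ N' + w) (hN : N ≤ K) (hN' : N' ≤ K) (hv : w ≤ v) :
    k ∈ window K i j v := by
  have hK := le_abs_self K
  rw [window, Finset.mem_Icc]
  rcases Int.units_eq_one_or ε with rfl | rfl
  · simp only [Units.val_one, one_mul] at h1 h2
    omega
  · simp only [Units.val_neg, Units.val_one, neg_mul, one_mul] at h1 h2
    omega

/-- Matrix multiplication `(A B)_{ij} = ∑_k A_{ik} B_{kj}`, coefficient by coefficient. -/
def mulEntry (A B : Matrix ℤ ℤ Coeff) : Matrix ℤ ℤ Coeff := fun i j =>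
  (fun m => ∑ᶠ k : ℤ, MvPowerSeries.coeff m (A i k * B k j) : MvPowerSeries Times ℂ)

theorem coeff_mulEntry (A B : Matrix ℤ ℤ Coeff) (i j : ℤ) (m : Times →₀ ℕ) :
    MvPowerSeries.coeff m (mulEntry A B i j) =
      ∑ᶠ k : ℤ, MvPowerSeries.coeff m (A i k * B k j) := rfl

theorem coeff_mulEntry_eq_sum {N N' : ℤ} {A B : Matrix ℤ ℤ Coeff} (hA : IsBounded ε N A)
    (hB : IsBounded ε N' B) {i j : ℤ} {m : Times →₀ ℕ} (S : Finset ℤ)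
    (hS : ∀ k : ℤ, (ε : ℤ) * (k - i) ≤ N + weight m → (ε : ℤ) * (j - k) ≤ N' + weight m → k ∈ S) :
    MvPowerSeries.coeff m (mulEntry A B i j) =
      ∑ k ∈ S, MvPowerSeries.coeff m (A i k * B k j) := by
  rw [coeff_mulEntry]
  refine finsum_eq_sum_of_support_subset _ fun k hk => ?_
  obtain ⟨h1, h2, -⟩ := mem_of_coeff_mul_ne hA hB hk
  exact hS k h1 h2

theorem isBounded_mulEntry {N N' : ℤ} {A B : Matrix ℤ ℤ Coeff} (hA : IsBounded ε N A)
    (hB : IsBounded ε N' B) : IsBounded ε (N + N') (mulEntry A B) := by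
  intro i j m h
  rw [coeff_mulEntry] at h
  obtain ⟨k, hk⟩ : ∃ k : ℤ, MvPowerSeries.coeff m (A i k * B k j) ≠ 0 := by
    by_contra hne
    push Not at hne
    exact h (by simp [hne])
  exact (mem_of_coeff_mul_ne hA hB hk).2.2

theorem isBounded_one : IsBounded ε 0 (1 : Matrix ℤ ℤ Coeff) := by
  intro i j m h
  by_cases hij : i = j
  · subst hij
    simp
  · rw [Matrix.one_apply_ne hij] at h
    simp at h

instance : Mul (Op ε) where
  mul A B := ⟨mulEntry A.1 B.1, by
    obtain ⟨N, hA⟩ := A.2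
    obtain ⟨N', hB⟩ := B.2
    exact ⟨N + N', isBounded_mulEntry hA hB⟩⟩

instance : One (Op ε) where
  one := ⟨1, 0, isBounded_one⟩

theorem entry_one (i j : ℤ) : (1 : Op ε).entry i j = if i = j then 1 else 0 :=
  Matrix.one_apply

theorem coeff_entry_mul (A B : Op ε) (i j : ℤ) (m : Times →₀ ℕ) :
    MvPowerSeries.coeff m ((A * B).entry i j) =
      ∑ᶠ k : ℤ, MvPowerSeries.coeff m (A.entry i k * B.entry k j) := rfl

theorem finite_support_mul (A B : Op ε) (i j : ℤ) (m : Times →₀ ℕ) :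
    (Function.support fun k : ℤ =>
      MvPowerSeries.coeff m (A.entry i k * B.entry k j)).Finite := by
  obtain ⟨N, hA⟩ := A.2
  obtain ⟨N', hB⟩ := B.2
  refine (window (max N N') i j (weight m)).finite_toSet.subset fun k hk => ?_
  obtain ⟨h1, h2, -⟩ := mem_of_coeff_mul_ne hA hB hk
  exact mem_window h1 h2 (le_max_left _ _) (le_max_right _ _) le_rfl

protected theorem mul_assoc (A B C : Op ε) : A * B * C = A * (B * C) := by
  classical
  obtain ⟨A, N₁, hA⟩ := A
  obtain ⟨B, N₂, hB⟩ := B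
  obtain ⟨C, N₃, hC⟩ := C
  refine Subtype.ext (Matrix.ext fun i j => MvPowerSeries.ext fun m => ?_)
  change MvPowerSeries.coeff m (mulEntry (mulEntry A B) C i j) =
    MvPowerSeries.coeff m (mulEntry A (mulEntry B C) i j)
  have hAB := isBounded_mulEntry hA hB
  have hBC := isBounded_mulEntry hB hC
  set K : ℤ := |N₁| + |N₂| + |N₃| with hK
  have b1 := le_abs_self N₁
  have b2 := le_abs_self N₂
  have b3 := le_abs_self N₃
  have c1 := abs_nonneg N₁
  have c2 := abs_nonneg N₂
  have c3 := abs_nonneg N₃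
  set S := window K i j (weight m) with hS
  -- every index that occurs lies in `T`
  set T := Finset.Icc (min i j - 3 * (K + weight m)) (max i j + 3 * (K + weight m)) with hT
  have hST : ∀ k : ℤ, k ∈ S → k ∈ T := by
    intro k hk
    rw [hS, window, Finset.mem_Icc, abs_of_nonneg (by omega)] at hk
    rw [hT, Finset.mem_Icc]
    omega
  have wle : ∀ x ∈ Finset.HasAntidiagonal.antidiagonal m, weight x.1 ≤ weight m ∧ weight x.2 ≤ weight m := by
    intro x hx
    rw [Finset.HasAntidiagonal.mem_antidiagonal] at hx
    rw [← hx, map_add]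
    omega
  rw [coeff_mulEntry_eq_sum hAB hC S fun k h1 h2 =>
      mem_window h1 h2 (by omega) (by omega) le_rfl,
    coeff_mulEntry_eq_sum hA hBC S fun k h1 h2 =>
      mem_window h1 h2 (by omega) (by omega) le_rfl]
  have hl : ∀ k ∈ S, MvPowerSeries.coeff m (mulEntry A B i k * C k j) =
      ∑ l ∈ T, MvPowerSeries.coeff m (A i l * B l k * C k j) := by
    intro k hk
    rw [MvPowerSeries.coeff_mul]
    simp_rw [MvPowerSeries.coeff_mul _ (A i _ * B _ k)]
    rw [Finset.sum_comm]
    refine Finset.sum_congr rfl fun x hx => ?_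
    rw [← Finset.sum_mul]
    congr 1
    refine coeff_mulEntry_eq_sum hA hB T fun l h1 h2 => ?_
    have := mem_window (K := K) h1 h2 (by omega) (by omega) (wle x hx).1
    rw [window, Finset.mem_Icc, abs_of_nonneg (by omega)] at this
    rw [hS, window, Finset.mem_Icc, abs_of_nonneg (by omega)] at hk
    rw [hT, Finset.mem_Icc]
    omega
  have hr : ∀ l ∈ S, MvPowerSeries.coeff m (A i l * mulEntry B C l j) =
      ∑ k ∈ T, MvPowerSeries.coeff m (A i l * B l k * C k j) := by
    intro l hl
    rw [MvPowerSeries.coeff_mul]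
    simp_rw [mul_assoc, MvPowerSeries.coeff_mul m (A i l)]
    rw [Finset.sum_comm]
    refine Finset.sum_congr rfl fun x hx => ?_
    rw [← Finset.mul_sum]
    congr 1
    refine coeff_mulEntry_eq_sum hB hC T fun k h1 h2 => ?_
    have := mem_window (K := K) h1 h2 (by omega) (by omega) (wle x hx).2
    rw [window, Finset.mem_Icc, abs_of_nonneg (by omega)] at this
    rw [hS, window, Finset.mem_Icc, abs_of_nonneg (by omega)] at hl
    rw [hT, Finset.mem_Icc]
    omega
  rw [Finset.sum_congr rfl hl, Finset.sum_congr rfl hr]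
  -- extend both outer sums to `T`
  have zl : ∀ k ∈ T, k ∉ S → ∑ l ∈ T, MvPowerSeries.coeff m (A i l * B l k * C k j) = 0 := by
    intro k _ hk
    refine Finset.sum_eq_zero fun l _ => ?_
    by_contra hne
    rw [MvPowerSeries.coeff_mul] at hne
    obtain ⟨⟨c, d⟩, hcd, h⟩ := Finset.exists_ne_zero_of_sum_ne_zero hne
    have w := wle _ hcd
    have h1 := (mem_of_coeff_mul_ne hA hB (left_ne_zero_of_mul h)).2.2
    have h2 := hC _ _ _ (right_ne_zero_of_mul h)
    simp only at w h1 h2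
    exact hk (mem_window (ε := ε) (N := N₁ + N₂) (N' := N₃) (w := weight m)
      (by omega) (by omega) (by omega) (by omega) le_rfl)
  have zr : ∀ l ∈ T, l ∉ S → ∑ k ∈ T, MvPowerSeries.coeff m (A i l * B l k * C k j) = 0 := by
    intro l _ hl
    refine Finset.sum_eq_zero fun k _ => ?_
    by_contra hne
    rw [mul_assoc, MvPowerSeries.coeff_mul] at hne
    obtain ⟨⟨c, d⟩, hcd, h⟩ := Finset.exists_ne_zero_of_sum_ne_zero hne
    have w := wle _ hcd
    have h1 := (mem_of_coeff_mul_ne hB hC (right_ne_zero_of_mul h)).2.2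
    have h2 := hA _ _ _ (left_ne_zero_of_mul h)
    simp only at w h1 h2
    exact hl (mem_window (ε := ε) (N := N₁) (N' := N₂ + N₃) (w := weight m)
      (by omega) (by omega) (by omega) (by omega) le_rfl)
  rw [Finset.sum_subset hST zl, Finset.sum_subset hST zr, Finset.sum_comm]

protected theorem one_mul (A : Op ε) : 1 * A = A := by
  refine ext fun i j => MvPowerSeries.ext fun m => ?_
  rw [coeff_entry_mul, finsum_eq_single _ i fun k hk => by simp [entry_one, hk.symm]]
  simp [entry_one]

protected theorem mul_one (A : Op ε) : A * 1 = A := by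
  refine ext fun i j => MvPowerSeries.ext fun m => ?_
  rw [coeff_entry_mul, finsum_eq_single _ j fun k hk => by simp [entry_one, hk]]
  simp [entry_one]

protected theorem mul_add (A B C : Op ε) : A * (B + C) = A * B + A * C := by
  refine ext fun i j => MvPowerSeries.ext fun m => ?_
  rw [entry_add, map_add, coeff_entry_mul, coeff_entry_mul, coeff_entry_mul,
    ← finsum_add_distrib (finite_support_mul A B i j m) (finite_support_mul A C i j m)]
  simp [mul_add]

protected theorem add_mul (A B C : Op ε) : (A + B) * C = A * C + B * C := by
  refine ext fun i j => MvPowerSeries.ext fun m => ?_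
  rw [entry_add, map_add, coeff_entry_mul, coeff_entry_mul, coeff_entry_mul,
    ← finsum_add_distrib (finite_support_mul A C i j m) (finite_support_mul B C i j m)]
  simp [add_mul]

protected theorem zero_mul (A : Op ε) : 0 * A = 0 := by
  refine ext fun i j => MvPowerSeries.ext fun m => ?_
  simp [coeff_entry_mul]

protected theorem mul_zero (A : Op ε) : A * 0 = 0 := by
  refine ext fun i j => MvPowerSeries.ext fun m => ?_
  simp [coeff_entry_mul]

instance : Ring (Op ε) :=
  { (inferInstance : AddCommGroup (Op ε)) with
    mul := (· * ·)
    one := 1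
    mul_assoc := Op.mul_assoc
    one_mul := Op.one_mul
    mul_one := Op.mul_one
    left_distrib := Op.mul_add
    right_distrib := Op.add_mul
    zero_mul := Op.zero_mul
    mul_zero := Op.mul_zero }

/-! ### The matrices `Λ`, `Δ` and the time-dependent factors -/

/-- `Λ^n = (δ_{i, j-n})`, i.e. the shift operator `e^{n∂_s}`. -/
def shift (n : ℤ) : Op ε :=
  ⟨fun i j => if i = j - n then 1 else 0, |n|, fun i j m h => by
    beta_reduce at h
    split_ifs at h with hij
    · have h1 := le_abs_self n
      have h2 := neg_abs_le n
      have h3 : j - i = n := by omega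
      rw [h3]
      rcases Int.units_eq_one_or ε with rfl | rfl
      · simp only [Units.val_one, one_mul]
        omega
      · simp only [Units.val_neg, Units.val_one, neg_mul, one_mul]
        omega
    · simp at h⟩

theorem entry_shift (n i j : ℤ) :
    (shift n : Op ε).entry i j = if i = j - n then 1 else 0 := rfl

theorem shift_mul_shift (a b : ℤ) : (shift a * shift b : Op ε) = shift (a + b) := by
  refine ext fun i j => MvPowerSeries.ext fun m => ?_
  rw [coeff_entry_mul, finsum_eq_single _ (i + a) fun k hk => by
    rw [entry_shift, if_neg (by omega)]
    simp]
  rw [entry_shift, entry_shift, entry_shift, if_pos (by omega), one_mul]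
  congr 1
  exact if_congr (by omega) rfl rfl

theorem shift_zero : (shift 0 : Op ε) = 1 := by
  refine ext fun i j => ?_
  rw [entry_shift, entry_one, sub_zero]

/-- The shift matrix `Λ`, as an invertible element. -/
def Lam : (Op ε)ˣ where
  val := shift 1
  inv := shift (-1)
  val_inv := by rw [shift_mul_shift, add_neg_cancel, shift_zero]
  inv_val := by rw [shift_mul_shift, neg_add_cancel, shift_zero]

/-- `Δ = (i δ_{ij})`, i.e. multiplication by the lattice coordinate. -/
def Del : Op ε :=
  ⟨fun i j => if i = j then (i : Coeff) else 0, 0, fun i j m h => by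
    beta_reduce at h
    split_ifs at h with hij
    · subst hij
      simp
    · simp at h⟩

theorem ε_mul_le (n : ℤ) {w : ℕ} (h : n = w ∨ -n = w) : (ε : ℤ) * n ≤ 0 + w := by
  rcases Int.units_eq_one_or ε with rfl | rfl
  · simp only [Units.val_one, one_mul]
    omega
  · simp only [Units.val_neg, Units.val_one, neg_mul, one_mul]
    omega

theorem ne_zero_of_coeff_intCast_mul_ne {n : ℤ} {f : Coeff} {m : Times →₀ ℕ}
    (h : MvPowerSeries.coeff m ((n : Coeff) * f) ≠ 0) : MvPowerSeries.coeff m f ≠ 0 := by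
  intro h0
  rw [← zsmul_eq_mul, map_zsmul, h0, smul_zero] at h
  exact h rfl

/-- `∑_{n ≥ 1} n t_n Λ^n`. -/
def tSum : Op ε :=
  ⟨fun i j => ((j - i : ℤ) : Coeff) * tVar (j - i), 0, fun _ _ _ h =>
    ε_mul_le _ (Or.inl
      (weight_of_coeff_tVar_ne (ne_zero_of_coeff_intCast_mul_ne h)).symm)⟩

/-- `∑_{n ≥ 1} n t̄_n Λ^{-n}`. -/
def tbarSum : Op ε :=
  ⟨fun i j => ((i - j : ℤ) : Coeff) * tbarVar (i - j), 0, fun _ _ _ h =>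
    ε_mul_le _ (Or.inr (by
      have := weight_of_coeff_tbarVar_ne (ne_zero_of_coeff_intCast_mul_ne h)
      omega))⟩

/-- `exp (ħ⁻¹ ∑_{n ≥ 1} t_n Λ^n) = ∑_{n ≥ 0} S_n(ħ⁻¹ t) Λ^n`. -/
def expT (hbar : ℂ) : Op ε :=
  ⟨fun i j => schur (fun n => hbar⁻¹ • tVar n) (j - i), 0, fun _ _ _ h =>
    ε_mul_le _ (Or.inl (weight_of_coeff_schur_ne (fun n m' h' =>
      weight_of_coeff_tVar_ne (right_ne_zero_of_mul (by rwa [map_smul] at h'))) h).symm)⟩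

/-- `exp (-ħ⁻¹ ∑_{n ≥ 1} t̄_n Λ^{-n}) = ∑_{n ≥ 0} S_n(-ħ⁻¹ t̄) Λ^{-n}`. -/
def expTbar (hbar : ℂ) : Op ε :=
  ⟨fun i j => schur (fun n => (-hbar⁻¹) • tbarVar n) (i - j), 0, fun _ _ _ h =>
    ε_mul_le _ (Or.inr (by
      have := weight_of_coeff_schur_ne (fun n m' h' =>
        weight_of_coeff_tbarVar_ne (right_ne_zero_of_mul (by rwa [map_smul] at h'))) h
      omega))⟩

end Op

/-! ### Solutions of the Toda lattice hierarchy -/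

/-- Lower triangular for `ε = 1`, upper triangular for `ε = -1`. -/
def IsTriangular (ε : ℤˣ) (u : Matrix ℤ ℤ ℂ) : Prop :=
  ∀ i j : ℤ, 0 < (ε : ℤ) * (j - i) → u i j = 0

/-- The numerical matrix `u = U(0,0)` as a formal matrix that does not depend on the times. -/
def initialOp {ε : ℤˣ} (u : Matrix ℤ ℤ ℂ) (hu : IsTriangular ε u) : Op ε :=
  ⟨fun i j => MvPowerSeries.C (u i j), 0, fun i j m h => by
    by_contra hlt
    beta_reduce at h
    rw [hu i j (by omega), map_zero, map_zero] at h
    exact h rfl⟩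

/-- `U(t, t̄) = exp (ħ⁻¹ ∑ t_n Λ^n) U(0,0) exp (-ħ⁻¹ ∑ t̄_n Λ^{-n})`. -/
def evolvedOp {ε : ℤˣ} (hbar : ℂ) (u : Matrix ℤ ℤ ℂ) (hu : IsTriangular ε u) : Op ε :=
  Op.expT hbar * initialOp u hu * Op.expTbar hbar

/-- `(W, W̄)` solves the factorization problem `U(t, t̄) = W⁻¹ W̄`, with `W` lower triangular
with unit diagonal and `W̄` upper triangular with invertible diagonal. -/
structure IsDressing {ε : ℤˣ} (hbar : ℂ) (u : Matrix ℤ ℤ ℂ) (hu : IsTriangular ε u)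
    (W Wbar : (Op ε)ˣ) : Prop where
  lower : ∀ i j : ℤ, i < j → (W : Op ε).entry i j = 0
  diag : ∀ i : ℤ, (W : Op ε).entry i i = 1
  upper : ∀ i j : ℤ, j < i → (Wbar : Op ε).entry i j = 0
  diag_bar : ∀ i : ℤ, IsUnit ((Wbar : Op ε).entry i i)
  factor : evolvedOp hbar u hu = ((W⁻¹ : (Op ε)ˣ) : Op ε) * (Wbar : Op ε)

/-- The Lax operator dressed by `V`: `L = W Λ W⁻¹` for `V = W`, `L̄ = W̄ Λ W̄⁻¹` for `V = W̄`. -/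
def laxOp {ε : ℤˣ} (V : (Op ε)ˣ) : (Op ε)ˣ := V * Op.Lam * V⁻¹

/-- The Orlov–Shulman operator `M = W (ħΔ + ∑ n t_n Λ^n) W⁻¹`. -/
def orlovM {ε : ℤˣ} (hbar : ℂ) (W : (Op ε)ˣ) : Op ε :=
  (W : Op ε) * (hbar • Op.Del + Op.tSum) * ((W⁻¹ : (Op ε)ˣ) : Op ε)

/-- The Orlov–Shulman operator `M̄ = W̄ (ħΔ - ∑ n t̄_n Λ^{-n}) W̄⁻¹`. -/
def orlovMbar {ε : ℤˣ} (hbar : ℂ) (Wbar : (Op ε)ˣ) : Op ε :=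
  (Wbar : Op ε) * (hbar • Op.Del - Op.tbarSum) * ((Wbar⁻¹ : (Op ε)ˣ) : Op ε)

/-- The two string equations; `q` stands for `p̄`. -/
def StringEquations {ε : ℤˣ} (p q : ℤ) (hbar : ℂ) (W Wbar : (Op ε)ˣ) : Prop :=
  ((laxOp W ^ p : (Op ε)ˣ) : Op ε) =
      (1 / (q : ℂ)) • (orlovMbar hbar Wbar * ((laxOp Wbar ^ (-q) : (Op ε)ˣ) : Op ε))
        - (hbar * ((q : ℂ) - 1) / (2 * q)) • ((laxOp Wbar ^ (-q) : (Op ε)ˣ) : Op ε)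
        + ((laxOp Wbar ^ p : (Op ε)ˣ) : Op ε) ∧
  ((laxOp Wbar ^ q : (Op ε)ˣ) : Op ε) =
      -((1 / (p : ℂ)) • (orlovM hbar W * ((laxOp W ^ (-p) : (Op ε)ˣ) : Op ε)))
        + (hbar * ((p : ℂ) - 1) / (2 * p)) • ((laxOp W ^ (-p) : (Op ε)ˣ) : Op ε)
        + ((laxOp W ^ q : (Op ε)ˣ) : Op ε)

/-! ### The generating functions `u_j(λ)` and the matrix `U(0,0)` -/

/-- The phase `z^q - q/(p+q) z^{p+q}` in the variable `z = μ/λ`; `z = 1` is a saddle point, with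
second derivative `-pq`. -/
def phase (p q : ℤ) (z : ℂ) : ℂ := z ^ q - (q : ℂ) / ((p : ℂ) + q) * z ^ (p + q)

/-- `z = γ(τ)`, `τ ∈ [a, b]`, is a `C¹` path in the plane cut along `(-∞, 0]` that passes through
the saddle point `z = 1` at `τ = 0` in a direction of descent, and along which the saddle point is
dominant. The path of integration of `u_j(λ)` is `μ = λ γ(τ)`. -/
structure IsSaddlePath (p q : ℤ) (γ : ℝ → ℂ) (a b : ℝ) : Prop where
  left_neg : a < 0
  right_pos : 0 < b
  contDiffOn : ContDiffOn ℝ 1 γ (Set.Icc a b)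
  mem_slitPlane : ∀ τ ∈ Set.Icc a b, γ τ ∈ Complex.slitPlane
  saddle : γ 0 = 1
  descent : 0 < ((p : ℂ) * q * deriv γ 0 ^ 2).re
  dominant : ∀ τ ∈ Set.Icc a b, τ ≠ 0 → (phase p q (γ τ)).re < (phase p q 1).re

/-- The integrand `μ^{(q-1)/2 - j - 1} exp ħ⁻¹ (λ^p μ^q - q/(p+q) μ^{p+q})` of `u_j(λ)`. -/
def integrand (p q : ℤ) (hbar : ℝ) (j : ℤ) (l : ℝ) (μ : ℂ) : ℂ :=
  μ ^ (((q : ℂ) - 1) / 2 - j - 1) *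
    Complex.exp ((hbar : ℂ)⁻¹ *
      ((l : ℂ) ^ p * μ ^ q - (q : ℂ) / ((p : ℂ) + q) * μ ^ (p + q)))

/-- The factor `c(λ) = const · λ^{(p-1)/2} exp ħ⁻¹ (-p/(p+q) λ^{p+q})`. -/
def prefactor (p q : ℤ) (hbar : ℝ) (const : ℂ) (l : ℝ) : ℂ :=
  const * (l : ℂ) ^ (((p : ℂ) - 1) / 2) *
    Complex.exp ((hbar : ℂ)⁻¹ * (-(p : ℂ) / ((p : ℂ) + q) * (l : ℂ) ^ (p + q)))

/-- `u_j(λ)`, with the path of integration `μ = λ γ(τ)`, `τ ∈ [a, b]`. -/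
def genFun (p q : ℤ) (hbar : ℝ) (const : ℂ) (γ : ℝ → ℂ) (a b : ℝ) (j : ℤ) (l : ℝ) : ℂ :=
  prefactor p q hbar const l *
    ∫ τ in a..b, integrand p q hbar j l ((l : ℂ) * γ τ) * ((l : ℂ) * deriv γ τ)

/-- `λ → +∞` for `ε = 1` and `λ → +0` for `ε = -1`. -/
def limitFilter (ε : ℤˣ) : Filter ℝ := if ε = 1 then atTop else 𝓝[>] 0

/-- `u` is the matrix of coefficients of the asymptotic expansions
`u_j(λ) ∼ ∑_{i = j, j+ε, j+2ε, …} λ^{-i-1} u_{ij}`, with zero entries elsewhere. -/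
structure IsAsymptoticMatrix (ε : ℤˣ) (f : ℤ → ℝ → ℂ) (u : Matrix ℤ ℤ ℂ) : Prop where
  triangular : IsTriangular ε u
  expansion : ∀ (j : ℤ) (N : ℕ),
    (fun l : ℝ => f j l - ∑ n ∈ Finset.range N,
        (l : ℂ) ^ (-(j + (ε : ℤ) * n) - 1) * u (j + (ε : ℤ) * n) j)
      =O[limitFilter ε] fun l : ℝ => l ^ (-(j + (ε : ℤ) * N) - 1)

/-! ### The case `p + p̄ = 0` -/

/-- The argument `1/2 - 1/ħ + (i + 1/2)/p` of the Gamma function. -/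
def gammaArg (p : ℤ) (hbar : ℝ) (i : ℤ) : ℝ := 1 / 2 - 1 / hbar + ((i : ℝ) + 1 / 2) / p

/-- The diagonal matrix `u_{ij} = (-ħ)^{(i+1/2)/p} Γ(1/2 - 1/ħ + (i+1/2)/p) / Γ(1/2 - 1/ħ) δ_{ij}`
of the compactified `c = 1` string theory. -/
def gammaMatrix (p : ℤ) (hbar : ℝ) : Matrix ℤ ℤ ℂ := Matrix.diagonal fun i =>
  (-(hbar : ℂ)) ^ (((i : ℂ) + 1 / 2) / p) * Complex.Gamma (gammaArg p hbar i) /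
    Complex.Gamma ((1 / 2 - 1 / hbar : ℝ) : ℂ)

theorem isTriangular_gammaMatrix (ε : ℤˣ) (p : ℤ) (hbar : ℝ) :
    IsTriangular ε (gammaMatrix p hbar) := by
  intro i j h
  refine Matrix.diagonal_apply_ne _ ?_
  rintro rfl
  simp at h

/-- None of the Gamma functions in `gammaMatrix` is evaluated at a pole. -/
def GammaRegular (p : ℤ) (hbar : ℝ) : Prop :=
  (∀ n : ℕ, 1 / 2 - 1 / hbar ≠ -(n : ℝ)) ∧ ∀ (i : ℤ) (n : ℕ), gammaArg p hbar i ≠ -(n : ℝ)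

/-- The integrand of `u_j(λ)` for `p + q = 0`, where `q/(p+q) μ^{p+q}` is replaced by `q log μ`. -/
def degenerateIntegrand (p q : ℤ) (hbar : ℝ) (j : ℤ) (l μ : ℝ) : ℝ :=
  μ ^ (((q : ℝ) - 1) / 2 - j - 1) * Real.exp (hbar⁻¹ * (l ^ p * μ ^ q - q * Real.log μ))

/-- The factor `c(λ)` for `p + q = 0`, where `p/(p+q) λ^{p+q}` is replaced by `p log λ`, with the
constant `|p| (-ħ)^{1/ħ - 1/2} / Γ(1/2 - 1/ħ)`. -/
def degeneratePrefactor (p : ℤ) (hbar : ℝ) (l : ℝ) : ℝ :=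
  |(p : ℝ)| * (-hbar) ^ (1 / hbar - 1 / 2) / Real.Gamma (1 / 2 - 1 / hbar) *
    l ^ (((p : ℝ) - 1) / 2) * Real.exp (hbar⁻¹ * (-p * Real.log l))

end Toda

end

/-!
The dressing operators come from a Gauss factorization in a filtered ring. On the matrices with
`ε (j - i) ≤ weight` the number `2 weight - ε (j - i)` is nonnegative, additive under products, and
zero only for the constant terms on the diagonal, so that `U(t, t̄) = D + (order ≥ 1)` with `D` the
diagonal of `U(0,0)`. If `D` has no zeros, the equation `W U = W̄` for `W = 1 + A` with `A` strictly
lower triangular is a fixed point equation for a contraction (`Toda.existsUnique_isDressing`).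

Since `exp (-X) (ħΔ + ∑ n t_n Λ^n) exp X = ħΔ` for `X = ħ⁻¹ ∑ t_n Λ^n` (Newton's recursion for the
Schur functions), and similarly for `t̄`, the string equations of the solution reduce to two linear
recursions for the numbers `u_{ij}` (`Toda.stringEquations_of_recursion`).

For `p + q = 0` both recursions are the functional equation of the Gamma function, and the
generating function is Euler's integral in the variable `μ^q`.

For `p + q ≠ 0` the substitution `μ = λ z` turns `u_j(λ)` into a power of `λ` times the moment
`F_α(X) = ∫_γ z^α exp (X (φ(z) - φ(1))) dz` at `X = λ^{p+q}/ħ`. The method of steepest descent gives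
full expansions of the moments in the powers `X^{-k-1/2}`, with a leading coefficient that is
nonzero and does not depend on `α` (`Toda.exists_hasExpansion_of_saddle`): in the coordinate `w`
with `φ - φ(1) = -w²` near the saddle point, a holomorphic `g` is `c w' + φ' h`, where `w'`
contributes a Gaussian integral and `φ' h` is replaced by `-X⁻¹ h'` through integration by parts. Integration by
parts of `d(z^α exp (X φ))` is the first recursion; the derivative of `F_α` with respect to `X`
combined with it is the second. Expansions may be differentiated since `F_α'` has one of its own
(`Toda.HasExpansion.deriv_coeff`).
-/

noncomputable section

/-! ### A filtration on the ring of formal matrices -/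

namespace Toda

namespace Op

variable {ε : ℤˣ}

/-- A formal matrix is small of order `k` if a monomial of weight `w` occurs in the entry `(i, j)`
only for `2 w - ε (j - i) ≥ k`. On matrices of bound `0` this number is nonnegative, and it is `0`
only for the constant terms of diagonal entries. -/
def Small (k : ℤ) (A : Op ε) : Prop :=
  ∀ (i j : ℤ) (m : Times →₀ ℕ), MvPowerSeries.coeff m (A.entry i j) ≠ 0 →
    k ≤ 2 * weight m - ε * (j - i)

/-- The matrices of bound `0`: a monomial of weight `w` occurs in the entry `(i, j)` only for
`ε (j - i) ≤ w`. -/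
def Bdd (A : Op ε) : Prop := IsBounded ε 0 A.entry

@[simp] theorem entry_neg (A : Op ε) (i j : ℤ) : (-A).entry i j = -A.entry i j := rfl

@[simp] theorem entry_sub (A B : Op ε) (i j : ℤ) :
    (A - B).entry i j = A.entry i j - B.entry i j := rfl

theorem Small.add {k : ℤ} {A B : Op ε} (hA : Small k A) (hB : Small k B) : Small k (A + B) := by
  intro i j m h
  by_cases h1 : MvPowerSeries.coeff m (A.entry i j) = 0
  · refine hB i j m fun h2 => h ?_
    rw [entry_add, map_add, h1, h2, add_zero]
  · exact hA i j m h1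

theorem Small.neg {k : ℤ} {A : Op ε} (hA : Small k A) : Small k (-A) := by
  intro i j m h
  refine hA i j m fun h1 => h ?_
  rw [entry_neg, map_neg, h1, neg_zero]

theorem Small.sub {k : ℤ} {A B : Op ε} (hA : Small k A) (hB : Small k B) : Small k (A - B) := by
  rw [sub_eq_add_neg]
  exact hA.add hB.neg

theorem Small.mono {k l : ℤ} {A : Op ε} (hA : Small k A) (h : l ≤ k) : Small l A :=
  fun i j m hm => h.trans (hA i j m hm)

theorem Small.mul {k l : ℤ} {A B : Op ε} (hA : Small k A) (hB : Small l B) :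
    Small (k + l) (A * B) := by
  classical
  intro i j m h
  rw [coeff_entry_mul] at h
  obtain ⟨n, hn⟩ : ∃ n : ℤ, MvPowerSeries.coeff m (A.entry i n * B.entry n j) ≠ 0 := by
    by_contra hne
    push Not at hne
    exact h (by simp [hne])
  rw [MvPowerSeries.coeff_mul] at hn
  obtain ⟨⟨c, d⟩, hcd, hn⟩ := Finset.exists_ne_zero_of_sum_ne_zero hn
  have h1 := hA i n c (left_ne_zero_of_mul hn)
  have h2 := hB n j d (right_ne_zero_of_mul hn)
  rw [Finset.HasAntidiagonal.mem_antidiagonal] at hcd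
  have h3 : weight m = weight c + weight d := by rw [← hcd, map_add]
  have h4 : (ε : ℤ) * (j - i) = ε * (n - i) + ε * (j - n) := by ring
  push_cast [h3]
  omega

theorem eq_zero_of_forall_small {A : Op ε} (hA : ∀ n : ℕ, Small n A) : A = 0 := by
  refine ext fun i j => MvPowerSeries.ext fun m => ?_
  by_contra hne
  have h := hA (2 * weight m - (ε : ℤ) * (j - i) + 1).toNat i j m (by simpa using hne)
  omega

theorem exists_small (A : Op ε) : ∃ k : ℤ, Small k A := by
  obtain ⟨N, hA⟩ := A.2
  refine ⟨-N, fun i j m h => ?_⟩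
  have := hA i j m h
  omega

theorem Bdd.small {A : Op ε} (hA : Bdd A) : Small 0 A := by
  intro i j m h
  have := hA i j m h
  omega

theorem Bdd.add {A B : Op ε} (hA : Bdd A) (hB : Bdd B) : Bdd (A + B) := by
  intro i j m h
  by_cases h1 : MvPowerSeries.coeff m (A.entry i j) = 0
  · refine hB i j m fun h2 => h ?_
    rw [entry_add, map_add, h1, h2, add_zero]
  · exact hA i j m h1

theorem Bdd.neg {A : Op ε} (hA : Bdd A) : Bdd (-A) := by
  intro i j m h
  refine hA i j m fun h1 => h ?_
  rw [entry_neg, map_neg, h1, neg_zero]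

theorem Bdd.sub {A B : Op ε} (hA : Bdd A) (hB : Bdd B) : Bdd (A - B) := by
  rw [sub_eq_add_neg]
  exact hA.add hB.neg

theorem Bdd.mul {A B : Op ε} (hA : Bdd A) (hB : Bdd B) : Bdd (A * B) := by
  have := isBounded_mulEntry hA hB
  rwa [add_zero] at this

theorem bdd_zero : Bdd (0 : Op ε) := fun i j m h => absurd (by simp) h

theorem bdd_one : Bdd (1 : Op ε) := isBounded_one

/-- A map that raises the order of differences has a fixed point: the coefficients of its iterates
become stationary. -/
theorem exists_fixedPoint (F : Op ε → Op ε) (hF : ∀ A, Bdd A → Bdd (F A))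
    (hc : ∀ A B, Bdd A → Bdd B → ∀ k : ℤ, Small k (A - B) → Small (k + 1) (F A - F B)) :
    ∃ A, Bdd A ∧ F A = A := by
  have hb : ∀ n : ℕ, Bdd (F^[n] 0) := by
    intro n
    induction n with
    | zero => exact bdd_zero
    | succ n ih => rw [Function.iterate_succ_apply']; exact hF _ ih
  have hstep : ∀ n : ℕ, Small n (F^[n + 1] 0 - F^[n] 0) := by
    intro n
    induction n with
    | zero => exact ((hb 1).sub (hb 0)).small
    | succ n ih =>
      rw [Function.iterate_succ_apply' F (n + 1), Function.iterate_succ_apply' F n]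
      rw [Function.iterate_succ_apply' F n] at ih
      exact_mod_cast hc _ _ (by rw [← Function.iterate_succ_apply' F n]; exact hb (n + 1))
        (hb n) n ih
  have hcauchy : ∀ n k : ℕ, Small n (F^[n + k] 0 - F^[n] 0) := by
    intro n k
    induction k with
    | zero => rw [add_zero, sub_self]; intro i j m h; simp at h
    | succ k ih =>
      have h1 := (hstep (n + k)).mono (l := n) (by push_cast; omega)
      have h2 := h1.add ih
      rwa [sub_add_sub_cancel] at h2
  -- the coefficient of `m` in the entry `(i, j)` no longer changes after `ord i j m` steps
  let ord : ℤ → ℤ → (Times →₀ ℕ) → ℕ := fun i j m => (2 * weight m - (ε : ℤ) * (j - i)).toNat + 1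
  let A : Op ε := ⟨fun i j => (fun m =>
      MvPowerSeries.coeff m ((F^[ord i j m] 0).entry i j) : MvPowerSeries Times ℂ), 0,
    fun i j m h => hb (ord i j m) i j m h⟩
  have hAc : ∀ i j m, MvPowerSeries.coeff m (A.entry i j) =
      MvPowerSeries.coeff m ((F^[ord i j m] 0).entry i j) := fun i j m => rfl
  have hA : Bdd A := fun i j m h => hb (ord i j m) i j m h
  have hlim : ∀ n : ℕ, Small n (A - F^[n] 0) := by
    intro n i j m h
    by_contra hlt
    refine h ?_
    have h0 := (hA.sub (hb n)).small i j m h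
    have hle : ord i j m ≤ n := by simp only [ord]; omega
    obtain ⟨k, rfl⟩ := Nat.exists_eq_add_of_le hle
    by_contra hne
    rw [entry_sub, map_sub, hAc] at hne
    have := hcauchy (ord i j m) k i j m (by
      rw [entry_sub, map_sub]
      intro h3
      exact hne (by rw [← neg_sub, h3, neg_zero]))
    simp only [ord] at this
    omega
  refine ⟨A, hA, sub_eq_zero.1 (eq_zero_of_forall_small fun n => ?_)⟩
  have h1 := hc A (F^[n] 0) hA (hb n) n (hlim n)
  rw [← Function.iterate_succ_apply' F n] at h1
  have h2 := (hlim (n + 1)).neg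
  push_cast at h2
  have h3 := h1.add h2
  rw [neg_sub, sub_add_sub_cancel] at h3
  exact h3.mono (by omega)

/-- The inverses of `1 + N` are the fixed points of `X ↦ 1 - N X` and `X ↦ 1 - X N`. -/
theorem isUnit_one_add {N : Op ε} (hN : Bdd N) (h1 : Small 1 N) : IsUnit (1 + N) := by
  obtain ⟨X, -, hX⟩ := exists_fixedPoint (fun X => 1 - N * X)
    (fun X h => bdd_one.sub (hN.mul h)) fun A B _ _ k hk => by
      have := (h1.mul hk).neg
      rw [add_comm] at this
      convert this using 1
      rw [mul_sub]
      abel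
  obtain ⟨Y, -, hY⟩ := exists_fixedPoint (fun X => 1 - X * N)
    (fun X h => bdd_one.sub (h.mul hN)) fun A B _ _ k hk => by
      have := (hk.mul h1).neg
      convert this using 1
      rw [sub_mul]
      abel
  rw [isUnit_iff_exists_and_exists]
  refine ⟨⟨X, ?_⟩, ⟨Y, ?_⟩⟩
  · rw [add_mul, one_mul]
    nth_rewrite 1 [← hX]
    abel
  · rw [mul_add, mul_one]
    nth_rewrite 1 [← hY]
    abel

/-! ### Diagonal matrices and triangular parts -/

/-- A numerical diagonal matrix. -/
def diagOp (d : ℤ → ℂ) : Op ε :=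
  ⟨fun i j => if i = j then MvPowerSeries.C (d i) else 0, 0, fun i j m h => by
    beta_reduce at h
    split_ifs at h with hij
    · subst hij
      simp
    · simp at h⟩

theorem entry_diagOp (d : ℤ → ℂ) (i j : ℤ) :
    (diagOp d : Op ε).entry i j = if i = j then MvPowerSeries.C (d i) else 0 := rfl

theorem bdd_diagOp (d : ℤ → ℂ) : Bdd (diagOp d : Op ε) := by
  intro i j m h
  rw [entry_diagOp] at h
  split_ifs at h with hij
  · subst hij
    simp
  · simp at h

theorem entry_mul_eq_of_right {A B : Op ε} {i j k : ℤ}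
    (h : ∀ l, l ≠ k → B.entry l j = 0) : (A * B).entry i j = A.entry i k * B.entry k j := by
  refine MvPowerSeries.ext fun m => ?_
  rw [coeff_entry_mul, finsum_eq_single _ k fun l hl => by rw [h l hl, mul_zero, map_zero]]

theorem entry_mul_eq_of_left {A B : Op ε} {i j k : ℤ}
    (h : ∀ l, l ≠ k → A.entry i l = 0) : (A * B).entry i j = A.entry i k * B.entry k j := by
  refine MvPowerSeries.ext fun m => ?_
  rw [coeff_entry_mul, finsum_eq_single _ k fun l hl => by rw [h l hl, zero_mul, map_zero]]

theorem entry_mul_diagOp (A : Op ε) (d : ℤ → ℂ) (i j : ℤ) :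
    (A * diagOp d).entry i j = A.entry i j * MvPowerSeries.C (d j) := by
  rw [entry_mul_eq_of_right (k := j) fun l hl => by rw [entry_diagOp, if_neg hl],
    entry_diagOp, if_pos rfl]

theorem entry_diagOp_mul (A : Op ε) (d : ℤ → ℂ) (i j : ℤ) :
    (diagOp d * A).entry i j = MvPowerSeries.C (d i) * A.entry i j := by
  rw [entry_mul_eq_of_left (k := i) fun l hl => by rw [entry_diagOp, if_neg hl.symm],
    entry_diagOp, if_pos rfl]

theorem diagOp_mul_diagOp_inv {d : ℤ → ℂ} (hd : ∀ i, d i ≠ 0) :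
    (diagOp d * diagOp (fun i => (d i)⁻¹) : Op ε) = 1 := by
  refine ext fun i j => ?_
  rw [entry_diagOp_mul, entry_diagOp, entry_one]
  split_ifs with h
  · rw [← map_mul, mul_inv_cancel₀ (hd i), map_one]
  · rw [mul_zero]

theorem diagOp_inv_mul_diagOp {d : ℤ → ℂ} (hd : ∀ i, d i ≠ 0) :
    (diagOp (fun i => (d i)⁻¹) * diagOp d : Op ε) = 1 := by
  refine ext fun i j => ?_
  rw [entry_diagOp_mul, entry_diagOp, entry_one]
  split_ifs with h
  · rw [← map_mul, inv_mul_cancel₀ (hd i), map_one]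
  · rw [mul_zero]

/-- The strictly lower triangular part of a matrix. -/
def lowerPart (A : Op ε) : Op ε :=
  ⟨fun i j => if j < i then A.entry i j else 0, by
    obtain ⟨N, hA⟩ := A.2
    refine ⟨N, fun i j m h => ?_⟩
    beta_reduce at h
    split_ifs at h with hij
    · exact hA i j m h
    · simp at h⟩

theorem entry_lowerPart (A : Op ε) (i j : ℤ) :
    (lowerPart A).entry i j = if j < i then A.entry i j else 0 := rfl

theorem Small.lowerPart {k : ℤ} {A : Op ε} (hA : Small k A) : Small k (lowerPart A) := by
  intro i j m h
  rw [entry_lowerPart] at h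
  split_ifs at h with hij
  · exact hA i j m h
  · simp at h

theorem Bdd.lowerPart {A : Op ε} (hA : Bdd A) : Bdd (lowerPart A) := by
  intro i j m h
  rw [entry_lowerPart] at h
  split_ifs at h with hij
  · exact hA i j m h
  · simp at h

theorem lowerPart_sub (A B : Op ε) : lowerPart (A - B) = lowerPart A - lowerPart B := by
  refine ext fun i j => ?_
  rw [entry_lowerPart, entry_sub, entry_sub, entry_lowerPart, entry_lowerPart]
  split_ifs
  · rfl
  · rw [sub_zero]

/-! ### Factorization of matrices with dominant diagonal -/

/-- Existence in the factorization problem `W U = W̄` for `U = D + (order ≥ 1)` with `D` diagonal: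
the strictly lower part of `W = 1 + A` solves `A = -(N + A N)_{< 0} D⁻¹`. -/
theorem exists_factorization {d : ℤ → ℂ} (hd : ∀ i, d i ≠ 0) {U : Op ε}
    (hb : Bdd (U - diagOp d)) (h1 : Small 1 (U - diagOp d)) :
    ∃ W Wbar : (Op ε)ˣ, (∀ i j : ℤ, i < j → (W : Op ε).entry i j = 0) ∧
      (∀ i : ℤ, (W : Op ε).entry i i = 1) ∧
      (∀ i j : ℤ, j < i → (Wbar : Op ε).entry i j = 0) ∧
      (∀ i : ℤ, IsUnit ((Wbar : Op ε).entry i i)) ∧ (W : Op ε) * U = Wbar := by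
  set D : Op ε := diagOp d with hD
  set D' : Op ε := diagOp fun i => (d i)⁻¹ with hD'
  have hDb : Bdd D := bdd_diagOp _
  have hDb' : Bdd D' := bdd_diagOp _
  have hDD' : D * D' = 1 := diagOp_mul_diagOp_inv hd
  have hD'D : D' * D = 1 := diagOp_inv_mul_diagOp hd
  set N := U - D with hN
  obtain ⟨A, hA, hfix⟩ := exists_fixedPoint (fun A => -lowerPart (N + A * N) * D')
    (fun A h => (hb.add (h.mul hb)).lowerPart.neg.mul hDb') fun A B _ _ k hk => by
      have := ((hk.mul h1).lowerPart.neg.mul hDb'.small)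
      rw [add_zero] at this
      convert this using 1
      have : (A - B) * N = (N + A * N) - (N + B * N) := by rw [sub_mul]; abel
      rw [this, lowerPart_sub, ← sub_mul]
      abel_nf
  have hA1 : Small 1 A := by
    rw [← hfix]
    have := ((h1.add ((hA.small.mul h1).mono (by omega))).lowerPart.neg.mul hDb'.small)
    rwa [add_zero] at this
  have hAlow : ∀ i j, i ≤ j → A.entry i j = 0 := by
    intro i j hij
    rw [← hfix]
    simp only [hD', entry_mul_diagOp]
    rw [entry_neg, entry_lowerPart, if_neg (by omega), neg_zero, zero_mul]
  have hAD : A * D = -lowerPart (N + A * N) := by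
    nth_rewrite 1 [← hfix]
    rw [mul_assoc, hD'D, mul_one]
  set B := A * D + N + A * N with hB
  have hBb : Bdd B := ((hA.mul hDb).add hb).add (hA.mul hb)
  have hB1 : Small 1 B :=
    ((((hA1.mul hDb.small).mono (by omega)).add h1)).add ((hA1.mul h1).mono (by omega))
  -- by the equation for `A`, the upper triangular factor is `D + B`
  have hBup : ∀ i j, j < i → B.entry i j = 0 := by
    intro i j hij
    rw [hB, add_assoc, hAD, entry_add, entry_neg, entry_lowerPart, if_pos hij, neg_add_cancel]
  have hUW : IsUnit (1 + A) := isUnit_one_add hA hA1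
  have hUD : IsUnit D := by
    rw [isUnit_iff_exists_and_exists]
    exact ⟨⟨D', hDD'⟩, ⟨D', hD'D⟩⟩
  have hUB : IsUnit (D + B) := by
    have : D + B = D * (1 + D' * B) := by
      rw [mul_add, mul_one, ← mul_assoc, hDD', one_mul]
    rw [this]
    exact hUD.mul (isUnit_one_add (hDb'.mul hBb) ((hDb'.small.mul hB1).mono (by omega)))
  refine ⟨hUW.unit, hUB.unit, ?_, ?_, ?_, ?_, ?_⟩
  · intro i j hij
    rw [IsUnit.unit_spec, entry_add, entry_one, if_neg hij.ne, hAlow i j hij.le, add_zero]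
  · intro i
    rw [IsUnit.unit_spec, entry_add, entry_one, if_pos rfl, hAlow i i le_rfl, add_zero]
  · intro i j hij
    rw [IsUnit.unit_spec, entry_add, hD, entry_diagOp, if_neg hij.ne', hBup i j hij, add_zero]
  · intro i
    rw [IsUnit.unit_spec, entry_add, hD, entry_diagOp, if_pos rfl,
      MvPowerSeries.isUnit_iff_constantCoeff, map_add, MvPowerSeries.constantCoeff_C]
    have : MvPowerSeries.constantCoeff (B.entry i i) = 0 := by
      by_contra hne
      rw [← MvPowerSeries.coeff_zero_eq_constantCoeff_apply] at hne
      have := hB1 i i 0 hne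
      simp at this
    rw [this, add_zero]
    exact (hd i).isUnit
  · rw [IsUnit.unit_spec, IsUnit.unit_spec, hB]
    have : U = D + N := by rw [hN]; abel
    rw [this]
    noncomm_ring

/-- Uniqueness in the factorization problem: a strictly lower triangular `A` for which `A U` is
upper triangular vanishes. -/
theorem eq_zero_of_lower_of_mul_upper {d : ℤ → ℂ} (hd : ∀ i, d i ≠ 0) {U A : Op ε}
    (h1 : Small 1 (U - diagOp d)) (hA : ∀ i j, i ≤ j → A.entry i j = 0)
    (hAU : ∀ i j, j < i → (A * U).entry i j = 0) : A = 0 := by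
  have key : A = -lowerPart (A * (U - diagOp d)) * diagOp fun i => (d i)⁻¹ := by
    have : A * diagOp d = -lowerPart (A * (U - diagOp d)) := by
      refine ext fun i j => ?_
      rw [entry_mul_diagOp, entry_neg, entry_lowerPart, mul_sub, entry_sub, entry_mul_diagOp]
      split_ifs with hij
      · rw [hAU i j hij]
        ring
      · rw [hA i j (by omega)]
        ring
    rw [← this, mul_assoc, diagOp_mul_diagOp_inv hd, mul_one]
  obtain ⟨k, hk⟩ := exists_small A
  have hstep : ∀ n : ℕ, Small (k + n) A := by
    intro n
    induction n with
    | zero => simpa using hk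
    | succ n ih =>
      rw [key]
      have := (ih.mul h1).lowerPart.neg.mul (bdd_diagOp (ε := ε) fun i => (d i)⁻¹).small
      exact this.mono (by push_cast; omega)
  exact eq_zero_of_forall_small fun n => (hstep (n + k.natAbs)).mono (by omega)

end Op

/-! ### Schur functions and the time-dependent factors -/

theorem coeff_timeSeries (x : ℤ → Coeff) (n : ℕ) :
    PowerSeries.coeff n (timeSeries x) = if n = 0 then 0 else x n := by
  rw [timeSeries, PowerSeries.coeff_mk]

theorem coeff_timeSeries_pow_eq_zero (x : ℤ → Coeff) {n r : ℕ} (h : n < r) :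
    PowerSeries.coeff n (timeSeries x ^ r) = 0 := by
  refine PowerSeries.coeff_of_lt_order _ ?_
  have h1 : (1 : ℕ∞) ≤ (timeSeries x).order := by
    refine PowerSeries.le_order _ _ fun i hi => ?_
    have : i = 0 := by
      have : i < 1 := by exact_mod_cast hi
      omega
    rw [coeff_timeSeries, if_pos this]
  have h2 : (r : ℕ∞) ≤ (timeSeries x ^ r).order := by
    refine le_trans ?_ (PowerSeries.le_order_pow _ r)
    calc (r : ℕ∞) = r • (1 : ℕ∞) := by simp
      _ ≤ r • (timeSeries x).order := nsmul_le_nsmul_right h1 r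
  exact lt_of_lt_of_le (by exact_mod_cast h) h2

/-- The number of terms in the definition of the Schur functions may be increased. -/
theorem schur_natCast (x : ℤ → Coeff) {n R : ℕ} (h : n < R) :
    schur x n = ∑ r ∈ Finset.range R,
      ((r.factorial : ℂ)⁻¹) • PowerSeries.coeff n (timeSeries x ^ r) := by
  rw [schur, if_pos (by omega)]
  simp only [Int.toNat_natCast]
  refine Finset.sum_subset (fun r hr => ?_) fun r _ hr => ?_
  · rw [Finset.mem_range] at hr ⊢
    omega
  · rw [Finset.mem_range] at hr
    rw [coeff_timeSeries_pow_eq_zero x (by omega), smul_zero]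

theorem schur_of_neg (x : ℤ → Coeff) {n : ℤ} (h : n < 0) : schur x n = 0 := by
  rw [schur, if_neg (by omega)]

theorem schur_zero (x : ℤ → Coeff) : schur x 0 = 1 := by
  have := schur_natCast x (n := 0) (R := 1) one_pos
  simpa using this

theorem natCast_mul_coeff_timeSeries_pow_succ (x : ℤ → Coeff) (n r : ℕ) :
    (n : Coeff) * PowerSeries.coeff n (timeSeries x ^ (r + 1)) =
      (r + 1 : ℕ) * ∑ a ∈ Finset.HasAntidiagonal.antidiagonal n,
        (a.1 : Coeff) * x a.1 * PowerSeries.coeff a.2 (timeSeries x ^ r) := by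
  have hX : ∀ (f : PowerSeries Coeff) (k : ℕ),
      PowerSeries.coeff k (PowerSeries.X * PowerSeries.derivative Coeff f) =
        (k : Coeff) * PowerSeries.coeff k f := by
    intro f k
    cases k with
    | zero => simp
    | succ k =>
      rw [PowerSeries.coeff_succ_X_mul, PowerSeries.coeff_derivative]
      push_cast
      ring
  rw [← hX]
  have h1 : PowerSeries.X * PowerSeries.derivative Coeff (timeSeries x ^ (r + 1)) =
      ((r + 1 : ℕ) : PowerSeries Coeff) *
        ((PowerSeries.X * PowerSeries.derivative Coeff (timeSeries x)) * timeSeries x ^ r) := by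
    rw [Derivation.leibniz_pow, Nat.add_sub_cancel, smul_eq_mul, nsmul_eq_mul]
    ring
  rw [h1, ← nsmul_eq_mul, map_nsmul, nsmul_eq_mul, PowerSeries.coeff_mul]
  congr 1
  refine Finset.sum_congr rfl fun a _ => ?_
  rw [hX, coeff_timeSeries]
  split_ifs with h
  · simp [h]
  · rfl

/-- Newton's recursion `n S_n = ∑_k k x_k S_{n-k}`, the logarithmic derivative of
`exp (∑_k x_k z^k)`. -/
theorem natCast_mul_schur (x : ℤ → Coeff) (n : ℕ) :
    (n : Coeff) * schur x n =
      ∑ a ∈ Finset.HasAntidiagonal.antidiagonal n, (a.1 : Coeff) * x a.1 * schur x a.2 := by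
  have hR : ∀ a ∈ Finset.HasAntidiagonal.antidiagonal n,
      (a.1 : Coeff) * x a.1 * schur x a.2 = ∑ r ∈ Finset.range (n + 1),
        ((r.factorial : ℂ)⁻¹) •
          ((a.1 : Coeff) * x a.1 * PowerSeries.coeff a.2 (timeSeries x ^ r)) := by
    intro a ha
    rw [Finset.HasAntidiagonal.mem_antidiagonal] at ha
    rw [schur_natCast x (show a.2 < n + 1 by omega), Finset.mul_sum]
    exact Finset.sum_congr rfl fun r _ => by rw [mul_smul_comm]
  rw [Finset.sum_congr rfl hR, Finset.sum_comm, schur_natCast x (show n < n + 2 by omega),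
    Finset.sum_range_succ', mul_add, Finset.mul_sum]
  have h0 : (n : Coeff) * (((Nat.factorial 0 : ℕ) : ℂ)⁻¹ •
      PowerSeries.coeff n (timeSeries x ^ 0)) = 0 := by
    rw [pow_zero, PowerSeries.coeff_one]
    split_ifs with h
    · simp [h]
    · simp
  rw [h0, add_zero]
  refine Finset.sum_congr rfl fun r _ => ?_
  rw [mul_smul_comm, natCast_mul_coeff_timeSeries_pow_succ, ← Finset.smul_sum, ← nsmul_eq_mul,
    ← Nat.cast_smul_eq_nsmul ℂ, smul_smul]
  congr 1
  rw [Nat.factorial_succ]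
  push_cast
  have h1 : (r : ℂ) + 1 ≠ 0 := by exact_mod_cast Nat.succ_ne_zero r
  have h2 : (r.factorial : ℂ) ≠ 0 := by exact_mod_cast r.factorial_ne_zero
  field_simp

/-- Newton's recursion as a sum over all integers. -/
theorem intCast_mul_schur (x y : ℤ → Coeff) (c : ℂ) (hy : ∀ n, y n = c • x n)
    (hy0 : ∀ n : ℤ, n ≤ 0 → y n = 0) (n : ℤ) (m : Times →₀ ℕ) :
    MvPowerSeries.coeff m (c • ((n : Coeff) * schur x n)) =
      ∑ᶠ k : ℤ, MvPowerSeries.coeff m ((k : Coeff) * y k * schur x (n - k)) := by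
  have hz : ∀ k : ℤ, (k ≤ 0 ∨ n < k) →
      MvPowerSeries.coeff m ((k : Coeff) * y k * schur x (n - k)) = 0 := by
    rintro k (hk | hk)
    · rw [hy0 k hk, mul_zero, zero_mul, map_zero]
    · rw [schur_of_neg x (by omega), mul_zero, map_zero]
  rcases lt_or_ge n 0 with hn | hn
  · rw [schur_of_neg x hn, mul_zero, smul_zero, map_zero, finsum_eq_zero_of_forall_eq_zero]
    intro k
    exact hz k (by omega)
  · obtain ⟨n, rfl⟩ := Int.eq_ofNat_of_zero_le hn
    have h1 := natCast_mul_schur x n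
    have h2 : (((n : ℤ) : Coeff)) = (n : Coeff) := by norm_cast
    rw [h2, h1, Finset.smul_sum, map_sum]
    rw [finsum_eq_sum_of_support_subset (s := (Finset.range (n + 1)).map
      (Nat.castEmbedding (R := ℤ)))]
    · rw [Finset.sum_map, Finset.Nat.sum_antidiagonal_eq_sum_range_succ_mk]
      refine Finset.sum_congr rfl fun k hk => ?_
      rw [Finset.mem_range] at hk
      simp only [Nat.castEmbedding_apply]
      rw [hy, Nat.cast_sub (by omega), mul_smul_comm, smul_mul_assoc]
      norm_cast
    · intro k hk
      by_contra hne
      refine hk (hz k ?_)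
      by_contra hlt
      push Not at hlt
      refine hne ?_
      simp only [Finset.coe_map, Nat.castEmbedding_apply, Set.mem_image, Finset.mem_coe,
        Finset.mem_range]
      exact ⟨k.toNat, by omega, by omega⟩

namespace Op

variable {ε : ℤˣ}

theorem shift_mul_entry (n : ℤ) (A : Op ε) (i j : ℤ) :
    (shift n * A).entry i j = A.entry (i + n) j := by
  rw [entry_mul_eq_of_left (k := i + n) fun l hl => by
    rw [entry_shift, if_neg (by omega)], entry_shift, if_pos (by omega), one_mul]

theorem mul_shift_entry (n : ℤ) (A : Op ε) (i j : ℤ) :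
    (A * shift n).entry i j = A.entry i (j - n) := by
  rw [entry_mul_eq_of_right (k := j - n) fun l hl => by
    rw [entry_shift, if_neg (by omega)], entry_shift, if_pos (by omega), mul_one]

theorem entry_Del (i j : ℤ) : (Del : Op ε).entry i j = if i = j then (i : Coeff) else 0 := rfl

theorem Del_mul_entry (A : Op ε) (i j : ℤ) :
    (Del * A).entry i j = (i : Coeff) * A.entry i j := by
  rw [entry_mul_eq_of_left (k := i) fun l hl => by rw [entry_Del, if_neg hl.symm],
    entry_Del, if_pos rfl]

theorem mul_Del_entry (A : Op ε) (i j : ℤ) :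
    (A * Del).entry i j = A.entry i j * (j : Coeff) := by
  rw [entry_mul_eq_of_right (k := j) fun l hl => by rw [entry_Del, if_neg hl],
    entry_Del, if_pos rfl]

theorem smul_mul' (c : ℂ) (A B : Op ε) : (c • A) * B = c • (A * B) := by
  refine ext fun i j => MvPowerSeries.ext fun m => ?_
  rw [entry_smul, map_smul, coeff_entry_mul, coeff_entry_mul, smul_finsum]
  exact finsum_congr fun k => by rw [entry_smul, smul_mul_assoc, map_smul]

theorem mul_smul' (c : ℂ) (A B : Op ε) : A * (c • B) = c • (A * B) := by
  refine ext fun i j => MvPowerSeries.ext fun m => ?_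
  rw [entry_smul, map_smul, coeff_entry_mul, coeff_entry_mul, smul_finsum]
  exact finsum_congr fun k => by rw [entry_smul, mul_smul_comm, map_smul]

instance : IsScalarTower ℂ (Op ε) (Op ε) := ⟨fun c A B => smul_mul' c A B⟩

instance : SMulCommClass ℂ (Op ε) (Op ε) := ⟨fun c A B => (mul_smul' c A B).symm⟩

theorem val_Lam_zpow (n : ℤ) : (((Lam : (Op ε)ˣ) ^ n : (Op ε)ˣ) : Op ε) = shift n := by
  have h : ∀ n : ℕ, (((Lam : (Op ε)ˣ) ^ n : (Op ε)ˣ) : Op ε) = shift n := by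
    intro n
    induction n with
    | zero => rw [pow_zero, Units.val_one, Nat.cast_zero, shift_zero]
    | succ n ih =>
      rw [pow_succ, Units.val_mul, ih]
      exact (shift_mul_shift _ _).trans (by push_cast; rfl)
  have h' : ∀ n : ℕ, (((Lam : (Op ε)ˣ)⁻¹ ^ n : (Op ε)ˣ) : Op ε) = shift (-n) := by
    intro n
    induction n with
    | zero => rw [pow_zero, Units.val_one, Nat.cast_zero, neg_zero, shift_zero]
    | succ n ih =>
      rw [pow_succ, Units.val_mul, ih]
      exact (shift_mul_shift _ _).trans (by congr 1; push_cast; ring)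
  obtain ⟨k, rfl | rfl⟩ := n.eq_nat_or_neg
  · rw [zpow_natCast, h]
  · rw [zpow_neg, zpow_natCast, ← inv_pow, h']

/-- A matrix that is constant along the diagonals commutes with the shift. -/
theorem commute_shift (n : ℤ) {A : Op ε} (a : ℤ → Coeff) (h : ∀ i j, A.entry i j = a (j - i)) :
    shift n * A = A * shift n := by
  refine ext fun i j => ?_
  rw [shift_mul_entry, mul_shift_entry, h, h]
  congr 1
  ring

theorem entry_expT (hbar : ℂ) (i j : ℤ) :
    (expT hbar : Op ε).entry i j = schur (fun n => hbar⁻¹ • tVar n) (j - i) := rfl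

theorem entry_expTbar (hbar : ℂ) (i j : ℤ) :
    (expTbar hbar : Op ε).entry i j = schur (fun n => (-hbar⁻¹) • tbarVar n) (i - j) := rfl

theorem entry_tSum (i j : ℤ) :
    (tSum : Op ε).entry i j = ((j - i : ℤ) : Coeff) * tVar (j - i) := rfl

theorem entry_tbarSum (i j : ℤ) :
    (tbarSum : Op ε).entry i j = ((i - j : ℤ) : Coeff) * tbarVar (i - j) := rfl

theorem shift_mul_expT (hbar : ℂ) (n : ℤ) :
    (shift n * expT hbar : Op ε) = expT hbar * shift n :=
  commute_shift n _ (entry_expT hbar)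

theorem shift_mul_expTbar (hbar : ℂ) (n : ℤ) :
    (shift n * expTbar hbar : Op ε) = expTbar hbar * shift n :=
  commute_shift n (fun k => schur (fun n => (-hbar⁻¹) • tbarVar n) (-k)) fun i j => by
    rw [entry_expTbar, neg_sub]

/-- `exp (-X) (ħΔ + ∑ n t_n Λ^n) exp X = ħΔ` for `X = ħ⁻¹ ∑ t_n Λ^n`. -/
theorem Del_add_tSum_mul_expT {hbar : ℂ} (h : hbar ≠ 0) :
    ((hbar • Del + tSum) * expT hbar : Op ε) = expT hbar * (hbar • Del) := by
  refine ext fun i j => MvPowerSeries.ext fun m => ?_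
  have key := intCast_mul_schur (fun n => hbar⁻¹ • tVar n) tVar hbar
    (fun n => by rw [smul_smul, mul_inv_cancel₀ h, one_smul])
    (fun n hn => by rw [tVar, dif_neg (by omega)]) (j - i) m
  have h2 : MvPowerSeries.coeff m ((tSum * expT hbar : Op ε).entry i j) =
      ∑ᶠ k : ℤ, MvPowerSeries.coeff m ((k : Coeff) * tVar k *
        schur (fun n => hbar⁻¹ • tVar n) (j - i - k)) := by
    rw [coeff_entry_mul, ← finsum_comp_equiv (Equiv.addRight i)]
    refine finsum_congr fun k => ?_
    rw [Equiv.coe_addRight, entry_tSum, entry_expT, add_sub_cancel_right]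
    congr 3
    ring
  rw [add_mul, entry_add, map_add, h2, ← key, smul_mul_assoc, mul_smul_comm, entry_smul,
    entry_smul, Del_mul_entry, mul_Del_entry, entry_expT, ← map_add, ← smul_add]
  congr 2
  push_cast
  ring

/-- `exp Y (ħΔ - ∑ n t̄_n Λ^{-n}) exp (-Y) = ħΔ` for `Y = -ħ⁻¹ ∑ t̄_n Λ^{-n}`. -/
theorem expTbar_mul_Del_sub_tbarSum {hbar : ℂ} (h : hbar ≠ 0) :
    (expTbar hbar * (hbar • Del - tbarSum) : Op ε) = (hbar • Del) * expTbar hbar := by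
  refine ext fun i j => MvPowerSeries.ext fun m => ?_
  have key := intCast_mul_schur (fun n => (-hbar⁻¹) • tbarVar n) tbarVar (-hbar)
    (fun n => by rw [smul_smul, neg_mul_neg, mul_inv_cancel₀ h, one_smul])
    (fun n hn => by rw [tbarVar, dif_neg (by omega)]) (i - j) m
  have h2 : MvPowerSeries.coeff m ((expTbar hbar * tbarSum : Op ε).entry i j) =
      ∑ᶠ k : ℤ, MvPowerSeries.coeff m ((k : Coeff) * tbarVar k *
        schur (fun n => (-hbar⁻¹) • tbarVar n) (i - j - k)) := by
    rw [coeff_entry_mul, ← finsum_comp_equiv (Equiv.addRight j)]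
    refine finsum_congr fun k => ?_
    rw [Equiv.coe_addRight, entry_tbarSum, entry_expTbar, add_sub_cancel_right, mul_comm]
    congr 3
    ring
  rw [mul_sub, entry_sub, map_sub, h2, ← key, smul_mul_assoc, mul_smul_comm, entry_smul,
    entry_smul, Del_mul_entry, mul_Del_entry, entry_expTbar, ← map_sub, neg_smul, sub_neg_eq_add,
    ← smul_add]
  congr 2
  push_cast
  ring

theorem bdd_expT (hbar : ℂ) : Bdd (expT hbar : Op ε) := fun _ _ _ h =>
  ε_mul_le _ (Or.inl (weight_of_coeff_schur_ne (fun n m' h' =>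
      weight_of_coeff_tVar_ne (right_ne_zero_of_mul (by rwa [map_smul] at h'))) h).symm)

theorem bdd_expTbar (hbar : ℂ) : Bdd (expTbar hbar : Op ε) := fun _ _ _ h =>
  ε_mul_le _ (Or.inr (by
      have := weight_of_coeff_schur_ne (fun n m' h' =>
        weight_of_coeff_tbarVar_ne (right_ne_zero_of_mul (by rwa [map_smul] at h'))) h
      omega))

theorem small_expT_sub_one (hbar : ℂ) : Small 1 (expT hbar - 1 : Op ε) := by
  intro i j m h
  rw [entry_sub, entry_one, entry_expT] at h
  split_ifs at h with hij
  · rw [hij, sub_self, schur_zero, sub_self, map_zero] at h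
    exact absurd rfl h
  · rw [sub_zero] at h
    have h1 := weight_of_coeff_schur_ne (fun n m' h' =>
      weight_of_coeff_tVar_ne (right_ne_zero_of_mul (by rwa [map_smul] at h'))) h
    have h2 : (ε : ℤ) * (j - i) ≤ 0 + weight m := ε_mul_le _ (Or.inl h1.symm)
    omega

theorem small_expTbar_sub_one (hbar : ℂ) : Small 1 (expTbar hbar - 1 : Op ε) := by
  intro i j m h
  rw [entry_sub, entry_one, entry_expTbar] at h
  split_ifs at h with hij
  · rw [hij, sub_self, schur_zero, sub_self, map_zero] at h
    exact absurd rfl h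
  · rw [sub_zero] at h
    have h1 := weight_of_coeff_schur_ne (fun n m' h' =>
      weight_of_coeff_tbarVar_ne (right_ne_zero_of_mul (by rwa [map_smul] at h'))) h
    have h2 : (ε : ℤ) * (j - i) ≤ 0 + weight m := ε_mul_le _ (Or.inr (by omega))
    omega

end Op

/-! ### Dressing operators and string equations for a triangular matrix -/

open Op

variable {ε : ℤˣ}

theorem entry_initialOp (u : Matrix ℤ ℤ ℂ) (hu : IsTriangular ε u) (i j : ℤ) :
    (initialOp u hu).entry i j = MvPowerSeries.C (u i j) := rfl

theorem bdd_initialOp (u : Matrix ℤ ℤ ℂ) (hu : IsTriangular ε u) : Bdd (initialOp u hu) := by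
  intro i j m h
  by_contra hlt
  rw [entry_initialOp, hu i j (by omega), map_zero, map_zero] at h
  exact h rfl

theorem small_initialOp_sub_diagOp (u : Matrix ℤ ℤ ℂ) (hu : IsTriangular ε u) :
    Small 1 (initialOp u hu - diagOp fun i => u i i) := by
  intro i j m h
  rw [entry_sub, entry_initialOp, entry_diagOp] at h
  split_ifs at h with hij
  · rw [hij, sub_self, map_zero] at h
    exact absurd rfl h
  · rw [sub_zero] at h
    by_contra hlt
    refine h ?_
    have h0 : (ε : ℤ) * (j - i) ≠ 0 := mul_ne_zero ε.ne_zero (by omega)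
    rw [hu i j (by omega), map_zero, map_zero]

theorem bdd_evolvedOp_sub (hbar : ℂ) (u : Matrix ℤ ℤ ℂ) (hu : IsTriangular ε u) :
    Bdd (evolvedOp hbar u hu - diagOp fun i => u i i) :=
  (((bdd_expT hbar).mul (bdd_initialOp u hu)).mul (bdd_expTbar hbar)).sub (bdd_diagOp _)

/-- Every factor `t_n Λ^n` or `t̄_n Λ^{-n}` has order at least one, and so has the part of the
initial matrix off the diagonal. -/
theorem small_evolvedOp_sub (hbar : ℂ) (u : Matrix ℤ ℤ ℂ) (hu : IsTriangular ε u) :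
    Small 1 (evolvedOp hbar u hu - diagOp fun i => u i i) := by
  have hu0 := (bdd_initialOp u hu).small
  have h1 := ((small_expT_sub_one (ε := ε) hbar).mul hu0).mul (bdd_expTbar hbar).small
  have h2 := hu0.mul (small_expTbar_sub_one hbar)
  have h3 := (h1.add h2).add (small_initialOp_sub_diagOp u hu)
  have h4 : evolvedOp hbar u hu - diagOp (fun i => u i i) =
      (expT hbar - 1) * initialOp u hu * expTbar hbar + initialOp u hu * (expTbar hbar - 1) +
        (initialOp u hu - diagOp fun i => u i i) := by
    rw [evolvedOp]
    noncomm_ring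
  rwa [h4]

/-- The factorization problem has exactly one solution if the diagonal of the initial matrix has
no zeros. -/
theorem existsUnique_isDressing (hbar : ℂ) (u : Matrix ℤ ℤ ℂ) (hu : IsTriangular ε u)
    (hd : ∀ i, u i i ≠ 0) :
    ∃! V : (Op ε)ˣ × (Op ε)ˣ, IsDressing hbar u hu V.1 V.2 := by
  obtain ⟨W, Wbar, h1, h2, h3, h4, h5⟩ :=
    exists_factorization hd (bdd_evolvedOp_sub hbar u hu) (small_evolvedOp_sub hbar u hu)
  refine ⟨(W, Wbar), ⟨h1, h2, h3, h4, by rw [← h5, Units.inv_mul_cancel_left]⟩, ?_⟩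
  rintro ⟨W', Wbar'⟩ ⟨k1, k2, k3, -, k5⟩
  have k6 : (W' : Op ε) * evolvedOp hbar u hu = Wbar' := by
    rw [k5, Units.mul_inv_cancel_left]
  have hz : (W' : Op ε) - W = 0 := by
    refine eq_zero_of_lower_of_mul_upper hd (small_evolvedOp_sub hbar u hu) (fun i j hij => ?_)
      fun i j hij => ?_
    · rw [entry_sub]
      rcases hij.lt_or_eq with h | rfl
      · rw [h1 i j h, k1 i j h, sub_zero]
      · rw [h2, k2, sub_self]
    · rw [sub_mul, h5, k6, entry_sub, h3 i j hij, k3 i j hij, sub_zero]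
  have hW : W' = W := Units.ext (sub_eq_zero.1 hz)
  have hWbar : Wbar' = Wbar := Units.ext (by rw [← k6, ← h5, hW])
  rw [hW, hWbar]

theorem val_laxOp_zpow (V : (Op ε)ˣ) (n : ℤ) :
    ((laxOp V ^ n : (Op ε)ˣ) : Op ε) = (V : Op ε) * shift n * ((V⁻¹ : (Op ε)ˣ) : Op ε) := by
  rw [laxOp, conj_zpow, Units.val_mul, Units.val_mul, val_Lam_zpow]

/-- The string equations hold as soon as the initial matrix satisfies their numerical analogues:
conjugation by the exponential factors turns the Orlov–Shulman operators into `ħΔ`. -/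
theorem stringEquations_of_recursion {p q : ℤ} {hbar : ℂ} (hh : hbar ≠ 0) {u : Matrix ℤ ℤ ℂ}
    (hu : IsTriangular ε u)
    (h1 : ∀ i j, u (i + p) j =
      hbar / q * (j + (q + 1) / 2) * u i (j + q) + u i (j - p))
    (h2 : ∀ i j, u i (j - q) =
      hbar / p * ((p - 1) / 2 - i) * u (i - p) j + u (i + q) j)
    (hp : p ≠ 0) (hq : q ≠ 0)
    {W Wbar : (Op ε)ˣ} (h : IsDressing hbar u hu W Wbar) : StringEquations p q hbar W Wbar := by
  have hp' : (p : ℂ) ≠ 0 := by exact_mod_cast hp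
  have hq' : (q : ℂ) ≠ 0 := by exact_mod_cast hq
  have hC : ∀ n : ℤ, ((n : ℤ) : Coeff) = MvPowerSeries.C (n : ℂ) := fun n => by simp
  have e1 : shift p * initialOp u hu = (1 / (q : ℂ)) • (initialOp u hu * (hbar • Del) * shift (-q))
      - (hbar * ((q : ℂ) - 1) / (2 * q)) • (initialOp u hu * shift (-q))
      + initialOp u hu * shift p := by
    refine ext fun i j => ?_
    simp only [entry_add, entry_sub, entry_smul, shift_mul_entry, mul_shift_entry, mul_smul_comm,
      smul_mul_assoc, mul_Del_entry, entry_initialOp, hC, ← map_mul, MvPowerSeries.smul_eq_C_mul,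
      ← map_add, ← map_sub, sub_neg_eq_add]
    congr 1
    rw [h1]
    push_cast
    field_simp
    ring
  have e2 : initialOp u hu * shift q =
      -((1 / (p : ℂ)) • ((hbar • Del) * shift (-p) * initialOp u hu))
      + (hbar * ((p : ℂ) - 1) / (2 * p)) • (shift (-p) * initialOp u hu)
      + shift q * initialOp u hu := by
    refine ext fun i j => ?_
    simp only [entry_add, entry_neg, entry_smul, shift_mul_entry, mul_shift_entry,
      smul_mul_assoc, Del_mul_entry, entry_initialOp, hC, ← map_mul, MvPowerSeries.smul_eq_C_mul,
      ← map_add, ← map_neg, mul_assoc, ← sub_eq_add_neg]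
    congr 1
    rw [h2]
    field_simp
    ring
  have hU := h.factor
  have hWU : (W : Op ε) * evolvedOp hbar u hu = Wbar := by
    rw [hU, Units.mul_inv_cancel_left]
  -- the first equation for `U(t, t̄)`
  have f1 : shift p * evolvedOp hbar u hu =
      (1 / (q : ℂ)) • (evolvedOp hbar u hu * (hbar • Del - tbarSum) * shift (-q))
      - (hbar * ((q : ℂ) - 1) / (2 * q)) • (evolvedOp hbar u hu * shift (-q))
      + evolvedOp hbar u hu * shift p := by
    have := congrArg (fun A => expT hbar * A * expTbar hbar) e1
    generalize hbar * ((q : ℂ) - 1) / (2 * q) = c at this ⊢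
    simp only [mul_add, add_mul, mul_sub, sub_mul, mul_smul_comm, smul_mul_assoc] at this
    have a1 : shift p * evolvedOp hbar u hu =
        expT hbar * (shift p * initialOp u hu) * expTbar hbar := by
      rw [evolvedOp, ← mul_assoc, ← mul_assoc, shift_mul_expT]
      noncomm_ring
    have a2 : ∀ n, evolvedOp hbar u hu * shift n =
        expT hbar * (initialOp u hu * shift n) * expTbar hbar := by
      intro n
      rw [evolvedOp, mul_assoc _ _ (shift n), ← shift_mul_expTbar]
      noncomm_ring
    have a3 : evolvedOp hbar u hu * (hbar • Del - tbarSum) * shift (-q) =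
        expT hbar * (initialOp u hu * (hbar • Del) * shift (-q)) * expTbar hbar := by
      rw [evolvedOp, mul_assoc _ (expTbar hbar), expTbar_mul_Del_sub_tbarSum hh, mul_assoc,
        mul_assoc (hbar • Del), ← shift_mul_expTbar]
      simp only [mul_assoc]
    rw [a1, a2, a2, a3, this]
    simp only [mul_smul_comm, smul_mul_assoc]
  -- the second equation for `U(t, t̄)`
  have f2 : evolvedOp hbar u hu * shift q =
      -((1 / (p : ℂ)) • ((hbar • Del + tSum) * shift (-p) * evolvedOp hbar u hu))
      + (hbar * ((p : ℂ) - 1) / (2 * p)) • (shift (-p) * evolvedOp hbar u hu)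
      + shift q * evolvedOp hbar u hu := by
    have := congrArg (fun A => expT hbar * A * expTbar hbar) e2
    generalize hbar * ((p : ℂ) - 1) / (2 * p) = c at this ⊢
    simp only [mul_add, add_mul, mul_neg, neg_mul, mul_smul_comm, smul_mul_assoc] at this
    have a1 : ∀ n, shift n * evolvedOp hbar u hu =
        expT hbar * (shift n * initialOp u hu) * expTbar hbar := by
      intro n
      rw [evolvedOp, ← mul_assoc, ← mul_assoc, shift_mul_expT]
      noncomm_ring
    have a2 : evolvedOp hbar u hu * shift q =
        expT hbar * (initialOp u hu * shift q) * expTbar hbar := by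
      rw [evolvedOp, mul_assoc _ _ (shift q), ← shift_mul_expTbar]
      noncomm_ring
    have a3 : (hbar • Del + tSum) * shift (-p) * evolvedOp hbar u hu =
        expT hbar * ((hbar • Del) * shift (-p) * initialOp u hu) * expTbar hbar := by
      rw [mul_assoc, a1, ← mul_assoc, ← mul_assoc, Del_add_tSum_mul_expT hh]
      simp only [mul_assoc]
    rw [a1, a1, a2, a3, this]
    simp only [mul_smul_comm, smul_mul_assoc]
  -- conjugation: multiply by `W` from the left and by `W̄⁻¹` from the right, where `W U = W̄`
  rw [StringEquations]
  generalize hbar * ((q : ℂ) - 1) / (2 * q) = c at f1 ⊢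
  generalize hbar * ((p : ℂ) - 1) / (2 * p) = c' at f2 ⊢
  constructor
  · have := congrArg (fun A => (W : Op ε) * A * ((Wbar⁻¹ : (Op ε)ˣ) : Op ε)) f1
    simp only [mul_add, add_mul, mul_sub, sub_mul, mul_smul_comm, smul_mul_assoc, ← mul_assoc,
      hWU] at this
    rw [val_laxOp_zpow, val_laxOp_zpow, val_laxOp_zpow, orlovMbar]
    have b1 : (W : Op ε) * shift p * evolvedOp hbar u hu * ((Wbar⁻¹ : (Op ε)ˣ) : Op ε) =
        (W : Op ε) * shift p * ((W⁻¹ : (Op ε)ˣ) : Op ε) := by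
      rw [hU, ← mul_assoc, Units.mul_inv_cancel_right]
    rw [← b1, this]
    simp only [mul_sub, sub_mul, mul_smul_comm, smul_mul_assoc, ← mul_assoc,
      Units.inv_mul_cancel_right]
  · have := congrArg (fun A => (W : Op ε) * A * ((Wbar⁻¹ : (Op ε)ˣ) : Op ε)) f2
    have b1 : ∀ A : Op ε, A * evolvedOp hbar u hu * ((Wbar⁻¹ : (Op ε)ˣ) : Op ε) =
        A * ((W⁻¹ : (Op ε)ˣ) : Op ε) := by
      intro A
      rw [hU, ← mul_assoc, Units.mul_inv_cancel_right]
    simp only [mul_add, add_mul, mul_neg, neg_mul, mul_smul_comm, smul_mul_assoc, ← mul_assoc,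
      hWU, b1] at this
    rw [val_laxOp_zpow, val_laxOp_zpow, val_laxOp_zpow, orlovM]
    rw [this]
    simp only [mul_add, add_mul, mul_smul_comm, smul_mul_assoc, ← mul_assoc,
      Units.inv_mul_cancel_right]

/-! ### The case `p + q = 0` -/

theorem gammaMatrix_self_ne_zero {p : ℤ} {hbar : ℝ} (hh : hbar ≠ 0) (hr : GammaRegular p hbar)
    (i : ℤ) : gammaMatrix p hbar i i ≠ 0 := by
  have h0 : (-(hbar : ℂ)) ≠ 0 := neg_ne_zero.2 (by exact_mod_cast hh)
  rw [gammaMatrix, Matrix.diagonal_apply_eq]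
  refine div_ne_zero (mul_ne_zero ?_ ?_) ?_
  · rw [Complex.cpow_ne_zero_iff]
    exact Or.inl h0
  · exact Complex.Gamma_ne_zero fun n h => hr.2 i n (by exact_mod_cast h)
  · exact Complex.Gamma_ne_zero fun n h => hr.1 n (by exact_mod_cast h)

/-- The functional equation of `Γ` as a recursion for the entries of the matrix. -/
theorem gammaMatrix_self_recursion {p : ℤ} (hp : p ≠ 0) {hbar : ℝ} (hh : hbar ≠ 0)
    (hr : GammaRegular p hbar) (i : ℤ) :
    gammaMatrix p hbar i i =
      ((hbar : ℂ) / p * ((p - 1) / 2 - i) + 1) * gammaMatrix p hbar (i - p) (i - p) := by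
  have h0 : (-(hbar : ℂ)) ≠ 0 := neg_ne_zero.2 (by exact_mod_cast hh)
  have hh' : (hbar : ℂ) ≠ 0 := by exact_mod_cast hh
  have hp' : (p : ℂ) ≠ 0 := by exact_mod_cast hp
  have hp'' : (p : ℝ) ≠ 0 := by exact_mod_cast hp
  have hx : gammaArg p hbar i = gammaArg p hbar (i - p) + 1 := by
    rw [gammaArg, gammaArg]
    push_cast
    field_simp
    ring
  have hx0 : ((gammaArg p hbar (i - p) : ℝ) : ℂ) ≠ 0 := by
    have := hr.2 (i - p) 0
    simpa using this
  have he : ((i : ℂ) + 1 / 2) / p = (((i - p : ℤ) : ℂ) + 1 / 2) / p + 1 := by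
    push_cast
    field_simp
    ring
  rw [gammaMatrix, Matrix.diagonal_apply_eq, Matrix.diagonal_apply_eq, hx, he,
    Complex.cpow_add _ _ h0, Complex.cpow_one, Complex.ofReal_add, Complex.ofReal_one,
    Complex.Gamma_add_one _ hx0]
  have hc : (-(hbar : ℂ)) * (gammaArg p hbar (i - p) : ℝ) =
      (hbar : ℂ) / p * ((p - 1) / 2 - i) + 1 := by
    rw [gammaArg]
    push_cast
    field_simp
    ring
  rw [← hc]
  ring

theorem gammaMatrix_of_ne {p : ℤ} {hbar : ℝ} {i j : ℤ} (h : i ≠ j) : gammaMatrix p hbar i j = 0 :=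
  Matrix.diagonal_apply_ne _ h

theorem gammaMatrix_solution {p q : ℤ} (hp : p ≠ 0) (hq : q ≠ 0) (hpq : p + q = 0) {hbar : ℝ}
    (hh : hbar ≠ 0) (hr : GammaRegular p hbar) (ε : ℤˣ) :
    (∃! V : (Op ε)ˣ × (Op ε)ˣ, IsDressing (hbar : ℂ) (gammaMatrix p hbar)
      (isTriangular_gammaMatrix ε p hbar) V.1 V.2) ∧
    ∀ W Wbar : (Op ε)ˣ, IsDressing (hbar : ℂ) (gammaMatrix p hbar)
      (isTriangular_gammaMatrix ε p hbar) W Wbar → StringEquations p q (hbar : ℂ) W Wbar := by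
  refine ⟨existsUnique_isDressing _ _ _ (gammaMatrix_self_ne_zero hh hr), fun W Wbar h => ?_⟩
  have hp' : (p : ℂ) ≠ 0 := by exact_mod_cast hp
  obtain rfl : q = -p := by omega
  refine stringEquations_of_recursion (by exact_mod_cast hh) _ (fun i j => ?_) (fun i j => ?_)
    hp hq h
  · by_cases hij : i + p = j
    · subst hij
      rw [show i + p + -p = i by ring, show i + p - p = i by ring,
        gammaMatrix_self_recursion hp hh hr (i + p), show i + p - p = i by ring]
      push_cast
      field_simp
      ring
    · rw [gammaMatrix_of_ne hij, gammaMatrix_of_ne (by omega), gammaMatrix_of_ne (by omega)]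
      ring
  · by_cases hij : i = j + p
    · subst hij
      rw [show j - -p = j + p by ring, show j + p + -p = j by ring, show j + p - p = j by ring,
        gammaMatrix_self_recursion hp hh hr (j + p), show j + p - p = j by ring]
      ring
    · rw [gammaMatrix_of_ne (by omega), gammaMatrix_of_ne (by omega), gammaMatrix_of_ne (by omega)]
      ring

/-- After the substitution `x = μ^q` the integral is Euler's integral for `Γ`. -/
theorem integral_degenerateIntegrand {p q : ℤ} (hp : p ≠ 0) (hpq : p + q = 0) {hbar : ℝ}
    (hh : hbar < 0) {j : ℤ} (hx : 0 < gammaArg p hbar j) {l : ℝ} (hl : 0 < l) :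
    MeasureTheory.IntegrableOn (degenerateIntegrand p q hbar j l) (Set.Ioi 0) ∧
      ∫ μ in Set.Ioi (0 : ℝ), degenerateIntegrand p q hbar j l μ =
        |(p : ℝ)|⁻¹ * ((1 / (l ^ p / (-hbar))) ^ gammaArg p hbar j *
          Real.Gamma (gammaArg p hbar j)) := by
  obtain rfl : q = -p := by omega
  set x := gammaArg p hbar j with hxdef
  set b : ℝ := l ^ p / (-hbar) with hb
  have hb0 : 0 < b := div_pos (zpow_pos hl p) (by linarith)
  have hp' : (p : ℝ) ≠ 0 := by exact_mod_cast hp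
  have hq' : ((-p : ℤ) : ℝ) ≠ 0 := by push_cast; exact neg_ne_zero.2 hp'
  let g : ℝ → ℝ := fun t => t ^ (x - 1) * Real.exp (-(b * t))
  have hg : MeasureTheory.IntegrableOn g (Set.Ioi 0) := by
    have := integrableOn_rpow_mul_exp_neg_mul_rpow (p := 1) (s := x - 1) (by linarith) one_pos hb0
    simpa [g] using this
  have hcongr : Set.EqOn (degenerateIntegrand p (-p) hbar j l)
      (fun t => t ^ (((-p : ℤ) : ℝ) - 1) • g (t ^ ((-p : ℤ) : ℝ))) (Set.Ioi 0) := by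
    intro t ht
    have ht0 : (0 : ℝ) < t := ht
    simp only [degenerateIntegrand, g, smul_eq_mul]
    rw [← Real.rpow_mul ht0.le, ← mul_assoc, ← Real.rpow_add ht0, ← Real.rpow_intCast t (-p)]
    have h1 : hbar⁻¹ * (l ^ p * t ^ ((-p : ℤ) : ℝ) - ((-p : ℤ) : ℝ) * Real.log t) =
        Real.log t * (p / hbar) + -(b * t ^ ((-p : ℤ) : ℝ)) := by
      rw [hb]
      push_cast
      have := hh.ne
      field_simp
      ring
    rw [h1, Real.exp_add, ← Real.rpow_def_of_pos ht0, ← mul_assoc, ← Real.rpow_add ht0]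
    congr 2
    rw [hxdef, gammaArg]
    push_cast
    have := hh.ne
    field_simp
    ring
  constructor
  · rw [MeasureTheory.integrableOn_congr_fun hcongr measurableSet_Ioi,
      MeasureTheory.integrableOn_Ioi_comp_rpow_iff' g hq']
    exact hg
  · have h1 := MeasureTheory.integral_comp_rpow_Ioi g hq'
    have h2 := Real.integral_rpow_mul_exp_neg_mul_Ioi hx hb0
    rw [MeasureTheory.setIntegral_congr_fun measurableSet_Ioi hcongr, ← h2, ← h1,
      ← MeasureTheory.integral_const_mul]
    refine MeasureTheory.setIntegral_congr_fun measurableSet_Ioi fun t _ => ?_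
    simp only [smul_eq_mul]
    push_cast
    rw [abs_neg]
    have : |(p : ℝ)| ≠ 0 := abs_ne_zero.2 hp'
    field_simp

theorem degenerate_generating_function {p q : ℤ} (hp : p ≠ 0) (hpq : p + q = 0) {hbar : ℝ}
    (hh : hbar < 0) {j : ℤ} (hx : 0 < gammaArg p hbar j) {l : ℝ} (hl : 0 < l) :
    ((degeneratePrefactor p hbar l *
        ∫ μ in Set.Ioi (0 : ℝ), degenerateIntegrand p q hbar j l μ : ℝ) : ℂ) =
      (l : ℂ) ^ (-j - 1) * gammaMatrix p hbar j j := by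
  have hp' : (p : ℝ) ≠ 0 := by exact_mod_cast hp
  have hn : 0 < -hbar := by linarith
  have key : degeneratePrefactor p hbar l *
      ∫ μ in Set.Ioi (0 : ℝ), degenerateIntegrand p q hbar j l μ =
      l ^ (-j - 1) * ((-hbar) ^ (((j : ℝ) + 1 / 2) / p) * Real.Gamma (gammaArg p hbar j) /
        Real.Gamma (1 / 2 - 1 / hbar)) := by
    rw [(integral_degenerateIntegrand hp hpq hh hx hl).2, degeneratePrefactor]
    have e1 : Real.exp (hbar⁻¹ * (-p * Real.log l)) = l ^ (-(p : ℝ) / hbar) := by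
      rw [Real.rpow_def_of_pos hl]
      congr 1
      ring
    have e2 : (1 / (l ^ p / (-hbar))) ^ gammaArg p hbar j =
        (-hbar) ^ gammaArg p hbar j * l ^ (-(p : ℝ) * gammaArg p hbar j) := by
      rw [one_div_div, Real.div_rpow hn.le (zpow_pos hl p).le, ← Real.rpow_intCast,
        ← Real.rpow_mul hl.le, neg_mul, Real.rpow_neg hl.le, div_eq_mul_inv]
    have e3 : l ^ (-j - 1) = l ^ (((p : ℝ) - 1) / 2) * l ^ (-(p : ℝ) / hbar) *
        l ^ (-(p : ℝ) * gammaArg p hbar j) := by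
      rw [← Real.rpow_add hl, ← Real.rpow_add hl, ← Real.rpow_intCast]
      congr 1
      rw [gammaArg]
      push_cast
      have := hh.ne
      field_simp
      ring
    have e4 : (-hbar) ^ (((j : ℝ) + 1 / 2) / p) =
        (-hbar) ^ (1 / hbar - 1 / 2) * (-hbar) ^ gammaArg p hbar j := by
      rw [← Real.rpow_add hn]
      congr 1
      rw [gammaArg]
      ring
    rw [e1, e2, e3, e4]
    have : |(p : ℝ)| ≠ 0 := abs_ne_zero.2 hp'
    field_simp
  rw [key, gammaMatrix, Matrix.diagonal_apply_eq, Complex.Gamma_ofReal, Complex.Gamma_ofReal]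
  push_cast
  rw [Complex.ofReal_cpow hn.le]
  push_cast
  ring

/-! ### Asymptotic expansions in powers `X^{-k-1/2}` -/

/-- The function `f` has the asymptotic expansion `∑_k c_k X^{-k-1/2}` as `X → +∞`. -/
def HasExpansion (f : ℝ → ℂ) (c : ℕ → ℂ) : Prop :=
  ∀ K : ℕ, (fun X : ℝ => f X - ∑ k ∈ Finset.range K, c k * ((X ^ (-(k : ℝ) - 1 / 2) : ℝ) : ℂ))
    =O[atTop] fun X : ℝ => X ^ (-(K : ℝ) - 1 / 2)

namespace HasExpansion

variable {f g : ℝ → ℂ} {c d : ℕ → ℂ}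

theorem congr' (hf : HasExpansion f c) (h : f =ᶠ[atTop] g) : HasExpansion g c := fun K =>
  (hf K).congr' (h.mono fun X hX => by simp only [hX]) EventuallyEq.rfl

theorem add (hf : HasExpansion f c) (hg : HasExpansion g d) :
    HasExpansion (fun X => f X + g X) (fun k => c k + d k) := fun K =>
  ((hf K).add (hg K)).congr_left fun X => by
    simp only [add_mul, Finset.sum_add_distrib]
    ring

theorem const_mul (hf : HasExpansion f c) (a : ℂ) :
    HasExpansion (fun X => a * f X) (fun k => a * c k) := fun K =>
  ((hf K).const_mul_left a).congr_left fun X => by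
    simp only [mul_assoc, ← Finset.mul_sum, mul_sub]

theorem sub (hf : HasExpansion f c) (hg : HasExpansion g d) :
    HasExpansion (fun X => f X - g X) (fun k => c k - d k) := by
  have := hf.add (hg.const_mul (-1))
  simpa [← sub_eq_add_neg] using this

theorem zero_of_isBigO_exp {r : ℝ} (hr : 0 < r)
    (h : f =O[atTop] fun X => Real.exp (-r * X)) : HasExpansion f 0 := fun K => by
  have := h.trans (isLittleO_exp_neg_mul_rpow_atTop hr (-(K : ℝ) - 1 / 2)).isBigO
  simpa using this

theorem const_mul_exp (e : ℂ) {ζ : ℂ} (hζ : ζ.re < 0) :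
    HasExpansion (fun X : ℝ => e * Complex.exp (X * ζ)) 0 := by
  refine zero_of_isBigO_exp (neg_pos.2 hζ) (IsBigO.const_mul_left ?_ _)
  refine isBigO_of_le _ fun X => ?_
  rw [Complex.norm_exp, Complex.re_ofReal_mul, Real.norm_of_nonneg (Real.exp_nonneg _), neg_neg,
    mul_comm]

theorem inv_mul (hf : HasExpansion f c) :
    HasExpansion (fun X => (X : ℂ)⁻¹ * f X) (fun k => if k = 0 then 0 else c (k - 1)) := by
  have hpow : ∀ K : ℕ, ∀ᶠ X : ℝ in atTop,
      X ^ (-((K + 1 : ℕ) : ℝ) - 1 / 2) = X⁻¹ * X ^ (-(K : ℝ) - 1 / 2) := by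
    intro K
    filter_upwards [eventually_gt_atTop 0] with X hX
    rw [← Real.rpow_neg_one, ← Real.rpow_add hX]
    congr 1
    push_cast
    ring
  have hO : ∀ K : ℕ, (fun X : ℝ => X⁻¹ * X ^ (-(K : ℝ) - 1 / 2))
      =O[atTop] fun X : ℝ => X ^ (-(K : ℝ) - 1 / 2) := by
    intro K
    have h1 : (fun X : ℝ => X⁻¹) =O[atTop] fun _ => (1 : ℝ) := tendsto_inv_atTop_zero.isBigO_one ℝ
    simpa using h1.mul (isBigO_refl (fun X : ℝ => X ^ (-(K : ℝ) - 1 / 2)) atTop)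
  have hinv : (fun X : ℝ => (X : ℂ)⁻¹) =O[atTop] fun X : ℝ => X⁻¹ :=
    isBigO_of_le _ fun X => by simp
  intro K
  cases K with
  | zero =>
    have := (hinv.mul (hf 0)).trans (hO 0)
    simpa using this
  | succ K =>
    refine (((hinv.mul (hf K)).congr' ?_ ((hpow K).mono fun X hX => hX.symm)))
    have hall : ∀ᶠ X : ℝ in atTop, ∀ k ∈ Finset.range K,
        X ^ (-((k + 1 : ℕ) : ℝ) - 1 / 2) = X⁻¹ * X ^ (-(k : ℝ) - 1 / 2) :=
      (Finset.eventually_all _).2 fun k _ => hpow k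
    filter_upwards [hall] with X hX
    rw [Finset.sum_range_succ', mul_sub, Finset.mul_sum]
    simp only [if_true, zero_mul, add_zero]
    congr 1
    refine Finset.sum_congr rfl fun k hk => ?_
    rw [hX k hk, if_neg (Nat.succ_ne_zero k), Nat.add_sub_cancel]
    push_cast
    ring

/-- The coefficients of an asymptotic expansion are determined by the function. -/
theorem unique (hf : HasExpansion f c) (hf' : HasExpansion f d) : c = d := by
  have h0 : HasExpansion (fun _ => 0) (fun k => c k - d k) := by
    simpa using hf.sub hf'
  have hz : ∀ n, c n - d n = 0 := by
    intro n
    induction n using Nat.strong_induction_on with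
    | _ n ih =>
      have h1 := h0 (n + 1)
      rw [isBigO_iff] at h1
      obtain ⟨C, hC⟩ := h1
      have hle : ∀ᶠ X : ℝ in atTop, ‖c n - d n‖ ≤ C * X⁻¹ := by
        filter_upwards [hC, eventually_gt_atTop 0] with X hX hX0
        rw [Finset.sum_range_succ, Finset.sum_eq_zero fun k hk => by
          rw [ih k (Finset.mem_range.1 hk), zero_mul]] at hX
        rw [zero_add, zero_sub, norm_neg, norm_mul, Complex.norm_real, Real.norm_eq_abs,
          Real.norm_eq_abs, abs_of_pos (Real.rpow_pos_of_pos hX0 _),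
          abs_of_pos (Real.rpow_pos_of_pos hX0 _)] at hX
        have h2 : X ^ (-((n + 1 : ℕ) : ℝ) - 1 / 2) = X⁻¹ * X ^ (-(n : ℝ) - 1 / 2) := by
          rw [← Real.rpow_neg_one, ← Real.rpow_add hX0]
          congr 1
          push_cast
          ring
        rw [h2, ← mul_assoc] at hX
        exact le_of_mul_le_mul_right hX (Real.rpow_pos_of_pos hX0 _)
      have hlim : Tendsto (fun X : ℝ => C * X⁻¹) atTop (𝓝 0) := by
        simpa using tendsto_inv_atTop_zero.const_mul C
      have := ge_of_tendsto hlim hle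
      exact norm_le_zero_iff.1 this
  funext n
  exact sub_eq_zero.1 (hz n)

theorem comp_two_mul (hf : HasExpansion f c) :
    HasExpansion (fun X => f (2 * X))
      (fun k => c k * (((2 : ℝ) ^ (-(k : ℝ) - 1 / 2) : ℝ) : ℂ)) := by
  intro K
  have h2 : Tendsto (fun X : ℝ => 2 * X) atTop atTop := tendsto_id.const_mul_atTop two_pos
  have hm : ∀ (k : ℕ) (X : ℝ), 0 < X → (2 * X) ^ (-(k : ℝ) - 1 / 2) =
      2 ^ (-(k : ℝ) - 1 / 2) * X ^ (-(k : ℝ) - 1 / 2) := fun k X hX =>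
    Real.mul_rpow two_pos.le hX.le
  have h1 := (hf K).comp_tendsto h2
  have h3 : ((fun X : ℝ => X ^ (-(K : ℝ) - 1 / 2)) ∘ fun X : ℝ => 2 * X) =O[atTop]
      fun X : ℝ => X ^ (-(K : ℝ) - 1 / 2) := by
    refine (((isBigO_refl _ _).const_mul_left ((2 : ℝ) ^ (-(K : ℝ) - 1 / 2)))).congr' ?_
      EventuallyEq.rfl
    filter_upwards [eventually_gt_atTop 0] with X hX
    exact (hm K X hX).symm
  refine (h1.trans h3).congr' ?_ EventuallyEq.rfl
  filter_upwards [eventually_gt_atTop 0] with X hX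
  simp only [Function.comp_apply]
  congr 1
  refine Finset.sum_congr rfl fun k _ => ?_
  rw [hm k X hX]
  push_cast
  ring

theorem integral_comp_mul (hf : HasExpansion f c) (hcont : ContinuousOn f (Set.Ioi 0)) :
    HasExpansion (fun X => ∫ s in (1 : ℝ)..2, f (s * X))
      (fun k => c k * ((∫ s in (1 : ℝ)..2, s ^ (-(k : ℝ) - 1 / 2) : ℝ) : ℂ)) := by
  intro K
  obtain ⟨C, hC⟩ := isBigO_iff.1 (hf K)
  obtain ⟨X₀, hX₀⟩ := eventually_atTop.1 hC
  refine isBigO_iff.2 ⟨C, ?_⟩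
  filter_upwards [eventually_ge_atTop X₀, eventually_gt_atTop 0] with X hX hXpos
  have hIcc : ∀ s ∈ Set.uIcc (1 : ℝ) 2, 1 ≤ s := by
    intro s hs
    rw [Set.uIcc_of_le one_le_two] at hs
    exact hs.1
  have hfi : IntervalIntegrable (fun s => f (s * X)) MeasureTheory.volume 1 2 := by
    refine ContinuousOn.intervalIntegrable ?_
    refine hcont.comp (by fun_prop) fun s hs => ?_
    exact mul_pos (one_pos.trans_le (hIcc s hs)) hXpos
  have hmi : ∀ k : ℕ, IntervalIntegrable (fun s : ℝ => s ^ (-(k : ℝ) - 1 / 2))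
      MeasureTheory.volume 1 2 := by
    intro k
    refine ContinuousOn.intervalIntegrable fun s hs => ?_
    exact (Real.continuousAt_rpow_const _ _
      (Or.inl (one_pos.trans_le (hIcc s hs)).ne')).continuousWithinAt
  have hmono : ∀ k : ℕ, c k * ((∫ s in (1 : ℝ)..2, s ^ (-(k : ℝ) - 1 / 2) : ℝ) : ℂ) *
      ((X ^ (-(k : ℝ) - 1 / 2) : ℝ) : ℂ) =
      ∫ s in (1 : ℝ)..2, c k * (((s * X) ^ (-(k : ℝ) - 1 / 2) : ℝ) : ℂ) := by
    intro k
    rw [← intervalIntegral.integral_ofReal, mul_assoc, ← intervalIntegral.integral_mul_const,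
      ← intervalIntegral.integral_const_mul]
    refine intervalIntegral.integral_congr fun s hs => ?_
    rw [Real.mul_rpow (zero_le_one.trans (hIcc s hs)) hXpos.le]
    push_cast
    ring
  have hmi' : ∀ k : ℕ, IntervalIntegrable
      (fun s : ℝ => c k * (((s * X) ^ (-(k : ℝ) - 1 / 2) : ℝ) : ℂ)) MeasureTheory.volume 1 2 := by
    intro k
    have h1 : IntervalIntegrable (fun s : ℝ => (((s ^ (-(k : ℝ) - 1 / 2) : ℝ)) : ℂ))
      MeasureTheory.volume 1 2 := ⟨(hmi k).1.ofReal, (hmi k).2.ofReal⟩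
    refine (h1.const_mul (c k * ((X ^ (-(k : ℝ) - 1 / 2) : ℝ) : ℂ))).congr fun s hs => ?_
    rw [Set.uIoc_of_le one_le_two] at hs
    rw [Real.mul_rpow (zero_le_one.trans hs.1.le) hXpos.le]
    push_cast
    ring
  rw [Finset.sum_congr rfl fun k _ => hmono k,
    ← intervalIntegral.integral_finsetSum fun k _ => hmi' k,
    ← intervalIntegral.integral_sub hfi (by
      have := IntervalIntegrable.sum (Finset.range K) fun k _ => hmi' k
      rwa [Finset.sum_fn] at this)]
  have hbound : ∀ s ∈ Set.uIoc (1 : ℝ) 2,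
      ‖f (s * X) - ∑ k ∈ Finset.range K, c k * (((s * X) ^ (-(k : ℝ) - 1 / 2) : ℝ) : ℂ)‖ ≤
        C * ‖X ^ (-(K : ℝ) - 1 / 2)‖ := by
    intro s hs
    rw [Set.uIoc_of_le one_le_two] at hs
    have hsX : X ≤ s * X := le_mul_of_one_le_left hXpos.le hs.1.le
    have h1 := hX₀ (s * X) (hX.trans hsX)
    have hC0 : 0 ≤ C := by
      by_contra hneg
      have h3 : 0 < ‖(s * X) ^ (-(K : ℝ) - 1 / 2)‖ :=
        norm_pos_iff.2 (Real.rpow_pos_of_pos (hXpos.trans_le hsX) _).ne'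
      have := (norm_nonneg _).trans h1
      nlinarith
    refine h1.trans (mul_le_mul_of_nonneg_left ?_ hC0)
    rw [Real.norm_of_nonneg (Real.rpow_nonneg (hXpos.le.trans hsX) _),
      Real.norm_of_nonneg (Real.rpow_nonneg hXpos.le _)]
    exact Real.rpow_le_rpow_of_nonpos hXpos hsX (by
      have : (0 : ℝ) ≤ K := Nat.cast_nonneg K
      linarith)
  have := intervalIntegral.norm_integral_le_of_norm_le_const hbound
  refine this.trans (le_of_eq ?_)
  norm_num

/-- If a function and its derivative both have expansions, then the expansion may be differentiated
termwise. Both expansions are compared through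
`X⁻¹ (f (2X) - f X) = ∫_1^2 f' (s X) ds`; no logarithm occurs since the exponents are
half-integers. -/
theorem deriv_coeff {f' : ℝ → ℂ} (hf : HasExpansion f c) (hf' : HasExpansion f' d)
    (hd : ∀ X, 0 < X → HasDerivAt f (f' X) X) (hcont : ContinuousOn f' (Set.Ioi 0)) (k : ℕ) :
    d (k + 1) = -((k : ℂ) + 1 / 2) * c k := by
  have h1 := ((hf.comp_two_mul).sub hf).inv_mul
  have h2 := hf'.integral_comp_mul hcont
  have h3 : (fun X => ∫ s in (1 : ℝ)..2, f' (s * X)) =ᶠ[atTop]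
      fun X : ℝ => (X : ℂ)⁻¹ * (f (2 * X) - f X) := by
    filter_upwards [eventually_gt_atTop 0] with X hX
    have e1 : ∫ t in X..2 * X, f' t = f (2 * X) - f X := by
      have hpos : ∀ t ∈ Set.uIcc X (2 * X), 0 < t := by
        intro t ht
        rw [Set.uIcc_of_le (by linarith)] at ht
        exact hX.trans_le ht.1
      refine intervalIntegral.integral_eq_sub_of_hasDerivAt (fun t ht => hd t (hpos t ht)) ?_
      exact ContinuousOn.intervalIntegrable (hcont.mono fun t ht => hpos t ht)
    have e2 := intervalIntegral.integral_comp_mul_right f' hX.ne' (a := 1) (b := 2)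
    rw [one_mul] at e2
    rw [e2, e1, Complex.real_smul, Complex.ofReal_inv]
  have h4 := congrFun ((h2.congr' h3).unique h1) (k + 1)
  have hne : -(k : ℝ) - 1 / 2 ≠ 0 := by
    have : (0 : ℝ) ≤ k := Nat.cast_nonneg k
    linarith
  have e3 : ∫ s in (1 : ℝ)..2, s ^ (-((k + 1 : ℕ) : ℝ) - 1 / 2) =
      (2 ^ (-(k : ℝ) - 1 / 2) - 1) / (-(k : ℝ) - 1 / 2) := by
    rw [integral_rpow (Or.inr ⟨by push_cast; contrapose! hne; linarith, by
      rw [Set.uIcc_of_le one_le_two]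
      rintro ⟨h, -⟩
      linarith⟩), Real.one_rpow]
    have : -((k + 1 : ℕ) : ℝ) - 1 / 2 + 1 = -(k : ℝ) - 1 / 2 := by
      push_cast
      ring
    rw [this]
  have hpow : (2 : ℝ) ^ (-(k : ℝ) - 1 / 2) - 1 ≠ 0 := by
    have : (2 : ℝ) ^ (-(k : ℝ) - 1 / 2) < 1 := Real.rpow_lt_one_of_one_lt_of_neg one_lt_two (by
      have : (0 : ℝ) ≤ k := Nat.cast_nonneg k
      linarith)
    linarith
  simp only [e3, if_neg (Nat.succ_ne_zero k), Nat.add_sub_cancel] at h4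
  have hpow' : (((2 : ℝ) ^ (-(k : ℝ) - 1 / 2) : ℝ) : ℂ) - 1 ≠ 0 := by exact_mod_cast hpow
  have hne' : -((k : ℂ) * 2) - 1 ≠ 0 := by
    have : (((2 * (-(k : ℝ) - 1 / 2) : ℝ)) : ℂ) ≠ 0 :=
      Complex.ofReal_ne_zero.2 (mul_ne_zero two_ne_zero hne)
    push_cast at this
    convert this using 1
    ring
  push_cast at h4 hpow'
  generalize ((2 : ℝ) ^ (-(k : ℝ) - 1 / 2) : ℝ) = z at *
  field_simp at h4
  linear_combination h4 / 2

end HasExpansion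

/-! ### Laplace integrals along a path -/

/-- A `C¹` path `γ : [a, b] → U` with derivative `γ'`. -/
structure IsC1Path (U : Set ℂ) (γ γ' : ℝ → ℂ) (a b : ℝ) : Prop where
  le : a ≤ b
  continuousOn : ContinuousOn γ (Set.Icc a b)
  continuousOn_deriv : ContinuousOn γ' (Set.Icc a b)
  hasDerivAt : ∀ τ ∈ Set.Ioo a b, HasDerivAt γ (γ' τ) τ
  mem : ∀ τ ∈ Set.Icc a b, γ τ ∈ U

theorem IsC1Path.mono {U V : Set ℂ} {γ γ' : ℝ → ℂ} {a b a' b' : ℝ} (h : IsC1Path U γ γ' a b)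
    (hle : a' ≤ b') (ha : a ≤ a') (hb : b' ≤ b) (hV : ∀ τ ∈ Set.Icc a' b', γ τ ∈ V) :
    IsC1Path V γ γ' a' b' where
  le := hle
  continuousOn := h.continuousOn.mono (Set.Icc_subset_Icc ha hb)
  continuousOn_deriv := h.continuousOn_deriv.mono (Set.Icc_subset_Icc ha hb)
  hasDerivAt τ hτ := h.hasDerivAt τ (Set.Ioo_subset_Ioo ha hb hτ)
  mem := hV

/-- The integral `∫_γ g(z) e^{X ψ(z)} dz` along the path `z = γ(τ)`, `τ ∈ [a, b]`. -/
def laplaceIntegral (γ γ' : ℝ → ℂ) (a b : ℝ) (ψ g : ℂ → ℂ) (X : ℝ) : ℂ :=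
  ∫ τ in a..b, g (γ τ) * Complex.exp (X * ψ (γ τ)) * γ' τ

section Path

variable {U : Set ℂ} {γ γ' : ℝ → ℂ} {a b : ℝ} {ψ g h : ℂ → ℂ}

theorem IsC1Path.continuousOn_integrand (hγ : IsC1Path U γ γ' a b) (hψ : ContinuousOn ψ U)
    (hg : ContinuousOn g U) (X : ℝ) :
    ContinuousOn (fun τ => g (γ τ) * Complex.exp (X * ψ (γ τ)) * γ' τ) (Set.Icc a b) := by
  have h1 : ContinuousOn (fun τ => g (γ τ)) (Set.Icc a b) := hg.comp hγ.continuousOn hγ.mem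
  have h2 : ContinuousOn (fun τ => ψ (γ τ)) (Set.Icc a b) := hψ.comp hγ.continuousOn hγ.mem
  exact (h1.mul (Complex.continuous_exp.comp_continuousOn (continuousOn_const.mul h2))).mul
    hγ.continuousOn_deriv

theorem IsC1Path.intervalIntegrable (hγ : IsC1Path U γ γ' a b) (hψ : ContinuousOn ψ U)
    (hg : ContinuousOn g U) (X : ℝ) :
    IntervalIntegrable (fun τ => g (γ τ) * Complex.exp (X * ψ (γ τ)) * γ' τ)
      MeasureTheory.volume a b :=
  ContinuousOn.intervalIntegrable_of_Icc hγ.le (hγ.continuousOn_integrand hψ hg X)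

theorem laplaceIntegral_congr (hγ : IsC1Path U γ γ' a b) (hgh : Set.EqOn g h U) (X : ℝ) :
    laplaceIntegral γ γ' a b ψ g X = laplaceIntegral γ γ' a b ψ h X := by
  refine intervalIntegral.integral_congr fun τ hτ => ?_
  rw [Set.uIcc_of_le hγ.le] at hτ
  simp only [hgh (hγ.mem τ hτ)]

theorem laplaceIntegral_add (hγ : IsC1Path U γ γ' a b) (hψ : ContinuousOn ψ U)
    (hg : ContinuousOn g U) (hh : ContinuousOn h U) (X : ℝ) :
    laplaceIntegral γ γ' a b ψ (fun z => g z + h z) X =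
      laplaceIntegral γ γ' a b ψ g X + laplaceIntegral γ γ' a b ψ h X := by
  rw [laplaceIntegral, laplaceIntegral, laplaceIntegral, ← intervalIntegral.integral_add
    (hγ.intervalIntegrable hψ hg X) (hγ.intervalIntegrable hψ hh X)]
  simp only [add_mul]

theorem laplaceIntegral_const_mul (c : ℂ) (X : ℝ) :
    laplaceIntegral γ γ' a b ψ (fun z => c * g z) X = c * laplaceIntegral γ γ' a b ψ g X := by
  rw [laplaceIntegral, laplaceIntegral, ← intervalIntegral.integral_const_mul]
  simp only [mul_assoc]

/-- Integration by parts: the integral of `d(h e^{X ψ})` is the boundary term. -/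
theorem laplaceIntegral_deriv (hU : IsOpen U) (hγ : IsC1Path U γ γ' a b)
    (hψ : DifferentiableOn ℂ ψ U) (hh : DifferentiableOn ℂ h U) (X : ℝ) :
    laplaceIntegral γ γ' a b ψ (deriv h) X +
        X * laplaceIntegral γ γ' a b ψ (fun z => deriv ψ z * h z) X =
      h (γ b) * Complex.exp (X * ψ (γ b)) - h (γ a) * Complex.exp (X * ψ (γ a)) := by
  have hh' : ContinuousOn (deriv h) U := (hh.deriv hU).continuousOn
  have hψ' : ContinuousOn (deriv ψ) U := (hψ.deriv hU).continuousOn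
  have hp : ContinuousOn (fun z => (X : ℂ) * (deriv ψ z * h z)) U :=
    continuousOn_const.mul (hψ'.mul hh.continuousOn)
  rw [← laplaceIntegral_const_mul, ← laplaceIntegral_add hγ hψ.continuousOn hh' hp]
  refine intervalIntegral.integral_eq_sub_of_hasDerivAt_of_le hγ.le
    (f := fun τ => h (γ τ) * Complex.exp (X * ψ (γ τ))) ?_ (fun τ hτ => ?_)
    (hγ.intervalIntegrable hψ.continuousOn (hh'.add hp) X)
  · exact (hh.continuousOn.comp hγ.continuousOn hγ.mem).mul
      (Complex.continuous_exp.comp_continuousOn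
        (continuousOn_const.mul (hψ.continuousOn.comp hγ.continuousOn hγ.mem)))
  · have hmem := hU.mem_nhds (hγ.mem τ (Set.Ioo_subset_Icc_self hτ))
    have d1 := ((hh.differentiableAt hmem).hasDerivAt).comp τ (hγ.hasDerivAt τ hτ)
    have d2 := ((hψ.differentiableAt hmem).hasDerivAt).comp τ (hγ.hasDerivAt τ hτ)
    refine (d1.mul (d2.const_mul (X : ℂ)).cexp).congr_deriv ?_
    simp only [Function.comp_apply]
    ring

theorem laplaceIntegral_isBigO (hγ : IsC1Path U γ γ' a b)
    (hg : ContinuousOn g U) {m : ℝ} (hm : ∀ τ ∈ Set.Icc a b, (ψ (γ τ)).re ≤ -m) :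
    laplaceIntegral γ γ' a b ψ g =O[atTop] fun X => Real.exp (-m * X) := by
  have hc : ContinuousOn (fun τ => g (γ τ) * γ' τ) (Set.Icc a b) :=
    (hg.comp hγ.continuousOn hγ.mem).mul hγ.continuousOn_deriv
  obtain ⟨C, hC⟩ := isCompact_Icc.exists_bound_of_continuousOn hc
  refine isBigO_iff.2 ⟨C * |b - a|, ?_⟩
  filter_upwards [eventually_ge_atTop 0] with X hX
  have hb : ∀ τ ∈ Set.uIoc a b,
      ‖g (γ τ) * Complex.exp (X * ψ (γ τ)) * γ' τ‖ ≤ C * Real.exp (-m * X) := by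
    intro τ hτ
    rw [Set.uIoc_of_le hγ.le] at hτ
    have hτ' := Set.Ioc_subset_Icc_self hτ
    have h1 : g (γ τ) * Complex.exp (X * ψ (γ τ)) * γ' τ =
        g (γ τ) * γ' τ * Complex.exp (X * ψ (γ τ)) := by ring
    rw [h1, norm_mul, Complex.norm_exp, Complex.re_ofReal_mul]
    refine mul_le_mul (hC τ hτ') (Real.exp_le_exp.2 ?_) (Real.exp_nonneg _)
      ((norm_nonneg _).trans (hC τ hτ'))
    have := mul_le_mul_of_nonneg_left (hm τ hτ') hX
    linarith
  refine (intervalIntegral.norm_integral_le_of_norm_le_const hb).trans (le_of_eq ?_)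
  rw [Real.norm_of_nonneg (Real.exp_nonneg _)]
  ring

/-- Differentiation under the integral sign. -/
theorem hasDerivAt_laplaceIntegral (hγ : IsC1Path U γ γ' a b) (hψ : ContinuousOn ψ U)
    (hg : ContinuousOn g U) (X : ℝ) :
    HasDerivAt (laplaceIntegral γ γ' a b ψ g)
      (laplaceIntegral γ γ' a b ψ (fun z => ψ z * g z) X) X := by
  have hψγ : ContinuousOn (fun τ => ψ (γ τ)) (Set.Icc a b) := hψ.comp hγ.continuousOn hγ.mem
  have hc : ContinuousOn (fun τ => ψ (γ τ) * g (γ τ) * γ' τ) (Set.Icc a b) :=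
    (hψγ.mul (hg.comp hγ.continuousOn hγ.mem)).mul hγ.continuousOn_deriv
  obtain ⟨C, hC⟩ := isCompact_Icc.exists_bound_of_continuousOn hc
  obtain ⟨D, hD⟩ := isCompact_Icc.exists_bound_of_continuousOn hψγ
  have hmeas : ∀ (f : ℂ → ℂ), ContinuousOn f U → ∀ Y : ℝ, MeasureTheory.AEStronglyMeasurable
      (fun τ => f (γ τ) * Complex.exp (Y * ψ (γ τ)) * γ' τ)
      (MeasureTheory.volume.restrict (Set.uIoc a b)) := by
    intro f hf Y
    rw [Set.uIoc_of_le hγ.le]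
    exact ((hγ.continuousOn_integrand hψ hf Y).mono Set.Ioc_subset_Icc_self).aestronglyMeasurable
      measurableSet_Ioc
  refine (intervalIntegral.hasDerivAt_integral_of_dominated_loc_of_deriv_le
    (F := fun (X : ℝ) τ => g (γ τ) * Complex.exp (X * ψ (γ τ)) * γ' τ)
    (F' := fun (X : ℝ) τ => ψ (γ τ) * g (γ τ) * Complex.exp (X * ψ (γ τ)) * γ' τ)
    (bound := fun _ => C * Real.exp ((|X| + 1) * D)) (s := Metric.ball X 1)
    (Metric.ball_mem_nhds X one_pos) (Eventually.of_forall fun Y => hmeas g hg Y)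
    (hγ.intervalIntegrable hψ hg X) (hmeas (fun z => ψ z * g z) (hψ.mul hg) X)
    (Eventually.of_forall fun τ hτ Y hY => ?_) intervalIntegrable_const
    (Eventually.of_forall fun τ hτ Y hY => ?_)).2
  · rw [Set.uIoc_of_le hγ.le] at hτ
    have hτ' := Set.Ioc_subset_Icc_self hτ
    have h1 : ψ (γ τ) * g (γ τ) * Complex.exp (Y * ψ (γ τ)) * γ' τ =
        ψ (γ τ) * g (γ τ) * γ' τ * Complex.exp (Y * ψ (γ τ)) := by ring
    rw [h1, norm_mul, Complex.norm_exp]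
    refine mul_le_mul (hC τ hτ') (Real.exp_le_exp.2 ?_) (Real.exp_nonneg _)
      ((norm_nonneg _).trans (hC τ hτ'))
    refine (Complex.re_le_norm _).trans ?_
    rw [norm_mul, Complex.norm_real]
    refine mul_le_mul ?_ (hD τ hτ') (norm_nonneg _) (by positivity)
    rw [Metric.mem_ball, Real.dist_eq] at hY
    have := abs_sub_abs_le_abs_sub Y X
    rw [Real.norm_eq_abs]
    linarith
  · have d1 : HasDerivAt (fun Y : ℝ => (Y : ℂ) * ψ (γ τ)) (1 * ψ (γ τ)) Y :=
      (Complex.ofRealCLM.hasDerivAt (x := Y)).mul_const _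
    refine ((d1.cexp.const_mul (g (γ τ))).mul_const (γ' τ)).congr_deriv ?_
    ring

end Path

/-! ### The Gaussian integral on a ray -/

/-- `z ∫_0^1 e^{-X z² s²} ds` is half of the Gaussian integral up to an exponentially small tail. -/
theorem hasExpansion_gaussian_ray {z : ℂ} (hz : 0 < z.re) (hz2 : 0 < (z ^ 2).re) :
    HasExpansion (fun X => ∫ s in (0 : ℝ)..1, z * Complex.exp (-(X * z ^ 2) * (s : ℂ) ^ 2))
      (fun k => if k = 0 then ((√Real.pi / 2 : ℝ) : ℂ) else 0) := by
  have hz0 : z ≠ 0 := by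
    rintro rfl
    simp at hz
  set r := (z ^ 2).re with hr
  have hmain : ∀ X : ℝ, 0 < X →
      ∫ s in Set.Ioi (0 : ℝ), z * Complex.exp (-(X * z ^ 2) * (s : ℂ) ^ 2) =
      ((√Real.pi / 2 : ℝ) : ℂ) * ((X ^ (-(1 / 2) : ℝ) : ℝ) : ℂ) := by
    intro X hX
    have hre : 0 < (X * z ^ 2).re := by
      rw [Complex.re_ofReal_mul]
      exact mul_pos hX hz2
    rw [MeasureTheory.integral_const_mul, integral_gaussian_complex_Ioi hre]
    have h1 : (Real.pi : ℂ) / (X * z ^ 2) =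
        (((√Real.pi * X ^ (-(1 / 2) : ℝ) : ℝ) : ℂ) / z) ^ 2 := by
      rw [div_pow, ← Complex.ofReal_pow, mul_pow, Real.sq_sqrt Real.pi_pos.le,
        ← Real.rpow_natCast (X ^ _), ← Real.rpow_mul hX.le]
      norm_num
      rw [Real.rpow_neg_one, Complex.ofReal_inv]
      have : (X : ℂ) ≠ 0 := by exact_mod_cast hX.ne'
      field_simp
    have h2 : 0 < (((√Real.pi * X ^ (-(1 / 2) : ℝ) : ℝ) : ℂ) / z).re := by
      rw [Complex.div_re, Complex.ofReal_re, Complex.ofReal_im, zero_mul, zero_div, add_zero]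
      have := Complex.normSq_pos.2 hz0
      have := Real.rpow_pos_of_pos hX (-(1 / 2))
      have := Real.sqrt_pos.2 Real.pi_pos
      positivity
    rw [h1, one_div (2 : ℂ), Complex.sq_cpow_two_inv h2]
    push_cast
    field_simp
  have hint : ∀ X : ℝ, 0 < X → MeasureTheory.IntegrableOn
      (fun s : ℝ => z * Complex.exp (-(X * z ^ 2) * (s : ℂ) ^ 2)) (Set.Ioi 0) := by
    intro X hX
    have hre : 0 < (X * z ^ 2).re := by
      rw [Complex.re_ofReal_mul]
      exact mul_pos hX hz2
    exact ((integrable_cexp_neg_mul_sq hre).const_mul z).integrableOn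
  have htail : ∀ X : ℝ, 0 < X →
      ‖∫ s in Set.Ioi (1 : ℝ), z * Complex.exp (-(X * z ^ 2) * (s : ℂ) ^ 2)‖ ≤
        ‖z‖ * (Real.exp (-(X * r)) / (X * r)) := by
    intro X hX
    have hXr : 0 < X * r := mul_pos hX hz2
    have hle := integral_exp_mul_Ioi (a := -(X * r)) (by linarith) 1
    have h3 : ∫ s in Set.Ioi (1 : ℝ), ‖z‖ * Real.exp (-(X * r) * s) =
        ‖z‖ * (Real.exp (-(X * r)) / (X * r)) := by
      rw [MeasureTheory.integral_const_mul, hle, mul_one]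
      congr 1
      rw [neg_div_neg_eq]
    rw [← h3]
    refine MeasureTheory.norm_integral_le_of_norm_le
      ((integrableOn_exp_mul_Ioi (by linarith) 1).const_mul _) ?_
    refine (MeasureTheory.ae_restrict_iff' measurableSet_Ioi).2
      (Eventually.of_forall fun s hs => ?_)
    have hs1 : (1 : ℝ) < s := hs
    rw [norm_mul, Complex.norm_exp]
    refine mul_le_mul_of_nonneg_left (Real.exp_le_exp.2 ?_) (norm_nonneg z)
    rw [← Complex.ofReal_pow, Complex.re_mul_ofReal, Complex.neg_re, Complex.re_ofReal_mul, ← hr]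
    have hs2 : s ≤ s ^ 2 := by nlinarith
    have := mul_le_mul_of_nonneg_left hs2 hXr.le
    linarith
  have hsplit : ∀ X : ℝ, 0 < X →
      ∫ s in (0 : ℝ)..1, z * Complex.exp (-(X * z ^ 2) * (s : ℂ) ^ 2) =
        ((√Real.pi / 2 : ℝ) : ℂ) * ((X ^ (-(1 / 2) : ℝ) : ℝ) : ℂ) -
          ∫ s in Set.Ioi (1 : ℝ), z * Complex.exp (-(X * z ^ 2) * (s : ℂ) ^ 2) := by
    intro X hX
    rw [← hmain X hX, ← intervalIntegral.integral_Ioi_sub_Ioi (hint X hX) zero_le_one]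
  have hneg : HasExpansion
      (fun X : ℝ => ∫ s in Set.Ioi (1 : ℝ), z * Complex.exp (-(X * z ^ 2) * (s : ℂ) ^ 2)) 0 := by
    refine HasExpansion.zero_of_isBigO_exp hz2 (isBigO_iff.2 ⟨‖z‖ / r, ?_⟩)
    filter_upwards [eventually_ge_atTop 1] with X hX
    refine (htail X (by linarith)).trans ?_
    have hX1 : r ≤ X * r := le_mul_of_one_le_left hz2.le hX
    rw [Real.norm_of_nonneg (Real.exp_nonneg _), div_mul_eq_mul_div, ← mul_div_assoc,
      show -(X * r) = -r * X by ring]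
    exact div_le_div_of_nonneg_left (by positivity) hz2 hX1
  have hlead : HasExpansion (fun X : ℝ => ((√Real.pi / 2 : ℝ) : ℂ) * ((X ^ (-(1 / 2) : ℝ) : ℝ) : ℂ))
      (fun k => if k = 0 then ((√Real.pi / 2 : ℝ) : ℂ) else 0) := by
    intro K
    cases K with
    | zero =>
      simp only [Finset.range_zero, Finset.sum_empty, sub_zero, Nat.cast_zero, neg_zero, zero_sub]
      refine IsBigO.const_mul_left ?_ _
      exact isBigO_of_le _ fun X => by rw [Complex.norm_real]
    | succ K =>
      refine (isBigO_zero _ _).congr_left fun X => ?_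
      rw [Finset.sum_range_succ', Finset.sum_eq_zero fun k _ => by
        simp only [if_neg (Nat.succ_ne_zero k), zero_mul]]
      simp
  have := (hlead.sub hneg).congr' ((eventually_gt_atTop 0).mono fun X hX => (hsplit X hX).symm)
  simpa using this

/-! ### The saddle point -/

/-- A local coordinate `w = (z - z₀) v(z)` at a nondegenerate critical point `z₀`, in which the
phase is `ψ = -w²`. -/
structure IsMorseCoordinate (V : Set ℂ) (z₀ : ℂ) (ψ v : ℂ → ℂ) : Prop where
  isOpen : IsOpen V
  mem : z₀ ∈ V
  differentiableOn : DifferentiableOn ℂ v V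
  ne_zero : ∀ z ∈ V, v z ≠ 0
  deriv_ne_zero : ∀ z ∈ V, deriv (fun z => (z - z₀) * v z) z ≠ 0
  eq_neg_sq : ∀ z ∈ V, ψ z = -((z - z₀) * v z) ^ 2

/-- The coordinate `w = κ (z - z₀) √(χ(z) / χ(z₀))`, where `ψ = (z - z₀)² χ` and
`κ² = -χ(z₀) = -ψ''(z₀)/2`. -/
theorem exists_isMorseCoordinate {U : Set ℂ} (hU : IsOpen U) {z₀ : ℂ} (hz₀ : z₀ ∈ U) {ψ : ℂ → ℂ}
    (hψ : DifferentiableOn ℂ ψ U) (h0 : ψ z₀ = 0) (h1 : deriv ψ z₀ = 0) {κ : ℂ} (hκ : κ ≠ 0)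
    (h2 : HasDerivAt (deriv ψ) (-2 * κ ^ 2) z₀) :
    ∃ V ⊆ U, ∃ v : ℂ → ℂ, IsMorseCoordinate V z₀ ψ v ∧ v z₀ = κ := by
  have hnhds := hU.mem_nhds hz₀
  set χ := dslope (dslope ψ z₀) z₀ with hχ
  have hd1 : DifferentiableOn ℂ (dslope ψ z₀) U :=
    (Complex.differentiableOn_dslope hnhds).2 hψ
  have hdχ : DifferentiableOn ℂ χ U := (Complex.differentiableOn_dslope hnhds).2 hd1
  have hψχ : ∀ z, ψ z = (z - z₀) ^ 2 * χ z := by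
    intro z
    have e1 := sub_smul_dslope ψ z₀ z
    have e2 := sub_smul_dslope (dslope ψ z₀) z₀ z
    rw [dslope_same, h1, sub_zero, smul_eq_mul] at e2
    rw [h0, sub_zero, smul_eq_mul, ← e2] at e1
    rw [← e1, hχ]
    ring
  have hχ0 : χ z₀ = -κ ^ 2 := by
    have hev : deriv ψ =ᶠ[𝓝 z₀]
        fun z => 2 * (z - z₀) * χ z + (z - z₀) ^ 2 * deriv χ z := by
      filter_upwards [hnhds] with z hz
      have hχz := (hdχ.differentiableAt (hU.mem_nhds hz)).hasDerivAt
      have : HasDerivAt (fun z => (z - z₀) ^ 2 * χ z)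
          (2 * (z - z₀) * χ z + (z - z₀) ^ 2 * deriv χ z) z := by
        refine ((((hasDerivAt_id z).sub_const z₀).pow 2).mul hχz).congr_deriv ?_
        simp
      rw [funext hψχ]
      exact this.deriv
    have hχz := (hdχ.differentiableAt hnhds).hasDerivAt
    have hχz' := ((hdχ.deriv hU).differentiableAt hnhds).hasDerivAt
    have hder : HasDerivAt (fun z => 2 * (z - z₀) * χ z + (z - z₀) ^ 2 * deriv χ z)
        (2 * χ z₀) z₀ := by
      refine (((((hasDerivAt_id z₀).sub_const z₀).const_mul 2).mul hχz).add
        ((((hasDerivAt_id z₀).sub_const z₀).pow 2).mul hχz')).congr_deriv ?_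
      simp
    have := (hder.congr_of_eventuallyEq hev).unique h2
    linear_combination this / 2
  have hχne : χ z₀ ≠ 0 := by
    rw [hχ0]
    exact neg_ne_zero.2 (pow_ne_zero 2 hκ)
  let v : ℂ → ℂ := fun z => κ * (χ z / χ z₀) ^ (2⁻¹ : ℂ)
  have hv0 : v z₀ = κ := by simp [v, div_self hχne]
  have hcont : ContinuousAt (fun z => χ z / χ z₀) z₀ :=
    (hdχ.differentiableAt hnhds).continuousAt.div_const _
  have hslit : ∀ᶠ z in 𝓝 z₀, χ z / χ z₀ ∈ Complex.slitPlane := by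
    refine hcont.eventually_mem (Complex.isOpen_slitPlane.mem_nhds ?_)
    simp [div_self hχne]
  obtain ⟨V₁, hV₁, hV₁o, hzV₁⟩ := eventually_nhds_iff.1 (hslit.and (eventually_mem_set.2 hnhds))
  have hvd : DifferentiableOn ℂ v V₁ := by
    intro z hz
    have hd : DifferentiableAt ℂ (fun z => χ z / χ z₀) z :=
      (hdχ.differentiableAt (hU.mem_nhds (hV₁ z hz).2)).div_const _
    exact ((hd.cpow_const (hV₁ z hz).1).const_mul κ).differentiableWithinAt
  have hw : DifferentiableOn ℂ (fun z => (z - z₀) * v z) V₁ :=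
    (differentiableOn_id.sub_const z₀).mul hvd
  have hw0 : deriv (fun z => (z - z₀) * v z) z₀ = κ := by
    have hvz := (hvd.differentiableAt (hV₁o.mem_nhds hzV₁)).hasDerivAt
    have := ((hasDerivAt_id z₀).sub_const z₀).mul hvz
    rw [show (fun z => (z - z₀) * v z) = ((fun x => id x - z₀) * v) from rfl, this.deriv]
    simp [hv0]
  have hwne : ∀ᶠ z in 𝓝 z₀, deriv (fun z => (z - z₀) * v z) z ≠ 0 := by
    refine ((hw.deriv hV₁o).differentiableAt (hV₁o.mem_nhds hzV₁)).continuousAt.eventually_ne ?_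
    rw [hw0]
    exact hκ
  obtain ⟨V, hV, hVo, hzV⟩ := eventually_nhds_iff.1 (hwne.and (hV₁o.eventually_mem hzV₁))
  refine ⟨V, fun z hz => (hV₁ z (hV z hz).2).2, v, ⟨hVo, hzV, ?_, fun z hz => ?_,
    fun z hz => (hV z hz).1, fun z hz => ?_⟩, hv0⟩
  · exact hvd.mono fun z hz => (hV z hz).2
  · refine mul_ne_zero hκ fun h => ?_
    have := (Complex.cpow_eq_zero_iff _ _).1 h
    exact Complex.slitPlane_ne_zero (hV₁ z (hV z hz).2).1 this.1
  · have : v z ^ 2 = κ ^ 2 * (χ z / χ z₀) := by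
      simp only [v]
      rw [mul_pow, ← Complex.cpow_nat_mul]
      simp
    rw [mul_pow, this, hψχ, hχ0]
    field_simp

namespace IsMorseCoordinate

variable {V : Set ℂ} {z₀ : ℂ} {ψ v : ℂ → ℂ} {γ γ' : ℝ → ℂ} {a b : ℝ}

/-- The factor `h` in the decomposition `g = c w' + ψ' h` of a holomorphic function `g`. -/
def cofactor (z₀ : ℂ) (v g : ℂ → ℂ) (z : ℂ) : ℂ :=
  dslope (fun z => g z - g z₀ / deriv (fun z => (z - z₀) * v z) z₀ *
    deriv (fun z => (z - z₀) * v z) z) z₀ z / (-2 * v z * deriv (fun z => (z - z₀) * v z) z)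

theorem differentiableOn_coord (hv : IsMorseCoordinate V z₀ ψ v) :
    DifferentiableOn ℂ (fun z => (z - z₀) * v z) V :=
  (differentiableOn_id.sub_const z₀).mul hv.differentiableOn

theorem differentiableOn_phase (hv : IsMorseCoordinate V z₀ ψ v) : DifferentiableOn ℂ ψ V :=
  ((hv.differentiableOn_coord.pow 2).neg).congr hv.eq_neg_sq

theorem differentiableOn_cofactor (hv : IsMorseCoordinate V z₀ ψ v) {g : ℂ → ℂ}
    (hg : DifferentiableOn ℂ g V) : DifferentiableOn ℂ (cofactor z₀ v g) V := by
  have hw := hv.differentiableOn_coord.deriv hv.isOpen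
  refine DifferentiableOn.div ?_ ((hv.differentiableOn.const_mul _).mul hw) fun z hz => ?_
  · refine (Complex.differentiableOn_dslope (hv.isOpen.mem_nhds hv.mem)).2 ?_
    exact hg.sub (hw.const_mul _)
  · exact mul_ne_zero (mul_ne_zero (by norm_num) (hv.ne_zero z hz)) (hv.deriv_ne_zero z hz)

theorem deriv_mul_cofactor (hv : IsMorseCoordinate V z₀ ψ v) (g : ℂ → ℂ) {z : ℂ} (hz : z ∈ V) :
    g z = g z₀ / deriv (fun z => (z - z₀) * v z) z₀ * deriv (fun z => (z - z₀) * v z) z +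
      deriv ψ z * cofactor z₀ v g z := by
  have hmem := hv.isOpen.mem_nhds hz
  have hψ : deriv ψ z = -2 * ((z - z₀) * v z) * deriv (fun z => (z - z₀) * v z) z := by
    have hev : ψ =ᶠ[𝓝 z] fun z => -((z - z₀) * v z) ^ 2 := by
      filter_upwards [hmem] with y hy
      exact hv.eq_neg_sq y hy
    have hw := (hv.differentiableOn_coord.differentiableAt hmem).hasDerivAt
    rw [hev.deriv_eq]
    refine ((hw.pow 2).neg.congr_deriv ?_).deriv
    push_cast
    ring
  have h1 := sub_smul_dslope (fun z => g z - g z₀ / deriv (fun z => (z - z₀) * v z) z₀ *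
    deriv (fun z => (z - z₀) * v z) z) z₀ z
  have hw0 := hv.deriv_ne_zero z₀ hv.mem
  rw [div_mul_cancel₀ _ hw0, sub_self, sub_zero, smul_eq_mul] at h1
  rw [hψ, cofactor]
  have hvz := hv.ne_zero z hz
  have hwz := hv.deriv_ne_zero z hz
  generalize dslope (fun z => g z - g z₀ / deriv (fun z => (z - z₀) * v z) z₀ *
    deriv (fun z => (z - z₀) * v z) z) z₀ z = D at h1 ⊢
  have h2 : -2 * ((z - z₀) * v z) * deriv (fun z => (z - z₀) * v z) z *
      (D / (-2 * v z * deriv (fun z => (z - z₀) * v z) z)) = (z - z₀) * D := by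
    field_simp
  rw [h2, h1]
  ring

/-- The integral of `w' e^{X ψ}` between two points on opposite sides of the saddle point is the
Gaussian integral up to exponentially small terms. -/
theorem hasExpansion_laplaceIntegral_deriv (hv : IsMorseCoordinate V z₀ ψ v)
    (hγ : IsC1Path V γ γ' a b) (ha : ((γ a - z₀) * v (γ a)).re < 0)
    (hb : 0 < ((γ b - z₀) * v (γ b)).re) (hψa : (ψ (γ a)).re < 0) (hψb : (ψ (γ b)).re < 0) :
    HasExpansion (laplaceIntegral γ γ' a b ψ (deriv fun z => (z - z₀) * v z))
      (fun k => if k = 0 then ((√Real.pi : ℝ) : ℂ) else 0) := by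
  set w : ℂ → ℂ := fun z => (z - z₀) * v z with hw
  have hwd : DifferentiableOn ℂ w V := hv.differentiableOn_coord
  have hamem : γ a ∈ V := hγ.mem a (Set.left_mem_Icc.2 hγ.le)
  have hbmem : γ b ∈ V := hγ.mem b (Set.right_mem_Icc.2 hγ.le)
  have hwa2 : 0 < ((-w (γ a)) ^ 2).re := by
    have := hv.eq_neg_sq _ hamem
    rw [this, Complex.neg_re] at hψa
    rw [neg_sq]
    exact neg_lt_zero.1 hψa
  have hwb2 : 0 < (w (γ b) ^ 2).re := by
    have := hv.eq_neg_sq _ hbmem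
    rw [this, Complex.neg_re] at hψb
    exact neg_lt_zero.1 hψb
  have hwa : 0 < (-w (γ a)).re := by
    rw [Complex.neg_re]
    exact neg_pos.2 ha
  -- in the coordinate `w` the integrand is exact, so that the path may be replaced by two rays
  have hX : ∀ X : ℝ, laplaceIntegral γ γ' a b ψ (deriv w) X =
      (∫ s in (0 : ℝ)..1, w (γ b) * Complex.exp (-(X * w (γ b) ^ 2) * (s : ℂ) ^ 2)) +
        ∫ s in (0 : ℝ)..1, (-w (γ a)) * Complex.exp (-(X * (-w (γ a)) ^ 2) * (s : ℂ) ^ 2) := by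
    intro X
    obtain ⟨E, hE⟩ : Complex.IsExactOn (fun ζ => Complex.exp (-(X * ζ ^ 2))) Set.univ :=
      Differentiable.isExactOn_univ (by fun_prop)
    have hray : ∀ ζ : ℂ, ∫ s in (0 : ℝ)..1, ζ * Complex.exp (-(X * ζ ^ 2) * (s : ℂ) ^ 2) =
        E ζ - E 0 := by
      intro ζ
      have h1 : ∀ s ∈ Set.uIcc (0 : ℝ) 1, HasDerivAt (fun s : ℝ => E (s * ζ))
          (ζ * Complex.exp (-(X * ζ ^ 2) * (s : ℂ) ^ 2)) s := by
        intro s _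
        have d1 : HasDerivAt (fun s : ℝ => (s : ℂ) * ζ) (1 * ζ) s :=
          (Complex.ofRealCLM.hasDerivAt (x := s)).mul_const _
        refine ((hE _ (Set.mem_univ (s * ζ))).comp s d1).congr_deriv ?_
        rw [one_mul, mul_comm ζ]
        ring_nf
      rw [intervalIntegral.integral_eq_sub_of_hasDerivAt h1
        (Continuous.intervalIntegrable (by fun_prop) _ _)]
      simp
    have hpath : laplaceIntegral γ γ' a b ψ (deriv w) X = E (w (γ b)) - E (w (γ a)) := by
      refine intervalIntegral.integral_eq_sub_of_hasDerivAt_of_le hγ.le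
        (f := fun τ => E (w (γ τ))) ?_ (fun τ hτ => ?_)
        (hγ.intervalIntegrable hv.differentiableOn_phase.continuousOn
          (hwd.deriv hv.isOpen).continuousOn X)
      · have hEc : Continuous E := continuous_iff_continuousAt.2 fun ζ =>
          (hE ζ (Set.mem_univ ζ)).continuousAt
        exact hEc.comp_continuousOn (hwd.continuousOn.comp hγ.continuousOn hγ.mem)
      · have hm := hγ.mem τ (Set.Ioo_subset_Icc_self hτ)
        have d1 := ((hwd.differentiableAt (hv.isOpen.mem_nhds hm)).hasDerivAt).comp τ
          (hγ.hasDerivAt τ hτ)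
        refine ((hE _ (Set.mem_univ (w (γ τ)))).comp τ d1).congr_deriv ?_
        rw [hv.eq_neg_sq _ hm]
        simp only [hw]
        ring_nf
    have hodd : ∫ s in (0 : ℝ)..1, (-w (γ a)) * Complex.exp (-(X * (-w (γ a)) ^ 2) * (s : ℂ) ^ 2) =
        -∫ s in (0 : ℝ)..1, w (γ a) * Complex.exp (-(X * w (γ a) ^ 2) * (s : ℂ) ^ 2) := by
      rw [← intervalIntegral.integral_neg]
      simp only [neg_sq, neg_mul]
    rw [hodd, hray, hray, hpath]
    ring
  have h := (hasExpansion_gaussian_ray hb hwb2).add (hasExpansion_gaussian_ray hwa hwa2)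
  have h' : HasExpansion (laplaceIntegral γ γ' a b ψ (deriv w)) _ :=
    h.congr' (Eventually.of_forall fun X => (hX X).symm)
  convert h' using 2 with k
  split_ifs
  · push_cast
    ring
  · ring

/-- Watson's expansion: the decomposition `g = c w' + ψ' h` and an integration by parts replace `g`
by `-X⁻¹ h'`, and this is iterated. -/
theorem exists_hasExpansion (hv : IsMorseCoordinate V z₀ ψ v)
    (hγ : IsC1Path V γ γ' a b) (hle : ∀ τ ∈ Set.Icc a b, (ψ (γ τ)).re ≤ 0)
    (ha : ((γ a - z₀) * v (γ a)).re < 0)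
    (hb : 0 < ((γ b - z₀) * v (γ b)).re) (hψa : (ψ (γ a)).re < 0) (hψb : (ψ (γ b)).re < 0)
    {g : ℂ → ℂ} (hg : DifferentiableOn ℂ g V) :
    ∃ c, HasExpansion (laplaceIntegral γ γ' a b ψ g) c ∧
      c 0 = g z₀ / deriv (fun z => (z - z₀) * v z) z₀ * (√Real.pi : ℝ) := by
  set w : ℂ → ℂ := fun z => (z - z₀) * v z with hw
  -- one step of the iteration replaces `g` by `S g`, with the boundary terms `R g`
  let S : (ℂ → ℂ) → ℂ → ℂ := fun g z => -deriv (cofactor z₀ v g) z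
  have hS : ∀ g, DifferentiableOn ℂ g V → DifferentiableOn ℂ (S g) V := fun g hg =>
    ((hv.differentiableOn_cofactor hg).deriv hv.isOpen).neg
  have hψ := hv.differentiableOn_phase
  have hwd : DifferentiableOn ℂ w V := hv.differentiableOn_coord
  let R : (ℂ → ℂ) → ℝ → ℂ := fun g X =>
    cofactor z₀ v g (γ b) * Complex.exp (X * ψ (γ b)) -
      cofactor z₀ v g (γ a) * Complex.exp (X * ψ (γ a))
  have hR : ∀ g, HasExpansion (R g) 0 := by
    intro g
    have : HasExpansion (R g) (fun k => (0 : ℕ → ℂ) k - (0 : ℕ → ℂ) k) :=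
      (HasExpansion.const_mul_exp _ hψb).sub (HasExpansion.const_mul_exp _ hψa)
    convert this using 1
    funext k
    simp
  have hstep : ∀ g, DifferentiableOn ℂ g V → ∀ X : ℝ, 0 < X →
      laplaceIntegral γ γ' a b ψ g X =
        g z₀ / deriv w z₀ * laplaceIntegral γ γ' a b ψ (deriv w) X +
          (X : ℂ)⁻¹ * (laplaceIntegral γ γ' a b ψ (S g) X + R g X) := by
    intro g hg X hX
    have hcof := hv.differentiableOn_cofactor hg
    have ibp := laplaceIntegral_deriv hv.isOpen hγ hψ hcof X
    have hSg : laplaceIntegral γ γ' a b ψ (S g) X =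
        -laplaceIntegral γ γ' a b ψ (deriv (cofactor z₀ v g)) X := by
      have := laplaceIntegral_const_mul (γ := γ) (γ' := γ') (a := a) (b := b) (ψ := ψ)
        (g := deriv (cofactor z₀ v g)) (-1) X
      simpa [S] using this
    have hsum : laplaceIntegral γ γ' a b ψ g X =
        g z₀ / deriv w z₀ * laplaceIntegral γ γ' a b ψ (deriv w) X +
          laplaceIntegral γ γ' a b ψ (fun z => deriv ψ z * cofactor z₀ v g z) X := by
      rw [← laplaceIntegral_const_mul]
      refine Eq.trans ?_ (laplaceIntegral_add hγ hψ.continuousOn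
        (g := fun z => g z₀ / deriv w z₀ * deriv w z)
        (h := fun z => deriv ψ z * cofactor z₀ v g z)
        (continuousOn_const.mul (hwd.deriv hv.isOpen).continuousOn)
        ((hψ.deriv hv.isOpen).continuousOn.mul hcof.continuousOn) X)
      exact laplaceIntegral_congr hγ (fun z hz => hv.deriv_mul_cofactor g hz) X
    have hX' : (X : ℂ) ≠ 0 := by exact_mod_cast hX.ne'
    have hRX : R g X = laplaceIntegral γ γ' a b ψ (deriv (cofactor z₀ v g)) X +
      X * laplaceIntegral γ γ' a b ψ (fun z => deriv ψ z * cofactor z₀ v g z) X := ibp.symm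
    rw [hsum, hSg, hRX, neg_add_cancel_left, inv_mul_cancel_left₀ hX']
  have hlead := hv.hasExpansion_laplaceIntegral_deriv hγ ha hb hψa hψb
  let c : (ℂ → ℂ) → ℕ → ℂ := fun g k => (S^[k] g) z₀ / deriv w z₀ * (√Real.pi : ℝ)
  have main : ∀ K : ℕ, ∀ g, DifferentiableOn ℂ g V →
      (fun X : ℝ => laplaceIntegral γ γ' a b ψ g X -
        ∑ k ∈ Finset.range K, c g k * ((X ^ (-(k : ℝ) - 1 / 2) : ℝ) : ℂ))
        =O[atTop] fun X : ℝ => X ^ (-(K : ℝ) - 1 / 2) := by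
    have hinv : (fun X : ℝ => (X : ℂ)⁻¹) =O[atTop] fun X : ℝ => X⁻¹ :=
      isBigO_of_le _ fun X => by simp
    intro K
    induction K with
    | zero =>
      intro g hg
      have h1 : laplaceIntegral γ γ' a b ψ (S g) =O[atTop] fun _ => (1 : ℝ) := by
        have := laplaceIntegral_isBigO (m := 0) hγ (hS g hg).continuousOn
          (ψ := ψ) (by simpa using hle)
        simpa using this
      have h2 : R g =O[atTop] fun _ => (1 : ℝ) := by
        have h3 := hR g 0
        simp only [Finset.range_zero, Finset.sum_empty, sub_zero, Nat.cast_zero, neg_zero] at h3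
        refine h3.trans (Tendsto.isBigO_one ℝ (tendsto_rpow_neg_atTop (y := 1 / 2)
          (by norm_num)) |>.congr_left fun X => by norm_num)
      have h4 := hinv.mul (h1.add h2)
      have h5 : (fun X : ℝ => X⁻¹ * 1) =O[atTop] fun X : ℝ => X ^ (-((0 : ℕ) : ℝ) - 1 / 2) := by
        refine IsBigO.of_bound 1 ?_
        filter_upwards [eventually_ge_atTop 1] with X hX
        rw [mul_one, one_mul, Real.norm_of_nonneg (by positivity),
          Real.norm_of_nonneg (by positivity), ← Real.rpow_neg_one]
        exact Real.rpow_le_rpow_of_exponent_le hX (by norm_num)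
      have h6 := ((hlead 0).const_mul_left (g z₀ / deriv w z₀)).add (h4.trans h5)
      refine h6.congr' ?_ EventuallyEq.rfl
      filter_upwards [eventually_gt_atTop 0] with X hX
      simp only [Finset.range_zero, Finset.sum_empty, sub_zero]
      rw [hstep g hg X hX]
    | succ K ih =>
      intro g hg
      have h1 := ih (S g) (hS g hg)
      have h2 : R g =O[atTop] fun X : ℝ => X ^ (-(K : ℝ) - 1 / 2) := by
        simpa using hR g K
      have h3 := hinv.mul (h1.add h2)
      have hpow : ∀ (k : ℕ) (X : ℝ), 0 < X →
          X ^ (-((k + 1 : ℕ) : ℝ) - 1 / 2) = X⁻¹ * X ^ (-(k : ℝ) - 1 / 2) := by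
        intro k X hX
        rw [← Real.rpow_neg_one, ← Real.rpow_add hX]
        congr 1
        push_cast
        ring
      have h4 : (fun X : ℝ => X⁻¹ * X ^ (-(K : ℝ) - 1 / 2)) =ᶠ[atTop]
          fun X : ℝ => X ^ (-((K + 1 : ℕ) : ℝ) - 1 / 2) := by
        filter_upwards [eventually_gt_atTop 0] with X hX
        exact (hpow K X hX).symm
      have h5 := ((hlead (K + 1)).const_mul_left (g z₀ / deriv w z₀)).add
        (h3.congr' EventuallyEq.rfl h4)
      refine h5.congr' ?_ EventuallyEq.rfl
      filter_upwards [eventually_gt_atTop 0] with X hX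
      rw [hstep g hg X hX, Finset.sum_range_succ', Finset.sum_range_succ',
        Finset.sum_eq_zero (s := Finset.range K) fun k _ => by
          simp only [if_neg (Nat.succ_ne_zero k), zero_mul]]
      have hc : ∑ k ∈ Finset.range K, c g (k + 1) * ((X ^ (-((k + 1 : ℕ) : ℝ) - 1 / 2) : ℝ) : ℂ) =
          (X : ℂ)⁻¹ * ∑ k ∈ Finset.range K, c (S g) k * ((X ^ (-(k : ℝ) - 1 / 2) : ℝ) : ℂ) := by
        rw [Finset.mul_sum]
        refine Finset.sum_congr rfl fun k _ => ?_
        rw [hpow k X hX]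
        simp only [c, Function.iterate_succ_apply]
        push_cast
        ring
      rw [hc]
      simp only [c, Function.iterate_zero, id_eq, if_true]
      ring
  exact ⟨c g, fun K => main K g hg, rfl⟩

end IsMorseCoordinate

/-- On a compact path a negative real part is bounded away from zero. -/
theorem exists_neg_bound {U : Set ℂ} {γ γ' : ℝ → ℂ} {a b : ℝ} {ψ : ℂ → ℂ}
    (hγ : IsC1Path U γ γ' a b) (hψ : ContinuousOn ψ U)
    (hneg : ∀ τ ∈ Set.Icc a b, (ψ (γ τ)).re < 0) :
    ∃ m > 0, ∀ τ ∈ Set.Icc a b, (ψ (γ τ)).re ≤ -m := by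
  have hc : ContinuousOn (fun τ => (ψ (γ τ)).re) (Set.Icc a b) :=
    Complex.continuous_re.comp_continuousOn (hψ.comp hγ.continuousOn hγ.mem)
  obtain ⟨τ₀, hτ₀, hmax⟩ := isCompact_Icc.exists_isMaxOn (Set.nonempty_Icc.2 hγ.le) hc
  exact ⟨-(ψ (γ τ₀)).re, neg_pos.2 (hneg τ₀ hτ₀), fun τ hτ => by
    rw [neg_neg]
    exact hmax hτ⟩

/-- The method of steepest descent: along a path on which a nondegenerate saddle point dominates,
and through which the path passes in a direction of descent, Laplace integrals have full asymptotic
expansions, whose leading coefficients are a common nonzero multiple of `g z₀`. -/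
theorem exists_hasExpansion_of_saddle {U : Set ℂ} (hU : IsOpen U) {γ γ' : ℝ → ℂ} {a b : ℝ}
    (hγ : IsC1Path U γ γ' a b) (ha : a < 0) (hb : 0 < b) {ψ : ℂ → ℂ}
    (hψ : DifferentiableOn ℂ ψ U) (h0 : ψ (γ 0) = 0) (h1 : deriv ψ (γ 0) = 0) {s : ℂ}
    (h2 : HasDerivAt (deriv ψ) (-2 * s) (γ 0)) (hs : 0 < (s * γ' 0 ^ 2).re)
    (hdom : ∀ τ ∈ Set.Icc a b, τ ≠ 0 → (ψ (γ τ)).re < 0) :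
    ∃ C : ℂ, C ≠ 0 ∧ ∀ g : ℂ → ℂ, DifferentiableOn ℂ g U →
      ∃ c, HasExpansion (laplaceIntegral γ γ' a b ψ g) c ∧ c 0 = C * g (γ 0) := by
  have hab0 : (0 : ℝ) ∈ Set.Ioo a b := ⟨ha, hb⟩
  have hz₀ : γ 0 ∈ U := hγ.mem 0 (Set.Ioo_subset_Icc_self hab0)
  -- the square root `κ` of `s` for which the coordinate `w` increases along the path
  obtain ⟨κ, hκs, hκ⟩ : ∃ κ : ℂ, κ ^ 2 = s ∧ 0 < (κ * γ' 0).re := by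
    obtain ⟨κ, hκ⟩ := IsAlgClosed.exists_pow_nat_eq s two_pos
    have hne : (κ * γ' 0).re ≠ 0 := by
      intro h
      rw [← hκ, ← mul_pow, sq, Complex.mul_re, h] at hs
      nlinarith [mul_self_nonneg (κ * γ' 0).im]
    rcases lt_or_gt_of_ne hne with h | h
    · exact ⟨-κ, by rw [neg_sq, hκ], by rw [neg_mul, Complex.neg_re]; linarith⟩
    · exact ⟨κ, hκ, h⟩
  have hκ0 : κ ≠ 0 := by
    rintro rfl
    simp at hκ
  obtain ⟨V, hVU, v, hv, hv0⟩ := exists_isMorseCoordinate hU hz₀ hψ h0 h1 hκ0 (by rwa [hκs])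
  set w : ℂ → ℂ := fun z => (z - γ 0) * v z with hw
  have hw0 : HasDerivAt w κ (γ 0) := by
    have hvz := (hv.differentiableOn.differentiableAt (hv.isOpen.mem_nhds hv.mem)).hasDerivAt
    refine (((hasDerivAt_id (γ 0)).sub_const (γ 0)).mul hvz).congr_deriv ?_
    simp [hv0]
  have hγ0 := hγ.hasDerivAt 0 hab0
  -- near `τ = 0` the real part of `w` has the sign of `τ`
  have hF : HasDerivAt (fun τ => (w (γ τ)).re) (κ * γ' 0).re 0 := by
    have := (hw0.comp (0 : ℝ) hγ0)
    exact (Complex.reCLM.hasFDerivAt.comp_hasDerivAt (0 : ℝ) this)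
  have hslope : ∀ᶠ τ in 𝓝 (0 : ℝ), τ ≠ 0 → 0 < slope (fun τ => (w (γ τ)).re) 0 τ := by
    have := (hasDerivAt_iff_tendsto_slope.1 hF).eventually (lt_mem_nhds hκ)
    rw [eventually_nhdsWithin_iff] at this
    exact this
  have hev : ∀ᶠ τ in 𝓝 (0 : ℝ), (τ ≠ 0 → 0 < slope (fun τ => (w (γ τ)).re) 0 τ) ∧
      τ ∈ Set.Ioo a b ∧ γ τ ∈ V :=
    hslope.and (Filter.Eventually.and (Ioo_mem_nhds ha hb)
      (hγ0.continuousAt.eventually_mem (hv.isOpen.mem_nhds hv.mem)))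
  obtain ⟨r, hr, hball⟩ := Metric.eventually_nhds_iff.1 hev
  set δ := r / 2 with hδ
  have hδ0 : 0 < δ := half_pos hr
  have hin : ∀ τ ∈ Set.Icc (-δ) δ, (τ ≠ 0 → 0 < slope (fun τ => (w (γ τ)).re) 0 τ) ∧
      τ ∈ Set.Ioo a b ∧ γ τ ∈ V := by
    intro τ hτ
    refine hball ?_
    rw [Real.dist_eq, sub_zero]
    exact (abs_le.2 hτ).trans_lt (half_lt_self hr)
  have hδm : δ ∈ Set.Icc (-δ) δ := ⟨by linarith, le_rfl⟩
  have hδm' : -δ ∈ Set.Icc (-δ) δ := ⟨le_rfl, by linarith⟩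
  have hδb := (hin δ hδm).2.1
  have hδa := (hin (-δ) hδm').2.1
  have hwb : 0 < (w (γ δ)).re := by
    have := (hin δ hδm).1 hδ0.ne'
    rw [slope_def_field] at this
    have hz : (w (γ 0)).re = 0 := by simp [hw]
    rw [hz, sub_zero, sub_zero] at this
    exact (div_pos_iff_of_pos_right hδ0).1 this
  have hwa : (w (γ (-δ))).re < 0 := by
    have := (hin (-δ) hδm').1 (neg_ne_zero.2 hδ0.ne')
    rw [slope_def_field] at this
    have hz : (w (γ 0)).re = 0 := by simp [hw]
    rw [hz, sub_zero, sub_zero, div_neg, neg_pos] at this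
    by_contra hcon
    exact absurd (div_nonneg (not_lt.1 hcon) hδ0.le) (not_le.2 this)
  -- outside of `[-δ, δ]` the path contributes exponentially small terms only
  have hγl := hγ.mono (V := U) (a' := a) (b' := -δ) hδa.1.le le_rfl hδa.2.le
    fun τ hτ => hγ.mem τ ⟨hτ.1, hτ.2.trans hδa.2.le⟩
  have hγr := hγ.mono (V := U) (a' := δ) (b' := b) hδb.2.le hδb.1.le le_rfl
    fun τ hτ => hγ.mem τ ⟨hδb.1.le.trans hτ.1, hτ.2⟩
  have hγm := hγ.mono (V := V) (a' := -δ) (b' := δ) (by linarith) hδa.1.le hδb.2.le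
    fun τ hτ => (hin τ hτ).2.2
  have hγm' := hγ.mono (V := U) (a' := -δ) (b' := δ) (by linarith) hδa.1.le hδb.2.le
    fun τ hτ => hVU (hin τ hτ).2.2
  refine ⟨(√Real.pi : ℝ) / κ, div_ne_zero ?_ hκ0, fun g hg => ?_⟩
  · exact_mod_cast (Real.sqrt_pos.2 Real.pi_pos).ne'
  obtain ⟨c, hc, hc0⟩ := hv.exists_hasExpansion hγm (fun τ hτ => by
      by_cases h : τ = 0
      · rw [h, h0, Complex.zero_re]
      · exact (hdom τ (Set.Ioo_subset_Icc_self (hin τ hτ).2.1) h).le) hwa hwb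
    (hdom _ (Set.Ioo_subset_Icc_self hδa) (neg_ne_zero.2 hδ0.ne'))
    (hdom _ (Set.Ioo_subset_Icc_self hδb) hδ0.ne') (hg.mono hVU)
  refine ⟨c, ?_, ?_⟩
  · obtain ⟨m₁, hm₁, hl⟩ := exists_neg_bound hγl hψ.continuousOn fun τ hτ =>
      hdom τ ⟨hτ.1, hτ.2.trans hδa.2.le⟩ (by
        rintro rfl
        linarith [hτ.2])
    obtain ⟨m₂, hm₂, hr⟩ := exists_neg_bound hγr hψ.continuousOn fun τ hτ =>
      hdom τ ⟨hδb.1.le.trans hτ.1, hτ.2⟩ (by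
        rintro rfl
        linarith [hτ.1])
    have e1 := HasExpansion.zero_of_isBigO_exp hm₁ (laplaceIntegral_isBigO hγl hg.continuousOn hl)
    have e2 := HasExpansion.zero_of_isBigO_exp hm₂ (laplaceIntegral_isBigO hγr hg.continuousOn hr)
    have := (e1.add hc).add e2
    simp only [Pi.zero_apply, zero_add, add_zero] at this
    refine this.congr' (Eventually.of_forall fun X => ?_)
    simp only [laplaceIntegral]
    rw [intervalIntegral.integral_add_adjacent_intervals
      (hγl.intervalIntegrable hψ.continuousOn hg.continuousOn X)
      (hγm'.intervalIntegrable hψ.continuousOn hg.continuousOn X),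
      intervalIntegral.integral_add_adjacent_intervals
      ((hγl.intervalIntegrable hψ.continuousOn hg.continuousOn X).trans
        (hγm'.intervalIntegrable hψ.continuousOn hg.continuousOn X))
      (hγr.intervalIntegrable hψ.continuousOn hg.continuousOn X)]
  · rw [hc0, hw0.deriv]
    ring

/-! ### The phase of the generating functions -/

section Phase

variable {p q : ℤ}

theorem hasDerivAt_phase (hpq : p + q ≠ 0) {z : ℂ} (hz : z ≠ 0) :
    HasDerivAt (phase p q) (q * z ^ (q - 1) - q * z ^ (p + q - 1)) z := by
  have hpq' : (p : ℂ) + q ≠ 0 := by exact_mod_cast hpq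
  refine ((hasDerivAt_zpow q z (Or.inl hz)).sub
    ((hasDerivAt_zpow (p + q) z (Or.inl hz)).const_mul _)).congr_deriv ?_
  push_cast
  field_simp

/-- The phase normalized to vanish at the saddle point `1`. -/
def reducedPhase (p q : ℤ) (z : ℂ) : ℂ := phase p q z - phase p q 1

theorem hasDerivAt_reducedPhase (hpq : p + q ≠ 0) {z : ℂ} (hz : z ≠ 0) :
    HasDerivAt (reducedPhase p q) (q * z ^ (q - 1) - q * z ^ (p + q - 1)) z :=
  (hasDerivAt_phase hpq hz).sub_const _

theorem differentiableOn_reducedPhase (hpq : p + q ≠ 0) :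
    DifferentiableOn ℂ (reducedPhase p q) Complex.slitPlane := fun _ hz =>
  (hasDerivAt_reducedPhase hpq
    (Complex.slitPlane_ne_zero hz)).differentiableAt.differentiableWithinAt

theorem hasDerivAt_deriv_reducedPhase (hpq : p + q ≠ 0) :
    HasDerivAt (deriv (reducedPhase p q)) (-2 * ((p : ℂ) * q / 2)) 1 := by
  have hev : deriv (reducedPhase p q) =ᶠ[𝓝 1]
      fun z => q * z ^ (q - 1) - q * z ^ (p + q - 1) := by
    filter_upwards [isOpen_ne.mem_nhds (one_ne_zero (α := ℂ))] with z hz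
    exact (hasDerivAt_reducedPhase hpq hz).deriv
  refine HasDerivAt.congr_of_eventuallyEq ?_ hev
  refine (((hasDerivAt_zpow (q - 1) (1 : ℂ) (Or.inl one_ne_zero)).const_mul _).sub
    ((hasDerivAt_zpow (p + q - 1) (1 : ℂ) (Or.inl one_ne_zero)).const_mul _)).congr_deriv ?_
  simp only [one_zpow]
  push_cast
  ring

theorem phase_one (hpq : p + q ≠ 0) : phase p q 1 = p / ((p : ℂ) + q) := by
  have hpq' : (p : ℂ) + q ≠ 0 := by exact_mod_cast hpq
  rw [phase, one_zpow, one_zpow]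
  field_simp
  ring

theorem differentiableOn_cpow (α : ℂ) : DifferentiableOn ℂ (fun z => z ^ α) Complex.slitPlane :=
  fun _ hz => (differentiableAt_id.cpow_const hz).differentiableWithinAt

/-- The one-sided derivative is used, since it is continuous up to the end points, where `deriv γ`
may take junk values. -/
theorem IsSaddlePath.isC1Path {γ : ℝ → ℂ} {a b : ℝ} (h : IsSaddlePath p q γ a b) :
    IsC1Path Complex.slitPlane γ (derivWithin γ (Set.Icc a b)) a b := by
  have hab : a < b := h.left_neg.trans h.right_pos
  refine ⟨hab.le, h.contDiffOn.continuousOn,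
    h.contDiffOn.continuousOn_derivWithin (uniqueDiffOn_Icc hab) le_rfl, fun τ hτ => ?_,
    h.mem_slitPlane⟩
  have hτ' := Icc_mem_nhds hτ.1 hτ.2
  have hd := (h.contDiffOn.differentiableOn one_ne_zero τ (Set.Ioo_subset_Icc_self hτ))
  exact hd.hasDerivWithinAt.hasDerivAt hτ'

/-- The moment `∫_γ z^α e^{X (φ(z) - φ(1))} dz`. -/
def moment (p q : ℤ) (γ : ℝ → ℂ) (a b : ℝ) (α : ℂ) : ℝ → ℂ :=
  laplaceIntegral γ (derivWithin γ (Set.Icc a b)) a b (reducedPhase p q) (fun z => z ^ α)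

theorem zpow_mul_cpow {z : ℂ} (hz : z ≠ 0) (n : ℤ) {α β : ℂ} (h : n + α = β) :
    z ^ n * z ^ α = z ^ β := by
  rw [← h, ← Complex.cpow_intCast, ← Complex.cpow_add _ _ hz]

/-- The integral of `d(z^{α - q + 1} e^{X ψ})`, where `ψ' = q z^{q - 1} - q z^{p + q - 1}`. -/
theorem IsSaddlePath.moment_by_parts (hpq : p + q ≠ 0) {γ : ℝ → ℂ} {a b : ℝ}
    (h : IsSaddlePath p q γ a b) (α : ℂ) (X : ℝ) :
    (α - q + 1) * moment p q γ a b (α - q) X +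
        X * (q * moment p q γ a b α X - q * moment p q γ a b (α + p) X) =
      γ b ^ (α - q + 1) * Complex.exp (X * reducedPhase p q (γ b)) -
        γ a ^ (α - q + 1) * Complex.exp (X * reducedPhase p q (γ a)) := by
  have hγ := h.isC1Path
  have hψ := differentiableOn_reducedPhase hpq
  have e0 := laplaceIntegral_deriv Complex.isOpen_slitPlane hγ hψ
    (differentiableOn_cpow (α - q + 1)) X
  have e1 : laplaceIntegral γ (derivWithin γ (Set.Icc a b)) a b (reducedPhase p q)
      (deriv fun z => z ^ (α - q + 1)) X = (α - q + 1) * moment p q γ a b (α - q) X := by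
    rw [moment, ← laplaceIntegral_const_mul]
    refine laplaceIntegral_congr hγ (fun z hz => ?_) X
    have := ((hasDerivAt_id z).cpow_const (c := α - q + 1) hz).deriv
    rw [mul_one, add_sub_cancel_right] at this
    exact this
  have e2 : laplaceIntegral γ (derivWithin γ (Set.Icc a b)) a b (reducedPhase p q)
      (fun z => deriv (reducedPhase p q) z * z ^ (α - q + 1)) X =
      q * moment p q γ a b α X + (-q) * moment p q γ a b (α + p) X := by
    rw [moment, moment, ← laplaceIntegral_const_mul, ← laplaceIntegral_const_mul]
    refine Eq.trans ?_ (laplaceIntegral_add hγ hψ.continuousOn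
      (g := fun z => (q : ℂ) * z ^ α) (h := fun z => (-q : ℂ) * z ^ (α + p))
      (continuousOn_const.mul (differentiableOn_cpow α).continuousOn)
      (continuousOn_const.mul (differentiableOn_cpow (α + p)).continuousOn) X)
    refine laplaceIntegral_congr hγ (fun z hz => ?_) X
    have hz0 := Complex.slitPlane_ne_zero hz
    have m1 : z ^ (q - 1) * z ^ (α - q + 1) = z ^ α := zpow_mul_cpow hz0 _ (by push_cast; ring)
    have m2 : z ^ (p + q - 1) * z ^ (α - q + 1) = z ^ (α + p) :=
      zpow_mul_cpow hz0 _ (by push_cast; ring)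
    rw [(hasDerivAt_reducedPhase hpq hz0).deriv, sub_mul, mul_assoc, mul_assoc, m1, m2]
    ring
  rw [e1, e2] at e0
  rw [sub_eq_add_neg (_ * _), ← neg_mul, e0]

/-- Differentiation with respect to `X` multiplies the integrand by
`ψ(z) = z^q - q / (p + q) z^{p + q} - p / (p + q)`. -/
theorem IsSaddlePath.hasDerivAt_moment (hpq : p + q ≠ 0) {γ : ℝ → ℂ} {a b : ℝ}
    (h : IsSaddlePath p q γ a b) (α : ℂ) (X : ℝ) :
    HasDerivAt (moment p q γ a b α) (moment p q γ a b (α + q) X -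
      q / ((p : ℂ) + q) * moment p q γ a b (α + p + q) X -
        p / ((p : ℂ) + q) * moment p q γ a b α X) X := by
  have hγ := h.isC1Path
  have hψ := differentiableOn_reducedPhase hpq
  refine (hasDerivAt_laplaceIntegral hγ hψ.continuousOn
    (differentiableOn_cpow α).continuousOn X).congr_deriv ?_
  have c1 := (differentiableOn_cpow (α + q)).continuousOn
  have c2 : ContinuousOn (fun z : ℂ => -(q / ((p : ℂ) + q)) * z ^ (α + p + q)) Complex.slitPlane :=
    continuousOn_const.mul (differentiableOn_cpow (α + p + q)).continuousOn
  have c3 : ContinuousOn (fun z : ℂ => -(p / ((p : ℂ) + q)) * z ^ α) Complex.slitPlane :=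
    continuousOn_const.mul (differentiableOn_cpow α).continuousOn
  have a1 := laplaceIntegral_add hγ hψ.continuousOn c1 c2 X
  have a2 := laplaceIntegral_add hγ hψ.continuousOn
    (g := fun z => z ^ (α + q) + -(q / ((p : ℂ) + q)) * z ^ (α + p + q)) (c1.add c2) c3 X
  rw [a1, laplaceIntegral_const_mul, laplaceIntegral_const_mul] at a2
  rw [moment, moment, moment, sub_eq_add_neg, sub_eq_add_neg, ← neg_mul, ← neg_mul, ← a2]
  refine laplaceIntegral_congr hγ (fun z hz => ?_) X
  have hz0 := Complex.slitPlane_ne_zero hz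
  have m1 : z ^ q * z ^ α = z ^ (α + q) := zpow_mul_cpow hz0 _ (by ring)
  have m2 : z ^ (p + q) * z ^ α = z ^ (α + p + q) := zpow_mul_cpow hz0 _ (by push_cast; ring)
  rw [reducedPhase, phase_one hpq, phase, ← m1, ← m2]
  ring

/-- Expansions of the moments, with a common leading coefficient, together with their recursion
relations: the first comes from integration by parts, the second from differentiation with respect
to `X`. -/
theorem IsSaddlePath.exists_expansions (hpq : p + q ≠ 0)
    {γ : ℝ → ℂ} {a b : ℝ} (h : IsSaddlePath p q γ a b) :
    ∃ (C : ℂ) (c : ℂ → ℕ → ℂ), C ≠ 0 ∧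
      (∀ α, HasExpansion (moment p q γ a b α) (c α)) ∧
      (∀ α, c α 0 = C) ∧
      (∀ α k, q * (c (α + p) (k + 1) - c α (k + 1)) = (α - q + 1) * c (α - q) k) ∧
      (∀ α k, c (α + q) (k + 1) - q / ((p : ℂ) + q) * c (α + p + q) (k + 1) -
        p / ((p : ℂ) + q) * c α (k + 1) = -((k : ℂ) + 1 / 2) * c α k) := by
  have hγ := h.isC1Path
  have hψ := differentiableOn_reducedPhase hpq
  have hab0 : (0 : ℝ) ∈ Set.Ioo a b := ⟨h.left_neg, h.right_pos⟩
  have hdom : ∀ τ ∈ Set.Icc a b, τ ≠ 0 → (reducedPhase p q (γ τ)).re < 0 := by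
    intro τ hτ hτ0
    rw [reducedPhase, Complex.sub_re]
    exact sub_neg.2 (h.dominant τ hτ hτ0)
  obtain ⟨C, hC, hexp⟩ := exists_hasExpansion_of_saddle Complex.isOpen_slitPlane hγ h.left_neg
    h.right_pos hψ
    (by rw [h.saddle, reducedPhase, sub_self])
    (by rw [h.saddle, (hasDerivAt_reducedPhase hpq one_ne_zero).deriv]; simp)
    (s := (p : ℂ) * q / 2)
    (by rw [h.saddle]; exact hasDerivAt_deriv_reducedPhase hpq)
    (by
      have hd := h.descent
      rw [(hγ.hasDerivAt 0 hab0).deriv] at hd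
      have : (p : ℂ) * q / 2 * derivWithin γ (Set.Icc a b) 0 ^ 2 =
          ((1 / 2 : ℝ) : ℂ) * ((p : ℂ) * q * derivWithin γ (Set.Icc a b) 0 ^ 2) := by
        push_cast
        ring
      rw [this, Complex.re_ofReal_mul]
      positivity) hdom
  choose! c hc hc0 using fun α : ℂ => hexp (fun z => z ^ α) (differentiableOn_cpow α)
  have hc' : ∀ α, HasExpansion (moment p q γ a b α) (c α) := hc
  refine ⟨C, c, hC, hc', fun α => by rw [hc0, h.saddle, Complex.one_cpow, mul_one], fun α k => ?_,
    fun α k => ?_⟩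
  · let R : ℝ → ℂ := fun X => γ b ^ (α - q + 1) * Complex.exp (X * reducedPhase p q (γ b)) -
      γ a ^ (α - q + 1) * Complex.exp (X * reducedPhase p q (γ a))
    have hR : HasExpansion R 0 := by
      have : HasExpansion R (fun k => (0 : ℕ → ℂ) k - (0 : ℕ → ℂ) k) :=
        (HasExpansion.const_mul_exp _ (hdom b (Set.right_mem_Icc.2 hγ.le) h.right_pos.ne')).sub
          (HasExpansion.const_mul_exp _ (hdom a (Set.left_mem_Icc.2 hγ.le) h.left_neg.ne))
      convert this using 1
      funext k
      simp
    have x1 := ((hc' (α - q)).const_mul (α - q + 1)).inv_mul.add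
      (((hc' α).const_mul q).sub ((hc' (α + p)).const_mul q))
    have x2 := hR.inv_mul
    have heq : (fun X : ℝ => (X : ℂ)⁻¹ * ((α - q + 1) * moment p q γ a b (α - q) X) +
        (q * moment p q γ a b α X - q * moment p q γ a b (α + p) X))
        =ᶠ[atTop] fun X : ℝ => (X : ℂ)⁻¹ * R X := by
      filter_upwards [eventually_gt_atTop 0] with X hX
      have hX' : (X : ℂ) ≠ 0 := by exact_mod_cast hX.ne'
      have := h.moment_by_parts hpq α X
      simp only [R]
      rw [← this, mul_add, inv_mul_cancel_left₀ hX']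
    have := congrFun ((x1.congr' heq).unique x2) (k + 1)
    simp only [if_neg (Nat.succ_ne_zero k), Nat.add_sub_cancel, Pi.zero_apply] at this
    linear_combination -this
  · have x1 := ((hc' (α + q)).sub ((hc' (α + p + q)).const_mul (q / ((p : ℂ) + q)))).sub
      ((hc' α).const_mul (p / ((p : ℂ) + q)))
    have hcont : ∀ β, Continuous (moment p q γ a b β) := fun β =>
      continuous_iff_continuousAt.2 fun X => (h.hasDerivAt_moment hpq β X).continuousAt
    exact (hc' α).deriv_coeff x1 (fun X _ => h.hasDerivAt_moment hpq α X)
      (Continuous.continuousOn (((hcont _).sub (continuous_const.mul (hcont _))).sub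
        (continuous_const.mul (hcont _)))) k

end Phase

/-! ### Matrices of asymptotic coefficients -/

theorem eventually_limitFilter (ε : ℤˣ) :
    ∀ᶠ l : ℝ in limitFilter ε, 0 < l ∧ 1 ≤ l ^ (ε : ℤ) := by
  rcases Int.units_eq_one_or ε with rfl | rfl
  · rw [limitFilter, if_pos rfl]
    filter_upwards [eventually_ge_atTop 1] with l hl
    exact ⟨by linarith, by simpa using hl⟩
  · rw [limitFilter, if_neg (by decide)]
    filter_upwards [Ioo_mem_nhdsGT (one_pos (α := ℝ))] with l hl
    refine ⟨hl.1, ?_⟩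
    rw [Units.val_neg, Units.val_one, zpow_neg_one]
    exact (one_le_inv₀ hl.1).2 hl.2.le

theorem tendsto_limitFilter_zpow (ε : ℤˣ) :
    Tendsto (fun l : ℝ => l ^ (ε : ℤ)) (limitFilter ε) atTop := by
  rcases Int.units_eq_one_or ε with rfl | rfl
  · rw [limitFilter, if_pos rfl]
    simpa using! tendsto_id
  · rw [limitFilter, if_neg (by decide)]
    simpa using tendsto_inv_nhdsGT_zero (𝕜 := ℝ)

instance (ε : ℤˣ) : NeBot (limitFilter ε) := by
  rw [limitFilter]
  split_ifs <;> infer_instance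

/-- The monomials of the asymptotic expansions decrease. -/
theorem isBigO_limitFilter_zpow (ε : ℤˣ) (j : ℤ) {m n : ℕ} (h : m ≤ n) :
    (fun l : ℝ => l ^ (-(j + (ε : ℤ) * n) - 1)) =O[limitFilter ε]
      fun l : ℝ => l ^ (-(j + (ε : ℤ) * m) - 1) := by
  refine IsBigO.of_bound 1 ?_
  filter_upwards [eventually_limitFilter ε] with l ⟨hl, hl1⟩
  obtain ⟨k, rfl⟩ := Nat.exists_eq_add_of_le h
  have h1 : l ^ (-(j + (ε : ℤ) * m) - 1) =
      l ^ (-(j + (ε : ℤ) * (m + k : ℕ)) - 1) * (l ^ (ε : ℤ)) ^ k := by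
    rw [← zpow_natCast, ← zpow_mul, ← zpow_add₀ hl.ne']
    congr 1
    push_cast
    ring
  rw [one_mul, h1, Real.norm_of_nonneg (zpow_pos hl _).le, Real.norm_of_nonneg (by positivity)]
  exact le_mul_of_one_le_right (zpow_pos hl _).le (one_le_pow₀ hl1)

/-- Asymptotic coefficients are unique. -/
theorem IsAsymptoticMatrix.unique {ε : ℤˣ} {f : ℤ → ℝ → ℂ} {u u' : Matrix ℤ ℤ ℂ}
    (hu : IsAsymptoticMatrix ε f u) (hu' : IsAsymptoticMatrix ε f u') : u = u' := by
  have hz : ∀ (j : ℤ) (n : ℕ), u (j + (ε : ℤ) * n) j = u' (j + (ε : ℤ) * n) j := by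
    intro j n
    induction n using Nat.strong_induction_on with
    | _ n ih =>
      have h1 := (hu'.expansion j (n + 1)).sub (hu.expansion j (n + 1))
      obtain ⟨C, hC⟩ := isBigO_iff.1 h1
      have hle : ∀ᶠ l : ℝ in limitFilter ε,
          ‖u (j + (ε : ℤ) * n) j - u' (j + (ε : ℤ) * n) j‖ ≤ C * (l ^ (ε : ℤ))⁻¹ := by
        filter_upwards [hC, eventually_limitFilter ε] with l hX hl
        replace hl := hl.1
        rw [sub_sub_sub_cancel_left, ← Finset.sum_sub_distrib, Finset.sum_range_succ,
          Finset.sum_eq_zero fun k hk => by rw [ih k (Finset.mem_range.1 hk), sub_self],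
          zero_add, ← mul_sub, norm_mul, norm_zpow, Complex.norm_real,
          Real.norm_of_nonneg (zpow_pos hl _).le, Real.norm_of_nonneg hl.le] at hX
        have h2 : l ^ (-(j + (ε : ℤ) * (n + 1 : ℕ)) - 1) =
            l ^ (-(j + (ε : ℤ) * n) - 1) * (l ^ (ε : ℤ))⁻¹ := by
          rw [← zpow_neg, ← zpow_add₀ hl.ne']
          congr 1
          push_cast
          ring
        rw [h2, mul_left_comm] at hX
        exact le_of_mul_le_mul_left hX (zpow_pos hl _)
      have hlim : Tendsto (fun l : ℝ => C * (l ^ (ε : ℤ))⁻¹) (limitFilter ε) (𝓝 0) := by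
        simpa using (tendsto_inv_atTop_zero.comp (tendsto_limitFilter_zpow ε)).const_mul C
      have := ge_of_tendsto hlim hle
      exact sub_eq_zero.1 (norm_le_zero_iff.1 this)
  refine Matrix.ext fun i j => ?_
  by_cases h : 0 < (ε : ℤ) * (j - i)
  · rw [hu.triangular i j h, hu'.triangular i j h]
  · have hi : i = j + (ε : ℤ) * ((ε : ℤ) * (i - j)).toNat := by
      have h1 : (ε : ℤ) * (i - j) = -((ε : ℤ) * (j - i)) := by ring
      rw [Int.toNat_of_nonneg (by omega), ← mul_assoc, Int.units_coe_mul_self, one_mul]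
      ring
    rw [hi, hz]

/-- Coefficients `A_j(k)` placed in row `j + k n` of column `j`. -/
def stepMatrix (n : ℤ) (A : ℤ → ℕ → ℂ) : Matrix ℤ ℤ ℂ := fun i j =>
  if n ∣ i - j ∧ 0 ≤ (i - j) / n then A j ((i - j) / n).toNat else 0

theorem stepMatrix_apply {n : ℤ} (hn : n ≠ 0) (A : ℤ → ℕ → ℂ) {i j : ℤ} (k : ℕ)
    (h : i = j + n * k) : stepMatrix n A i j = A j k := by
  have h1 : i - j = n * k := by rw [h]; ring
  rw [stepMatrix, h1, Int.mul_ediv_cancel_left _ hn, if_pos ⟨dvd_mul_right _ _, by omega⟩,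
    Int.toNat_natCast]

theorem stepMatrix_of_ne {n : ℤ} (hn : n ≠ 0) (A : ℤ → ℕ → ℂ) {i j : ℤ}
    (h : ∀ k : ℕ, i ≠ j + n * k) : stepMatrix n A i j = 0 := by
  rw [stepMatrix, if_neg]
  rintro ⟨⟨k, hk⟩, h1⟩
  rw [hk, Int.mul_ediv_cancel_left _ hn] at h1
  obtain ⟨k, rfl⟩ := Int.eq_ofNat_of_zero_le h1
  exact h k (by rw [← hk]; ring)

theorem isTriangular_stepMatrix {ε : ℤˣ} {n : ℤ} (hn : 0 < (ε : ℤ) * n) (A : ℤ → ℕ → ℂ) :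
    IsTriangular ε (stepMatrix n A) := by
  intro i j h
  have hn0 : n ≠ 0 := by
    rintro rfl
    simp at hn
  refine stepMatrix_of_ne hn0 A fun k hk => ?_
  have h1 : (ε : ℤ) * (j - i) = -((ε * n) * k) := by rw [hk]; ring
  have h2 : 0 ≤ (ε * n : ℤ) * k := by positivity
  omega

/-- An expansion in powers of `X = l^n / ħ` is an expansion in powers of `l`. -/
theorem isAsymptoticMatrix_stepMatrix {ε : ℤˣ} {n : ℤ} (hn : 0 < (ε : ℤ) * n)
    {A : ℤ → ℕ → ℂ} {f : ℤ → ℝ → ℂ}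
    (h : ∀ (j : ℤ) (K : ℕ), (fun l : ℝ => f j l - ∑ k ∈ Finset.range K,
      (l : ℂ) ^ (-(j + n * k) - 1) * A j k) =O[limitFilter ε]
        fun l : ℝ => l ^ (-(j + n * K) - 1)) :
    IsAsymptoticMatrix ε f (stepMatrix n A) := by
  have hn0 : n ≠ 0 := by
    rintro rfl
    simp at hn
  obtain ⟨d, hd⟩ := Int.eq_ofNat_of_zero_le hn.le
  have hd0 : 0 < d := by omega
  have hnd : n = ε * d := by
    rw [← hd, ← mul_assoc, Int.units_coe_mul_self, one_mul]
  refine ⟨isTriangular_stepMatrix hn A, fun j N => ?_⟩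
  have hterm : ∀ m : ℕ, (fun l : ℝ => (l : ℂ) ^ (-(j + (ε : ℤ) * m) - 1) *
      stepMatrix n A (j + (ε : ℤ) * m) j) =O[limitFilter ε]
        fun l : ℝ => l ^ (-(j + (ε : ℤ) * m) - 1) := by
    intro m
    simp_rw [mul_comm _ (stepMatrix n A (j + (ε : ℤ) * m) j)]
    refine IsBigO.const_mul_left (isBigO_of_le _ fun l => ?_) _
    rw [norm_zpow, norm_zpow, Complex.norm_real]
  -- expansions up to a multiple of `d`
  have hmult : ∀ K : ℕ, (fun l : ℝ => f j l - ∑ m ∈ Finset.range (d * K),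
      (l : ℂ) ^ (-(j + (ε : ℤ) * m) - 1) * stepMatrix n A (j + (ε : ℤ) * m) j)
        =O[limitFilter ε] fun l : ℝ => l ^ (-(j + (ε : ℤ) * (d * K : ℕ)) - 1) := by
    intro K
    have hK := h j K
    have e1 : j + n * K = j + (ε : ℤ) * (d * K : ℕ) := by
      rw [hnd]
      push_cast
      ring
    rw [e1] at hK
    refine hK.congr_left fun l => ?_
    congr 1
    have e2 : ∀ k : ℕ, (l : ℂ) ^ (-(j + n * k) - 1) * A j k =
        (l : ℂ) ^ (-(j + (ε : ℤ) * (d * k : ℕ)) - 1) *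
          stepMatrix n A (j + (ε : ℤ) * (d * k : ℕ)) j := by
      intro k
      have e3 : j + (ε : ℤ) * (d * k : ℕ) = j + n * k := by
        rw [hnd]
        push_cast
        ring
      rw [e3, stepMatrix_apply hn0 A k rfl]
    rw [Finset.sum_congr rfl fun k _ => e2 k]
    rw [← Finset.sum_image (s := Finset.range K) (g := fun k => d * k)
      (f := fun m : ℕ => (l : ℂ) ^ (-(j + (ε : ℤ) * m) - 1) *
        stepMatrix n A (j + (ε : ℤ) * m) j)
      (fun x _ y _ hxy => Nat.eq_of_mul_eq_mul_left hd0 hxy)]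
    refine Finset.sum_subset (fun m hm => ?_) fun m hm hm' => ?_
    · obtain ⟨k, hk, rfl⟩ := Finset.mem_image.1 hm
      exact Finset.mem_range.2 (Nat.mul_lt_mul_of_pos_left (Finset.mem_range.1 hk) hd0)
    · rw [stepMatrix_of_ne hn0, mul_zero]
      intro k hk
      refine hm' (Finset.mem_image.2 ⟨k, Finset.mem_range.2 ?_, ?_⟩)
      all_goals
        have e4 : m = d * k := by
          rw [hnd, mul_assoc, add_right_inj] at hk
          exact_mod_cast mul_left_cancel₀ ε.ne_zero hk
      · rw [e4, Finset.mem_range] at hm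
        exact lt_of_mul_lt_mul_left hm hd0.le
      · exact e4.symm
  have hNle : N ≤ d * N := Nat.le_mul_of_pos_left N hd0
  have h1 := (hmult N).trans (isBigO_limitFilter_zpow ε j hNle)
  have h2 : (∑ m ∈ Finset.Ico N (d * N), fun l : ℝ => (l : ℂ) ^ (-(j + (ε : ℤ) * m) - 1) *
      stepMatrix n A (j + (ε : ℤ) * m) j) =O[limitFilter ε]
        fun l : ℝ => l ^ (-(j + (ε : ℤ) * N) - 1) :=
    IsBigO.sum fun m hm => (hterm m).trans
      (isBigO_limitFilter_zpow ε j (Finset.mem_Ico.1 hm).1)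
  refine (h1.add h2).congr_left fun l => ?_
  rw [← Finset.sum_range_add_sum_Ico _ hNle, Finset.sum_apply]
  ring

/-! ### The generating functions for `p + q ≠ 0` -/

section GenFun

variable {p q : ℤ}

/-- The exponent `(q - 1)/2 - j - 1` of `μ` in the generating function `u_j`. -/
def exponent (q j : ℤ) : ℂ := ((q : ℂ) - 1) / 2 - j - 1

/-- The substitution `μ = l z`; the prefactor of the generating function supplies the subtraction of
`φ(1) = p / (p + q)` in the exponent. The derivatives `deriv γ` and `derivWithin γ` agree except
possibly at the two end points. -/
theorem genFun_eq (hpq : p + q ≠ 0) {hbar : ℝ} (const : ℂ) {γ : ℝ → ℂ} {a b : ℝ}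
    (h : IsSaddlePath p q γ a b) (j : ℤ) {l : ℝ} (hl : 0 < l) :
    genFun p q hbar const γ a b j l =
      const * (l : ℂ) ^ (((p : ℂ) + q) / 2 - j - 1) *
        moment p q γ a b (exponent q j) (l ^ (p + q) / hbar) := by
  have hγ := h.isC1Path
  have hl0 : (l : ℂ) ≠ 0 := by exact_mod_cast hl.ne'
  have hder : ∀ τ ∈ Set.Ioo a b, deriv γ τ = derivWithin γ (Set.Icc a b) τ := fun τ hτ =>
    (hγ.hasDerivAt τ hτ).deriv
  have hpow : (l : ℂ) ^ (((p : ℂ) + q) / 2 - j - 1) =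
      (l : ℂ) ^ (((p : ℂ) - 1) / 2) * (l : ℂ) ^ exponent q j * l := by
    nth_rewrite 4 [← Complex.cpow_one (l : ℂ)]
    rw [← Complex.cpow_add _ _ hl0, ← Complex.cpow_add _ _ hl0, exponent]
    congr 1
    ring
  rw [genFun, prefactor, moment, laplaceIntegral, hpow, ← intervalIntegral.integral_const_mul,
    ← intervalIntegral.integral_const_mul]
  refine intervalIntegral.integral_congr_Ioo_of_le hγ.le fun τ hτ => ?_
  have hτ0 := Complex.slitPlane_ne_zero (hγ.mem τ (Set.Ioo_subset_Icc_self hτ))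
  have m1 : ((l : ℂ) * γ τ) ^ (((q : ℂ) - 1) / 2 - j - 1) =
      (l : ℂ) ^ exponent q j * γ τ ^ exponent q j := by
    rw [exponent, Complex.cpow_def_of_ne_zero (mul_ne_zero hl0 hτ0),
      Complex.cpow_def_of_ne_zero hl0, Complex.cpow_def_of_ne_zero hτ0, ← Complex.exp_add,
      Complex.log_ofReal_mul hl hτ0, Complex.ofReal_log hl.le, add_mul]
  have m2 : Complex.exp ((hbar : ℂ)⁻¹ * (-(p : ℂ) / ((p : ℂ) + q) * (l : ℂ) ^ (p + q))) *
      Complex.exp ((hbar : ℂ)⁻¹ * ((l : ℂ) ^ p * ((l : ℂ) * γ τ) ^ q -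
        (q : ℂ) / ((p : ℂ) + q) * ((l : ℂ) * γ τ) ^ (p + q))) =
      Complex.exp (((l ^ (p + q) / hbar : ℝ) : ℂ) * reducedPhase p q (γ τ)) := by
    rw [← Complex.exp_add, reducedPhase, phase_one hpq, phase, mul_zpow, mul_zpow,
      ← mul_assoc ((l : ℂ) ^ p), ← zpow_add₀ hl0]
    push_cast
    congr 1
    ring
  simp only [integrand]
  rw [hder τ hτ, m1, ← m2]
  ring

/-- The powers of `l` and `X = l^n / ħ` combine to integer powers of `l`. -/
theorem rpow_mul_rpow_zpow_div {l hbar : ℝ} (hl : 0 < l) (hh : 0 < hbar) (n j : ℤ) (k : ℕ) :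
    l ^ ((n : ℝ) / 2 - j - 1) * (l ^ n / hbar) ^ (-(k : ℝ) - 1 / 2) =
      hbar ^ ((k : ℝ) + 1 / 2) * l ^ (-(j + n * k) - 1) := by
  have h1 : (l ^ n / hbar) ^ (-(k : ℝ) - 1 / 2) =
      l ^ ((n : ℝ) * (-(k : ℝ) - 1 / 2)) * hbar ^ ((k : ℝ) + 1 / 2) := by
    rw [Real.div_rpow (zpow_pos hl n).le hh.le, ← Real.rpow_intCast, ← Real.rpow_mul hl.le,
      show -(k : ℝ) - 1 / 2 = -((k : ℝ) + 1 / 2) by ring, Real.rpow_neg hh.le, div_inv_eq_mul]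
  rw [h1, ← mul_assoc, ← Real.rpow_add hl, mul_comm, ← Real.rpow_intCast]
  congr 2
  push_cast
  ring

/-- The asymptotic coefficients of the generating functions form a triangular matrix with nonzero
diagonal that satisfies the numerical string equations. -/
theorem exists_isAsymptoticMatrix_genFun (hp : p ≠ 0) (hq : q ≠ 0) {ε : ℤˣ}
    (hε : 0 < (ε : ℤ) * (p + q)) {hbar : ℝ} (hh : 0 < hbar) {const : ℂ} (hconst : const ≠ 0)
    {γ : ℝ → ℂ} {a b : ℝ} (h : IsSaddlePath p q γ a b) :
    ∃ u : Matrix ℤ ℤ ℂ, IsAsymptoticMatrix ε (genFun p q hbar const γ a b) u ∧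
      (∀ i, u i i ≠ 0) ∧
      (∀ i j, u (i + p) j = (hbar : ℂ) / q * (j + (q + 1) / 2) * u i (j + q) + u i (j - p)) ∧
      (∀ i j, u i (j - q) =
        (hbar : ℂ) / p * ((p - 1) / 2 - i) * u (i - p) j + u (i + q) j) := by
  have hpq : p + q ≠ 0 := by
    intro h0
    rw [h0, mul_zero] at hε
    exact lt_irrefl _ hε
  have hp' : (p : ℂ) ≠ 0 := by exact_mod_cast hp
  have hq' : (q : ℂ) ≠ 0 := by exact_mod_cast hq
  have hpq' : (p : ℂ) + q ≠ 0 := by exact_mod_cast hpq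
  obtain ⟨C, c, hC, hc, hc0, r1, r2⟩ := h.exists_expansions hpq
  let A : ℤ → ℕ → ℂ := fun j k =>
    const * ((hbar ^ ((k : ℝ) + 1 / 2) : ℝ) : ℂ) * c (exponent q j) k
  have hA0 : ∀ j, A j 0 = const * ((hbar ^ (((0 : ℕ) : ℝ) + 1 / 2) : ℝ) : ℂ) * C := fun j => by
    simp only [A, hc0]
  have hpow : ∀ k : ℕ, ((hbar ^ (((k + 1 : ℕ) : ℝ) + 1 / 2) : ℝ) : ℂ) =
      hbar * ((hbar ^ ((k : ℝ) + 1 / 2) : ℝ) : ℂ) := by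
    intro k
    rw [← Complex.ofReal_mul]
    congr 1
    nth_rewrite 2 [← Real.rpow_one hbar]
    rw [← Real.rpow_add hh]
    congr 1
    push_cast
    ring
  -- the two recursions in terms of the coefficients `A_j(k) = u_{j + k (p + q), j}`
  have s1 : ∀ j k, A j (k + 1) =
      (hbar : ℂ) / q * (j + (q + 1) / 2) * A (j + q) k + A (j - p) (k + 1) := by
    intro j k
    have e1 : exponent q (j - p) = exponent q j + p := by
      simp only [exponent]
      push_cast
      ring
    have e2 : exponent q (j + q) = exponent q j - q := by
      simp only [exponent]
      push_cast
      ring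
    have e3 : exponent q j - q + 1 = -((j : ℂ) + (q + 1) / 2) := by
      simp only [exponent]
      ring
    have r := r1 (exponent q j) k
    rw [e3] at r
    have key : c (exponent q j) (k + 1) = 1 / q * (j + (q + 1) / 2) * c (exponent q j - q) k +
        c (exponent q j + p) (k + 1) := by
      field_simp
      linear_combination -2 * r
    simp only [A]
    rw [e1, e2, hpow, key]
    ring
  have s2 : ∀ j k, A (j - q) (k + 1) = (hbar : ℂ) / p *
      ((p - 1) / 2 - (j - q + (p + q) * (k + 1 : ℕ) : ℤ)) * A j k + A j (k + 1) := by
    intro j k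
    have e1 : exponent q (j - q) = exponent q j + q := by
      simp only [exponent]
      push_cast
      ring
    have r := r1 (exponent q j + q) k
    rw [add_sub_cancel_right, show exponent q j + q + p = exponent q j + p + q by ring] at r
    have r' := r2 (exponent q j) k
    have key : c (exponent q j + q) (k + 1) = 1 / p *
        ((p - 1) / 2 - (j - q + (p + q) * (k + 1 : ℕ) : ℤ)) * c (exponent q j) k +
          c (exponent q j) (k + 1) := by
      have e3 : exponent q j + 1 = ((q : ℂ) - 1) / 2 - j := by
        simp only [exponent]
        ring
      rw [e3] at r
      generalize c (exponent q j + q) (k + 1) = x at *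
      generalize c (exponent q j + p + q) (k + 1) = y at *
      generalize c (exponent q j) (k + 1) = z at *
      generalize c (exponent q j) k = t at *
      push_cast
      field_simp at r r' ⊢
      linear_combination r' + r
    simp only [A]
    rw [e1, hpow, key]
    ring
  -- an entry vanishes unless it lies `k (p + q)` rows below the diagonal for some `k ≥ 0`; for
  -- `k = 0` the recursions hold since the leading coefficients agree
  have hstep : ∀ (i j : ℤ), (∃ k : ℕ, i = j + (p + q) * k) ∨ ∀ k : ℕ, i ≠ j + (p + q) * k := by
    intro i j
    by_cases hk : ∃ k : ℕ, i = j + (p + q) * k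
    · exact Or.inl hk
    · exact Or.inr fun k hk' => hk ⟨k, hk'⟩
  refine ⟨stepMatrix (p + q) A, isAsymptoticMatrix_stepMatrix hε fun j K => ?_, fun i => ?_,
    fun i j => ?_, fun i j => ?_⟩
  · have htend : Tendsto (fun l : ℝ => l ^ (p + q) / hbar) (limitFilter ε) atTop := by
      refine Tendsto.atTop_div_const hh ?_
      obtain ⟨d, hd⟩ := Int.eq_ofNat_of_zero_le hε.le
      have hnd : p + q = ε * d := by
        rw [← hd, ← mul_assoc, Int.units_coe_mul_self, one_mul]
      have hd0 : d ≠ 0 := by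
        rintro rfl
        rw [hd] at hε
        simp at hε
      refine ((tendsto_pow_atTop hd0).comp (tendsto_limitFilter_zpow ε)).congr fun l => ?_
      rw [Function.comp_apply, hnd, zpow_mul, zpow_natCast]
    have hO := (hc (exponent q j) K).comp_tendsto htend
    have hcast : ∀ l : ℝ, 0 < l → ((l ^ ((((p + q : ℤ) : ℝ)) / 2 - j - 1) : ℝ) : ℂ) =
        (l : ℂ) ^ (((p : ℂ) + q) / 2 - j - 1) := by
      intro l hl
      rw [Complex.ofReal_cpow hl.le]
      congr 1
      push_cast
      ring
    have hP : (fun l : ℝ => const * ((l ^ ((((p + q : ℤ) : ℝ)) / 2 - j - 1) : ℝ) : ℂ))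
        =O[limitFilter ε] fun l : ℝ => l ^ ((((p + q : ℤ) : ℝ)) / 2 - j - 1) :=
      IsBigO.const_mul_left (isBigO_of_le _ fun l => by rw [Complex.norm_real]) _
    have hbound : (fun l : ℝ => l ^ ((((p + q : ℤ) : ℝ)) / 2 - j - 1) *
        (l ^ (p + q) / hbar) ^ (-(K : ℝ) - 1 / 2)) =O[limitFilter ε]
          fun l : ℝ => l ^ (-(j + (p + q) * K) - 1) := by
      refine (((isBigO_refl _ _).const_mul_left (hbar ^ ((K : ℝ) + 1 / 2)))).congr' ?_
        EventuallyEq.rfl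
      filter_upwards [eventually_limitFilter ε] with l hl
      exact (rpow_mul_rpow_zpow_div hl.1 hh (p + q) j K).symm
    refine ((hP.mul hO).trans hbound).congr' ?_ EventuallyEq.rfl
    filter_upwards [eventually_limitFilter ε] with l hl
    rw [genFun_eq hpq const h j hl.1, Function.comp_apply, mul_sub, ← hcast l hl.1, Finset.mul_sum]
    congr 1
    refine Finset.sum_congr rfl fun k _ => ?_
    have hk := congrArg (fun x : ℝ => (x : ℂ)) (rpow_mul_rpow_zpow_div hl.1 hh (p + q) j k)
    simp only [Complex.ofReal_mul, Complex.ofReal_zpow] at hk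
    simp only [A]
    linear_combination const * c (exponent q j) k * hk
  · rw [stepMatrix_apply hpq A 0 (by simp), hA0]
    exact mul_ne_zero (mul_ne_zero hconst (by exact_mod_cast (Real.rpow_pos_of_pos hh _).ne')) hC
  · rcases hstep (i + p) j with ⟨k, hk⟩ | hk
    · rw [stepMatrix_apply hpq A k hk, stepMatrix_apply hpq A (j := j - p) k (by linarith)]
      cases k with
      | zero =>
        rw [stepMatrix_of_ne hpq A fun k' hk' => ?_, mul_zero, zero_add, hA0, hA0]
        have h1 : (p + q) * ((k' : ℤ) + 1) = 0 := by
          push_cast at hk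
          linear_combination hk - hk'
        exact mul_ne_zero hpq (by omega) h1
      | succ k =>
        rw [stepMatrix_apply hpq A (j := j + q) k (by push_cast at hk; linear_combination hk), s1]
    · rw [stepMatrix_of_ne hpq A hk, stepMatrix_of_ne hpq A fun k' hk' =>
        hk (k' + 1) (by push_cast; linear_combination hk'),
        stepMatrix_of_ne hpq A fun k' hk' => hk k' (by linear_combination hk')]
      ring
  · rcases hstep (i + q) j with ⟨k, hk⟩ | hk
    · rw [stepMatrix_apply hpq A k hk, stepMatrix_apply hpq A (j := j - q) k (by linarith)]
      cases k with
      | zero =>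
        rw [stepMatrix_of_ne hpq A fun k' hk' => ?_, mul_zero, zero_add, hA0, hA0]
        have h1 : (p + q) * ((k' : ℤ) + 1) = 0 := by
          push_cast at hk
          linear_combination hk - hk'
        exact mul_ne_zero hpq (by omega) h1
      | succ k =>
        rw [stepMatrix_apply hpq A (j := j) k (by push_cast at hk; linear_combination hk), s2,
          show i = j - q + (p + q) * (k + 1 : ℕ) by linear_combination hk]
    · rw [stepMatrix_of_ne hpq A hk,
        stepMatrix_of_ne hpq A fun k' hk' => hk k' (by linear_combination hk'),
        stepMatrix_of_ne hpq A fun k' hk' =>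
          hk (k' + 1) (by push_cast; linear_combination hk')]
      ring

end GenFun

end Toda

end

theorem mainTheorem1 (p q : ℤ) (hp : p ≠ 0) (hq : q ≠ 0) (hbar : ℝ) :
    -- the case `p + q ≠ 0`: the matrix of asymptotic coefficients of `u_j(λ)`
    (∀ ε : ℤˣ, 0 < (ε : ℤ) * (p + q) → 0 < hbar →
      ∀ const : ℂ, const ≠ 0 →
      ∀ (γ : ℝ → ℂ) (a b : ℝ), Toda.IsSaddlePath p q γ a b →
        (∃! u : Matrix ℤ ℤ ℂ,
          Toda.IsAsymptoticMatrix ε (Toda.genFun p q hbar const γ a b) u) ∧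
        ∀ (u : Matrix ℤ ℤ ℂ)
          (hu : Toda.IsAsymptoticMatrix ε (Toda.genFun p q hbar const γ a b) u),
          (∃! V : (Toda.Op ε)ˣ × (Toda.Op ε)ˣ,
            Toda.IsDressing (hbar : ℂ) u hu.triangular V.1 V.2) ∧
          ∀ W Wbar : (Toda.Op ε)ˣ, Toda.IsDressing (hbar : ℂ) u hu.triangular W Wbar →
            Toda.StringEquations p q (hbar : ℂ) W Wbar) ∧
    -- the case `p + q = 0`: `u_j(λ)` is a monomial in `λ`, and the matrix is diagonal
    (p + q = 0 → hbar ≠ 0 → Toda.GammaRegular p hbar →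
      (hbar < 0 → ∀ j : ℤ, 0 < Toda.gammaArg p hbar j → ∀ l : ℝ, 0 < l →
        MeasureTheory.IntegrableOn (Toda.degenerateIntegrand p q hbar j l) (Set.Ioi 0) ∧
        ((Toda.degeneratePrefactor p hbar l *
            ∫ μ in Set.Ioi (0 : ℝ), Toda.degenerateIntegrand p q hbar j l μ : ℝ) : ℂ) =
          (l : ℂ) ^ (-j - 1) * Toda.gammaMatrix p hbar j j) ∧
      ∀ ε : ℤˣ,
        (∃! V : (Toda.Op ε)ˣ × (Toda.Op ε)ˣ,
          Toda.IsDressing (hbar : ℂ) (Toda.gammaMatrix p hbar)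
            (Toda.isTriangular_gammaMatrix ε p hbar) V.1 V.2) ∧
        ∀ W Wbar : (Toda.Op ε)ˣ,
          Toda.IsDressing (hbar : ℂ) (Toda.gammaMatrix p hbar)
            (Toda.isTriangular_gammaMatrix ε p hbar) W Wbar →
          Toda.StringEquations p q (hbar : ℂ) W Wbar) := by
  refine ⟨fun ε hε hh const hconst γ a b hγ => ?_, fun hpq hh hr => ⟨fun hneg j hj l hl => ?_,
    Toda.gammaMatrix_solution hp hq hpq hh hr⟩⟩
  · obtain ⟨u, hu, hdiag, h1, h2⟩ :=
      Toda.exists_isAsymptoticMatrix_genFun hp hq hε hh hconst hγ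
    refine ⟨⟨u, hu, fun u' hu' => hu'.unique hu⟩, fun u' hu' => ?_⟩
    obtain rfl := hu'.unique hu
    exact ⟨Toda.existsUnique_isDressing _ _ _ hdiag, fun W Wbar h =>
      Toda.stringEquations_of_recursion (by exact_mod_cast hh.ne') _ h1 h2 hp hq h⟩
  · exact ⟨(Toda.integral_degenerateIntegrand hp hpq hneg hj hl).1,
      Toda.degenerate_generating_function hp hpq hneg hj hl⟩
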